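/- **Definitions.** Let $G=(V,E)$ be a finite simple graph with positive edge weights $w$. For a capacity function $b:V\to\mathbb{N}_{+}$ put $b^*=\max_{i\in V} b(i)$ (with $b^*=0$ if $V=\emptyset$). The *$b$-matching game* on $(G,b,w)$ has player set $N=V$, and $v(S)$ is the maximum weight of a set of edges of $G[S]$ in which each vertex $i$ is incident to at most $b(i)$ edges. The *partitioned matching game* on $(G,w,(V_1,\dots,V_n))$, where $(V_1,\dots,V_n)$ is a partition of $V$ into non-empty sets, has player set $\{1,\dots,n\}$, and $v(S)$ is the maximum weight of a matching of $G[\bigcup_{p\in S}V_p]$; its *width* is $c=\max_p |V_p|$. A game is *uniform* if $w\equiv 1$. Write $x(S)=\sum_{p\in S}x_p$. An *allocation* is a vector $x\in\mathbb{R}^N$ with $x(N)=v(N)$, and the *core* is the set of allocations $x$ with $x(S)\ge v(S)$ for all $S\subseteq N$. P1: decide whether a given allocation $x$ is in the core, or find $S$ with $x(S)<v(S)$. P2: decide whether the core is non-empty. P3: find an allocation in the core, if it is non-empty. **Theorem.** P1–P3 can be reduced in polynomial time from $b$-matching games to partitioned matching games of width $c=b^*$, preserving uniformity. In detail: (a)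 *(Real weights.)* Let $(N,v)$ be the $b$-matching game on $(G,b,w)$ with positive real weights. Form $\overline G$ by replacing each vertex $i$ by a set $V_i=\{i^1,\dots,i^{b(i)}\}$ and each edge $ij$ by two new vertices $i_j,j_i$ and the edges $i_jj_i$, $i_ji^h$ ($1\le h\le b(i)$), $j_ij^h$ ($1\le h\le b(j)$), all of weight $w(ij)$; let $(\overline N,\overline v)$ be the partitioned matching game on $\overline G$ whose parts are the sets $V_i$ and $E_{ij}=\{i_j,j_i\}$. Its weights are positive and its parts non-empty, its width is $b^*$ if $b^*\ge 2$, and it is uniform if $(N,v)$ is. (If $b^*\le 1$, then $(N,v)$ itself is the partitioned matching game on $(G,w)$ with singleton parts, which has width $b^*$.) For an allocation $x$ of $(N,v)$, the vector $\overline x$ with $\overline x(V_i)=x_i$ and $\overline x(E_{ij})=w(ij)$ is an allocation of $(\overline N,\overline v)$; $x$ is in the core of $(N,v)$ if and only if $\overline x$ is in the core of $(\overline N,\overline v)$; and if $\overline x(S)<\overline v(S)$ for some $S\subseteq\overline N$, then $x(S')<v(S')$ for $S'=\{i\in N: V_i\in S\}$. The core of $(N,v)$ is non-empty if and only if the core of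 $(\overline N,\overline v)$ is non-empty. (b) *(Polynomial-time reductions.)* Consider games with positive rational weights, and rational vectors, all numbers being given in binary. There are maps $f$, $\varphi$, $\gamma$, $\rho$, computable in time polynomial in the length of their input and $b^*$, such that for every $b$-matching game $I$, $f(I)$ is a partitioned matching game of width $b^*$, which is uniform if $I$ is, and the following hold. P1: for every rational allocation $x$ of $I$, $\varphi(I,x)$ is an allocation of $f(I)$; it is in the core of $f(I)$ if and only if $x$ is in the core of $I$; and every coalition $S$ of $f(I)$ that violates its core constraint for $\varphi(I,x)$ yields a coalition $\gamma(I,S)$ of $I$ that violates its core constraint for $x$. P2: the core of $I$ is non-empty if and only if the core of $f(I)$ is non-empty. P3: for every rational $y$ in the core of $f(I)$, $\rho(I,y)$ is in the core of $I$. -/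

import Mathlib

/-! ### Cooperative games -/

section Games

variable {N : Type*} [Fintype N]

/-- `x` is an allocation of the game with value function `v`: it distributes exactly `v(N)`. -/
def IsAllocation (v : Finset N → ℝ) (x : N → ℝ) : Prop :=
  ∑ p, x p = v Finset.univ

/-- The core: all allocations `x` with `x(S) ≥ v(S)` for every coalition `S`. -/
def core (v : Finset N → ℝ) : Set (N → ℝ) :=
  {x | IsAllocation v x ∧ ∀ S : Finset N, v S ≤ ∑ p ∈ S, x p}

/-- The coalition `S` violates its core constraint: `x(S) < v(S)`. -/
def Violates (v : Finset N → ℝ) (x : N → ℝ) (S : Finset N) : Prop :=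
  ∑ p ∈ S, x p < v S

end Games

/-! ### Matchings and the two kinds of games -/

section MatchingGames

variable {V N : Type*}

open Classical in
/-- `M` is a `b`-matching of the induced subgraph `G[S]`: a set of edges of `G` with both ends in
`S`, such that every vertex `p` is incident to at most `b p` of them. -/
def IsBMatching (G : SimpleGraph V) (b : V → ℕ) (S : Finset V) (M : Finset (Sym2 V)) : Prop :=
  (∀ e ∈ M, e ∈ G.edgeSet ∧ ∀ p ∈ e, p ∈ S) ∧ ∀ p, (M.filter (fun e => p ∈ e)).card ≤ b p

/-- `M` is a matching of the subgraph of `G` induced by the vertices that satisfy `U`: a set of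
edges with both ends in `U`, no two of which share an end-vertex. -/
def IsMatchingOn (G : SimpleGraph V) (U : V → Prop) (M : Finset (Sym2 V)) : Prop :=
  (∀ e ∈ M, e ∈ G.edgeSet ∧ ∀ p ∈ e, U p) ∧
    ∀ e ∈ M, ∀ e' ∈ M, ∀ p, p ∈ e → p ∈ e' → e = e'

/-- The value function of the `b`-matching game on `(G, b, w)`: the maximum weight of a
`b`-matching of `G[S]`. (For finite `V` the supremum is over a finite non-empty set.) -/
noncomputable def bMatchingValue (G : SimpleGraph V) (b : V → ℕ) (w : Sym2 V → ℝ)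
    (S : Finset V) : ℝ :=
  sSup {r | ∃ M, IsBMatching G b S M ∧ r = ∑ e ∈ M, w e}

/-- The value function of the partitioned matching game on `(G, w, 𝒱)`, where the partition `𝒱`
is given by the map `owner`, so that `V_p = owner ⁻¹' {p}`: the maximum weight of a matching in
the subgraph induced by the vertices owned by the players in `S`. -/
noncomputable def partitionedValue (G : SimpleGraph V) (w : Sym2 V → ℝ) (owner : V → N)
    (S : Finset N) : ℝ :=
  sSup {r | ∃ M, IsMatchingOn G (fun u => owner u ∈ S) M ∧ r = ∑ e ∈ M, w e}

/-- `b*`, the maximum capacity. -/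
def maxCapacity [Fintype V] (b : V → ℕ) : ℕ :=
  Finset.univ.sup b

/-- The width of a partition, the maximum of the sizes `|V_p|`. -/
noncomputable def width [Fintype N] (owner : V → N) : ℕ :=
  Finset.univ.sup fun p => Nat.card {u // owner u = p}

/-- The weighting is positive (on the edges of `G`; values elsewhere play no role). -/
def PositiveWeights (G : SimpleGraph V) (w : Sym2 V → ℝ) : Prop :=
  ∀ e ∈ G.edgeSet, 0 < w e

/-- A game on `(G, w)` is uniform if all edges have weight one. -/
def UniformWeights (G : SimpleGraph V) (w : Sym2 V → ℝ) : Prop :=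
  ∀ e ∈ G.edgeSet, w e = 1

end MatchingGames

/-! ### Tutte's vertex-splitting construction -/

section Splitting

variable {V : Type*}

/-- The vertices of the split graph: the copies `i^1, …, i^{b(i)}` of each vertex `i`, and for
each edge `ij` the two vertices `i_j` (the dart from `i` to `j`) and `j_i`. -/
abbrev SplitVertex (G : SimpleGraph V) (b : V → ℕ) : Type _ :=
  (Σ i : V, Fin (b i)) ⊕ G.Dart

/-- The split graph: `i_j` is adjacent to `j_i` and to all copies of `i`. -/
def splitGraph (G : SimpleGraph V) (b : V → ℕ) : SimpleGraph (SplitVertex G b) :=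
  SimpleGraph.fromRel fun
    | .inr d, .inl p => d.fst = p.1
    | .inr d, .inr d' => d' = d.symm
    | _, _ => False

open Classical in
/-- The weighting of the split graph: the edges `i_j j_i`, `i_j i^h` and `j_i j^h` all get the
weight `w(ij)`. -/
noncomputable def splitWeight (G : SimpleGraph V) (b : V → ℕ) (w : Sym2 V → ℝ) :
    Sym2 (SplitVertex G b) → ℝ :=
  Sym2.lift ⟨fun
    | .inl _, .inl _ => 0
    | .inl _, .inr d => w d.edge
    | .inr d, .inl _ => w d.edge
    | .inr d, .inr d' => if d.edge = d'.edge then w d.edge else 0, by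
      rintro (p | d) (p' | d') <;> simp only
      by_cases h : d.edge = d'.edge
      · simp [h]
      · rw [if_neg h, if_neg (Ne.symm h)]⟩

/-- The partition of the split graph: its players are the vertices `i` of `G`, owning
`V_i = {i^1, …, i^{b(i)}}`, and the edges `ij` of `G`, owning `E_{ij} = {i_j, j_i}`. -/
def splitOwner (G : SimpleGraph V) (b : V → ℕ) : SplitVertex G b → V ⊕ G.edgeSet
  | .inl p => .inl p.1
  | .inr d => .inr ⟨d.edge, d.edge_mem⟩

/-- The vector `x̄` with `x̄(V_i) = x_i` and `x̄(E_{ij}) = w(ij)`. -/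
def splitVector (G : SimpleGraph V) (w : Sym2 V → ℝ) (x : V → ℝ) : V ⊕ G.edgeSet → ℝ :=
  Sum.elim x fun e => w e

end Splitting

/-! ### Random access programs with logarithmic cost

Programs act on a memory of integers that is organized in arrays `0, 1, 2, …`, each indexed by
the integers (a scalar variable is a cell of an array). Every operation is charged the bit lengths
of the integers that it handles. -/

namespace RAM

/-- A memory: the content of cell `i` of array `a`. -/
abbrev Memory : Type := ℕ → ℤ → ℤ

/-- Integer expressions; `read a e` is the content of the cell of array `a` with index `e`. -/
inductive Expr : Type
  | const (z : ℤ)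
  | read (a : ℕ) (e : Expr)
  | add (e₁ e₂ : Expr)
  | sub (e₁ e₂ : Expr)
  | mul (e₁ e₂ : Expr)

/-- Programs. A test of an expression `e` asks whether its value is positive. -/
inductive Prog : Type
  | skip
  | write (a : ℕ) (i e : Expr)
  | seq (c₁ c₂ : Prog)
  | ite (e : Expr) (c₁ c₂ : Prog)
  | loop (e : Expr) (c : Prog)

/-- The bit length of an integer, including the sign. -/
def bits (z : ℤ) : ℕ := Nat.size z.natAbs + 1

/-- The value of an expression. -/
def Expr.eval (s : Memory) : Expr → ℤ
  | .const z => z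
  | .read a e => s a (e.eval s)
  | .add e₁ e₂ => e₁.eval s + e₂.eval s
  | .sub e₁ e₂ => e₁.eval s - e₂.eval s
  | .mul e₁ e₂ => e₁.eval s * e₂.eval s

/-- The logarithmic cost of evaluating an expression: the total bit length of the values of all
its subexpressions. -/
def Expr.cost (s : Memory) : Expr → ℕ
  | .const z => bits z
  | .read a e => e.cost s + bits (s a (e.eval s))
  | .add e₁ e₂ => e₁.cost s + e₂.cost s + bits (e₁.eval s + e₂.eval s)
  | .sub e₁ e₂ => e₁.cost s + e₂.cost s + bits (e₁.eval s - e₂.eval s)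
  | .mul e₁ e₂ => e₁.cost s + e₂.cost s + bits (e₁.eval s * e₂.eval s)

/-- The memory after `z` has been written to cell `i` of array `a`. -/
def Memory.set (s : Memory) (a : ℕ) (i z : ℤ) : Memory :=
  Function.update s a (Function.update (s a) i z)

/-- `Exec c s s' t`: the program `c`, started in memory `s`, halts in memory `s'` after a
computation of total cost `t`. -/
inductive Exec : Prog → Memory → Memory → ℕ → Prop
  | skip (s : Memory) : Exec .skip s s 1
  | write (s : Memory) (a : ℕ) (i e : Expr) :
      Exec (.write a i e) s (s.set a (i.eval s) (e.eval s)) (i.cost s + e.cost s)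
  | seq {c₁ c₂ : Prog} {s s' s'' : Memory} {t₁ t₂ : ℕ} :
      Exec c₁ s s' t₁ → Exec c₂ s' s'' t₂ → Exec (.seq c₁ c₂) s s'' (t₁ + t₂)
  | ite_pos {e : Expr} {c₁ c₂ : Prog} {s s' : Memory} {t : ℕ} :
      0 < e.eval s → Exec c₁ s s' t → Exec (.ite e c₁ c₂) s s' (e.cost s + t)
  | ite_neg {e : Expr} {c₁ c₂ : Prog} {s s' : Memory} {t : ℕ} :
      ¬ 0 < e.eval s → Exec c₂ s s' t → Exec (.ite e c₁ c₂) s s' (e.cost s + t)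
  | loop_pos {e : Expr} {c : Prog} {s s' s'' : Memory} {t₁ t₂ : ℕ} :
      0 < e.eval s → Exec c s s' t₁ → Exec (.loop e c) s' s'' t₂ →
        Exec (.loop e c) s s'' (e.cost s + t₁ + t₂)
  | loop_neg {e : Expr} {c : Prog} {s : Memory} :
      ¬ 0 < e.eval s → Exec (.loop e c) s s (e.cost s)

/-- The initial memory for the input `L`: its entries are in the cells `0, 1, …` of array `0`, its
length is in cell `0` of array `1`, and all other cells are zero. -/
def input (L : List ℤ) : Memory := fun a i =>
  if a = 0 then (if 0 ≤ i then L.getD i.toNat 0 else 0)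
  else if a = 1 ∧ i = 0 then L.length else 0

/-- The memory `s` holds the output `L`, laid out in the same way as an input. -/
def Outputs (s : Memory) (L : List ℤ) : Prop :=
  s 1 0 = L.length ∧ ∀ k : ℕ, k < L.length → s 0 k = L.getD k 0

/-- The total bit length of a list of integers. -/
def bitLength (L : List ℤ) : ℕ := (L.map bits).sum

/-- There is a program that, for every `a`, computes the list `out a` from the list `inp a`, at a
cost that is bounded by a polynomial in the bit length of `inp a` and the parameter `par a`. -/
def PolyTime {α : Type} (inp : α → List ℤ) (par : α → ℕ) (out : α → List ℤ) : Prop :=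
  ∃ (c : Prog) (P : Polynomial ℕ), ∀ a, ∃ (s : Memory) (t : ℕ),
    Exec c (input (inp a)) s t ∧ t ≤ P.eval (bitLength (inp a) + par a) ∧ Outputs s (out a)

end RAM

/-! ### Instances and their descriptions -/

/-- A finite graph with positive rational edge weights, which are given as fractions over a common
denominator. -/
structure WeightedGraph where
  /-- the number of vertices -/
  n : ℕ
  graph : SimpleGraph (Fin n)
  num : Sym2 (Fin n) → ℕ
  den : ℕ
  num_pos : ∀ e ∈ graph.edgeSet, 0 < num e
  den_pos : 0 < den

namespace WeightedGraph

/-- The edge weighting. -/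
noncomputable def weight (H : WeightedGraph) (e : Sym2 (Fin H.n)) : ℝ :=
  (H.num e : ℝ) / H.den

/-- The weighting is constantly one. -/
def Uniform (H : WeightedGraph) : Prop := UniformWeights H.graph H.weight

open Classical in
/-- Description of a weighted graph: the number of vertices, the denominator of the weights, and
the matrix of the numerators, with entry zero for non-adjacent pairs. -/
noncomputable def code (H : WeightedGraph) : List ℤ :=
  (H.n : ℤ) :: (H.den : ℤ) ::
    (List.ofFn fun i => List.ofFn fun j =>
      if H.graph.Adj i j then (H.num s(i, j) : ℤ) else 0).flatten

end WeightedGraph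

/-- A `b`-matching game: a weighted graph with a positive capacity function. -/
structure BMatchingGame extends WeightedGraph where
  cap : Fin n → ℕ
  cap_pos : ∀ i, 0 < cap i

namespace BMatchingGame

/-- The value function. -/
noncomputable def value (I : BMatchingGame) : Finset (Fin I.n) → ℝ :=
  bMatchingValue I.graph I.cap I.weight

/-- `b*` -/
def bStar (I : BMatchingGame) : ℕ := maxCapacity I.cap

/-- Description: the weighted graph, followed by the capacities. -/
noncomputable def code (I : BMatchingGame) : List ℤ :=
  I.toWeightedGraph.code ++ List.ofFn fun i => (I.cap i : ℤ)

end BMatchingGame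

/-- A partitioned matching game: a weighted graph with a partition of its vertices into the
non-empty sets `V_p = owner ⁻¹' {p}`, one for each player `p`. -/
structure PartitionedGame extends WeightedGraph where
  /-- the number of players -/
  k : ℕ
  owner : Fin n → Fin k
  owner_surjective : Function.Surjective owner

namespace PartitionedGame

/-- The value function. -/
noncomputable def value (J : PartitionedGame) : Finset (Fin J.k) → ℝ :=
  partitionedValue J.graph J.weight J.owner

/-- Description: the weighted graph, the number of players, and the owner of each vertex. -/
noncomputable def code (J : PartitionedGame) : List ℤ :=
  J.toWeightedGraph.code ++ (J.k : ℤ) :: List.ofFn fun i => ((J.owner i : ℕ) : ℤ)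

end PartitionedGame

/-- A rational vector, given by integer numerators over a common positive denominator. -/
structure RatVec (m : ℕ) where
  num : Fin m → ℤ
  den : ℕ
  den_pos : 0 < den

namespace RatVec

/-- The vector that is described. -/
noncomputable def vec {m : ℕ} (x : RatVec m) (p : Fin m) : ℝ := (x.num p : ℝ) / x.den

/-- Description: the denominator and the numerators. -/
def code {m : ℕ} (x : RatVec m) : List ℤ := (x.den : ℤ) :: List.ofFn x.num

end RatVec

/-- Description of a coalition by its characteristic vector. -/
def coalitionCode {m : ℕ} (S : Finset (Fin m)) : List ℤ :=
  List.ofFn fun p => if p ∈ S then 1 else 0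

/-! ### Value functions: attainable weights, upper bounds, and padding -/

section Values

variable {V N : Type*}

/-! Everything follows from two inequalities between the value functions. Let T be a coalition of
the split game, S the set of its vertex players and F the set of its edge players. Every edge of the
split graph contains a dart, so a matching charges each edge ij in F at most twice, and twice only
if both darts of ij are matched to copies. Edges of that kind form a b-matching of G[S], since edges
at i occupy distinct copies of i. Hence v̄(T) ≤ v(S) + w(F) (`partitionedValue_split_le`).
Conversely, suppose that F contains all edges of G[S], and let M be a b-matching of G[S]. Match both
darts of each edge of M to copies, and the two darts of each edge of F \ M to each other: this gives
weight 2w(M) + w(F \ M) = w(M) + w(F), so v(S) + w(F) ≤ v̄(T) (`le_partitionedValue_split`).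

`CoreReduction` isolates these inequalities. If every edge player receives exactly its weight, the
term w(F) cancels: the core constraints of x and x̄ hold together, and a violated coalition of x̄
restricts to one of x. For an arbitrary y in the core of the split game, each excess y(E_ij) -
w(ij), whatever its sign, is handed to a chosen end of ij, its anchor. The resulting x satisfies
x(S) = y(T) - w(F), where F consists of the edges anchored in S, and T of S and F. This F contains
all edges of G[S], so x(S) ≥ v(S) (`CoreReduction.pull_mem_core`).

For the reductions by programs, the split game is padded with isolated vertices until all rows have
the same length, so that adjacency, weights and owners are given by explicit arithmetic. By
`partitionedValue_embed` the padding does not affect the values, and the additional players have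
demand zero (`coreReduction_padded`). If all capacities are one, darts are left out, because a pair
of darts would have width two.

The programs are nests of counting loops that emit their output entry by entry. If N bounds the
rounds of every loop and the bit lengths of all cells, the cost is at most a polynomial in N that
depends on the program only. `Runs` is a Hoare triple that carries correctness and this bound
together, and `PolyTime.of_runs` takes N linear in the size of the input plus b*. -/

theorem finite_bMatching_weights [Finite V] (G : SimpleGraph V) (b : V → ℕ) (w : Sym2 V → ℝ)
    (S : Finset V) : {r | ∃ M, IsBMatching G b S M ∧ r = ∑ e ∈ M, w e}.Finite :=
  (Set.finite_range fun M : Finset (Sym2 V) => ∑ e ∈ M, w e).subset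
    (by rintro _ ⟨M, -, rfl⟩; exact ⟨M, rfl⟩)

theorem finite_matching_weights [Finite V] (G : SimpleGraph V) (w : Sym2 V → ℝ)
    (U : V → Prop) : {r | ∃ M, IsMatchingOn G U M ∧ r = ∑ e ∈ M, w e}.Finite :=
  (Set.finite_range fun M : Finset (Sym2 V) => ∑ e ∈ M, w e).subset
    (by rintro _ ⟨M, -, rfl⟩; exact ⟨M, rfl⟩)

/-- Finiteness is essential: the real `sSup` of an unbounded set is zero by convention. -/
theorem IsBMatching.weight_le [Finite V] {G : SimpleGraph V} {b : V → ℕ} (w : Sym2 V → ℝ)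
    {S : Finset V} {M : Finset (Sym2 V)} (hM : IsBMatching G b S M) :
    ∑ e ∈ M, w e ≤ bMatchingValue G b w S :=
  le_csSup (finite_bMatching_weights G b w S).bddAbove ⟨M, hM, rfl⟩

theorem IsMatchingOn.weight_le [Finite V] {G : SimpleGraph V} (w : Sym2 V → ℝ) {owner : V → N}
    {S : Finset N} {M : Finset (Sym2 V)} (hM : IsMatchingOn G (fun u => owner u ∈ S) M) :
    ∑ e ∈ M, w e ≤ partitionedValue G w owner S :=
  le_csSup (finite_matching_weights G w _).bddAbove ⟨M, hM, rfl⟩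

/-- The empty set of edges is always a b-matching, so the supremum is over a non-empty set. -/
theorem bMatchingValue_le {G : SimpleGraph V} {b : V → ℕ} {w : Sym2 V → ℝ} {S : Finset V} {r : ℝ}
    (h : ∀ M, IsBMatching G b S M → ∑ e ∈ M, w e ≤ r) : bMatchingValue G b w S ≤ r :=
  csSup_le ⟨0, ∅, by simp [IsBMatching], by simp⟩ (by rintro _ ⟨M, hM, rfl⟩; exact h M hM)

theorem partitionedValue_le {G : SimpleGraph V} {w : Sym2 V → ℝ} {owner : V → N} {S : Finset N}
    {r : ℝ} (h : ∀ M, IsMatchingOn G (fun u => owner u ∈ S) M → ∑ e ∈ M, w e ≤ r) :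
    partitionedValue G w owner S ≤ r :=
  csSup_le ⟨0, ∅, by simp [IsMatchingOn], by simp⟩ (by rintro _ ⟨M, hM, rfl⟩; exact h M hM)

theorem Sym2.exists_mem {α : Type*} (e : Sym2 α) : ∃ p, p ∈ e := by
  induction e with
  | _ i j => exact ⟨i, by simp⟩

/-- With all capacities one, `b`-matchings are matchings. -/
theorem partitionedValue_id (G : SimpleGraph V) (w : Sym2 V → ℝ) {b : V → ℕ} (hb : ∀ i, b i = 1) :
    partitionedValue G w (id : V → V) = bMatchingValue G b w := by
  have key : ∀ S M, IsMatchingOn G (fun u => id u ∈ S) M ↔ IsBMatching G b S M := by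
    intro S M
    simp only [IsMatchingOn, IsBMatching, id, hb, Finset.card_le_one, Finset.mem_filter]
    refine and_congr_right fun _ => ⟨fun h p e he e' he' => ?_, fun h e he e' he' p hp hp' => ?_⟩
    · exact h e he.1 e' he'.1 p he.2 he'.2
    · exact h p e ⟨he, hp⟩ e' ⟨he', hp'⟩
  funext S
  simp only [partitionedValue, bMatchingValue, key]

open Classical in
/-- Adding isolated vertices, and players who own only such vertices, does not change the values. -/
theorem partitionedValue_embed {U U' P P' : Type*} [Finite U] [Finite U'] {H : SimpleGraph U}
    {H' : SimpleGraph U'} {w : Sym2 U → ℝ} {w' : Sym2 U' → ℝ} {owner : U → P} {owner' : U' → P'}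
    {ι : U → U'} {κ : P → P'} (hι : Function.Injective ι) (T' : Finset P') (T : Finset P)
    (hT : ∀ p, p ∈ T ↔ κ p ∈ T')
    (hadj : ∀ u v, H'.Adj u v ↔ ∃ x y, H.Adj x y ∧ ι x = u ∧ ι y = v)
    (hweight : ∀ x y, H.Adj x y → w' s(ι x, ι y) = w s(x, y))
    (howner : ∀ x, owner' (ι x) = κ (owner x)) :
    partitionedValue H' w' owner' T' = partitionedValue H w owner T := by
  have hinj : Function.Injective (Sym2.map ι) := Sym2.map.injective hι
  have hsum : ∀ M : Finset (Sym2 U), (∀ e ∈ M, e ∈ H.edgeSet) →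
      ∑ e ∈ M.image (Sym2.map ι), w' e = ∑ e ∈ M, w e := by
    intro M hM
    rw [Finset.sum_image fun _ _ _ _ h => hinj h]
    refine Finset.sum_congr rfl fun e he => ?_
    have := hM e he
    induction e with
    | _ x y => exact hweight x y this
  apply le_antisymm
  · refine partitionedValue_le fun M' hM' => ?_
    -- By `hadj`, both ends of an edge of `H'` lie in the range of `ι`, so a matching of `H'` is the
    -- image of its preimage.
    obtain ⟨M, rfl⟩ : ∃ M : Finset (Sym2 U), M' = M.image (Sym2.map ι) := by
      refine ⟨Finset.preimage M' (Sym2.map ι) hinj.injOn, ?_⟩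
      ext e
      simp only [Finset.mem_image, Finset.mem_preimage]
      refine ⟨fun he => ?_, fun ⟨a, ha, h⟩ => h ▸ ha⟩
      have h1 := (hM'.1 e he).1
      induction e with
      | _ u v =>
        obtain ⟨x, y, -, rfl, rfl⟩ := (hadj u v).1 h1
        exact ⟨s(x, y), by simpa using he, by simp⟩
    have hedge : ∀ e ∈ M, e ∈ H.edgeSet := by
      intro e he
      have h1 := (hM'.1 _ (Finset.mem_image_of_mem _ he)).1
      induction e with
      | _ u v =>
        obtain ⟨x, y, hxy, h1, h2⟩ := (hadj _ _).1 h1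
        rw [hι h1, hι h2] at hxy
        exact hxy
    rw [hsum M hedge]
    refine IsMatchingOn.weight_le w ⟨fun e he => ⟨hedge e he, fun p hp => ?_⟩, ?_⟩
    · show owner p ∈ T
      rw [hT, ← howner]
      exact (hM'.1 _ (Finset.mem_image_of_mem _ he)).2 _ (Sym2.mem_map.2 ⟨p, hp, rfl⟩)
    · intro e he e' he' p hp hp'
      exact hinj (hM'.2 _ (Finset.mem_image_of_mem _ he) _ (Finset.mem_image_of_mem _ he') (ι p)
        (Sym2.mem_map.2 ⟨p, hp, rfl⟩) (Sym2.mem_map.2 ⟨p, hp', rfl⟩))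
  · refine partitionedValue_le fun M hM => ?_
    rw [← hsum M fun e he => (hM.1 e he).1]
    refine IsMatchingOn.weight_le w' ⟨fun e' he' => ?_, fun e₁ he₁ e₂ he₂ p hp hp' => ?_⟩
    · obtain ⟨e, he, rfl⟩ := Finset.mem_image.1 he'
      refine ⟨?_, fun p hp => ?_⟩
      · have h1 := (hM.1 e he).1
        induction e with
        | _ x y => exact (hadj _ _).2 ⟨x, y, h1, rfl, rfl⟩
      · obtain ⟨q, hq, rfl⟩ := Sym2.mem_map.1 hp
        show owner' (ι q) ∈ T'
        rw [howner, ← hT]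
        exact (hM.1 e he).2 q hq
    · obtain ⟨e, he, rfl⟩ := Finset.mem_image.1 he₁
      obtain ⟨e', he', rfl⟩ := Finset.mem_image.1 he₂
      obtain ⟨q, hq, rfl⟩ := Sym2.mem_map.1 hp
      obtain ⟨q', hq', h⟩ := Sym2.mem_map.1 hp'
      obtain rfl := hι h
      rw [hM.2 e he e' he' _ hq hq']

end Values

/-! ### Transfer of the core to a game with additional players -/

section CoreReduction

variable {V Q P : Type*} [Fintype V] [Fintype Q] [Fintype P] {e : V ⊕ Q ≃ P}
  {v : Finset V → ℝ} {v' : Finset P → ℝ} {c : Q → ℝ} {anchor : Q → V}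

open Classical in
theorem sum_players (e : V ⊕ Q ≃ P) (y : P → ℝ) (T : Finset P) :
    ∑ p ∈ T, y p = ∑ i with e (.inl i) ∈ T, y (e (.inl i)) +
      ∑ q with e (.inr q) ∈ T, y (e (.inr q)) := by
  have : ∑ p ∈ T, y p = ∑ p, if p ∈ T then y p else 0 := by simp
  rw [this, ← e.sum_comp, Fintype.sum_sum_type]
  simp only [Finset.sum_filter]

/-- A game `v'` whose players are those of `v` and further players `q` with a fixed demand `c q`,
each of whom is anchored at a player of `v`. -/
structure CoreReduction (e : V ⊕ Q ≃ P) (v : Finset V → ℝ) (v' : Finset P → ℝ) (c : Q → ℝ)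
    (anchor : Q → V) : Prop where
  upper : ∀ T S F, (∀ i, i ∈ S ↔ e (.inl i) ∈ T) → (∀ q, q ∈ F ↔ e (.inr q) ∈ T) →
    v' T ≤ v S + ∑ q ∈ F, c q
  lower : ∀ T S F, (∀ i, i ∈ S ↔ e (.inl i) ∈ T) → (∀ q, q ∈ F ↔ e (.inr q) ∈ T) →
    (∀ q, anchor q ∈ S → q ∈ F) → v S + ∑ q ∈ F, c q ≤ v' T

namespace CoreReduction

/-- The grand coalition contains all additional players, so both inequalities apply to it. -/
theorem univ_eq (h : CoreReduction e v v' c anchor) :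
    v' Finset.univ = v Finset.univ + ∑ q, c q := by
  exact le_antisymm (h.upper _ _ _ (by simp) (by simp))
    (h.lower _ _ _ (by simp) (by simp) (by simp))

theorem isAllocation_iff (h : CoreReduction e v v' c anchor) {x : V → ℝ} {x' : P → ℝ}
    (hV : ∀ i, x' (e (.inl i)) = x i) (hQ : ∀ q, x' (e (.inr q)) = c q) :
    IsAllocation v' x' ↔ IsAllocation v x := by
  rw [IsAllocation, IsAllocation, h.univ_eq, sum_players e]
  simp [hV, hQ]

-- Only `upper` is needed: the additional players in `T` receive exactly their demands, which
-- cancel.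
open Classical in
theorem violates (h : CoreReduction e v v' c anchor) {x : V → ℝ} {x' : P → ℝ}
    (hV : ∀ i, x' (e (.inl i)) = x i) (hQ : ∀ q, x' (e (.inr q)) = c q) {T : Finset P}
    (hT : Violates v' x' T) : Violates v x {i | e (.inl i) ∈ T} := by
  have := h.upper T {i | e (.inl i) ∈ T} {q | e (.inr q) ∈ T} (by simp) (by simp)
  rw [Violates, sum_players e] at hT
  simp only [hV, hQ] at hT
  rw [Violates]
  linarith

theorem mem_core_iff (h : CoreReduction e v v' c anchor) {x : V → ℝ} {x' : P → ℝ}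
    (hV : ∀ i, x' (e (.inl i)) = x i) (hQ : ∀ q, x' (e (.inr q)) = c q) :
    x' ∈ core v' ↔ x ∈ core v := by
  classical
  refine and_congr (h.isAllocation_iff hV hQ) ⟨fun hx S => ?_, fun hx T => ?_⟩
  · let T : Finset P := Finset.univ.filter fun p => ∀ i, p = e (.inl i) → i ∈ S
    have h1 := (h.lower T {i | e (.inl i) ∈ T} {q | e (.inr q) ∈ T} (by simp) (by simp)
      (by simp [T])).trans (hx T)
    rw [sum_players e] at h1
    simpa [hV, hQ, T] using h1
  · by_contra hlt
    exact absurd (hx _) (not_le.2 (h.violates hV hQ (T := T) (not_le.1 hlt)))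

-- Moving each excess to the anchor makes the amount of `S` equal to y(T) - c(F), where `T` consists
-- of `S` and the set F of players anchored in `S`. This is the smallest coalition with vertex part
-- `S` to which `lower` applies. The excess may be negative.
open Classical in
theorem pull_mem_core (h : CoreReduction e v v' c anchor) {y : P → ℝ} (hy : y ∈ core v') :
    (fun i => y (e (.inl i)) + ∑ q with anchor q = i, (y (e (.inr q)) - c q)) ∈ core v := by
  have hfib : ∀ S : Finset V, ∑ i ∈ S, ∑ q with anchor q = i, (y (e (.inr q)) - c q) =
      ∑ q with anchor q ∈ S, (y (e (.inr q)) - c q) := by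
    intro S
    rw [← Finset.sum_fiberwise_of_maps_to (t := S) (g := anchor) (by simp)]
    refine Finset.sum_congr rfl fun i hi => Finset.sum_congr ?_ fun _ _ => rfl
    ext q
    simp only [Finset.mem_filter, Finset.mem_univ, true_and]
    exact ⟨fun hq => ⟨hq ▸ hi, hq⟩, fun hq => hq.2⟩
  constructor
  · have h1 := hy.1
    rw [IsAllocation, h.univ_eq, sum_players e] at h1
    rw [IsAllocation, Finset.sum_add_distrib, hfib]
    simp only [Finset.mem_univ, Finset.filter_true, Finset.sum_sub_distrib] at h1 ⊢
    linarith
  · intro S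
    let T : Finset P := Finset.univ.filter fun p =>
      (∃ i ∈ S, p = e (.inl i)) ∨ ∃ q, anchor q ∈ S ∧ p = e (.inr q)
    have h1 := (h.lower T {i | e (.inl i) ∈ T} {q | e (.inr q) ∈ T} (by simp) (by simp)
      (by simp [T])).trans (hy.2 T)
    rw [sum_players e] at h1
    simp only [T, Finset.mem_filter, Finset.mem_univ, true_and, EmbeddingLike.apply_eq_iff_eq,
      Sum.inl.injEq, Sum.inr.injEq, reduceCtorEq, and_false, exists_false, or_false, false_or,
      exists_eq_right', Finset.filter_univ_mem] at h1
    rw [Finset.sum_add_distrib, hfib, Finset.sum_sub_distrib]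
    linarith

theorem nonempty_iff (h : CoreReduction e v v' c anchor) :
    (core v).Nonempty ↔ (core v').Nonempty := by
  refine ⟨fun ⟨x, hx⟩ => ⟨fun p => Sum.elim x c (e.symm p), ?_⟩, fun ⟨y, hy⟩ =>
    ⟨_, h.pull_mem_core hy⟩⟩
  exact (h.mem_core_iff (by simp) (by simp)).2 hx

end CoreReduction

end CoreReduction

/-! ### The split graph: edges, weights, owners and width -/

section SplitGame

variable {V : Type*} {G : SimpleGraph V} {b : V → ℕ} {w : Sym2 V → ℝ}

@[simp] theorem splitGraph_adj_inr_inl (d : G.Dart) (p : Σ i : V, Fin (b i)) :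
    (splitGraph G b).Adj (.inr d) (.inl p) ↔ d.fst = p.1 := by
  simp [splitGraph]

@[simp] theorem splitGraph_adj_inl_inr (d : G.Dart) (p : Σ i : V, Fin (b i)) :
    (splitGraph G b).Adj (.inl p) (.inr d) ↔ d.fst = p.1 := by
  simp [splitGraph]

@[simp] theorem splitGraph_adj_inl_inl (p p' : Σ i : V, Fin (b i)) :
    ¬ (splitGraph G b).Adj (.inl p) (.inl p') := by
  simp [splitGraph]

@[simp] theorem splitGraph_adj_inr_inr (d d' : G.Dart) :
    (splitGraph G b).Adj (.inr d) (.inr d') ↔ d' = d.symm := by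
  have h : d = d'.symm ↔ d' = d.symm := by
    constructor <;> (rintro rfl; simp)
  simp only [splitGraph, SimpleGraph.fromRel_adj, ne_eq, Sum.inr.injEq, h, or_self,
    and_iff_right_iff_imp]
  rintro rfl h
  exact d.symm_ne h.symm

/-- Copies are pairwise non-adjacent, so every edge can be written with a dart in front. -/
theorem splitGraph_edge_cases {e : Sym2 (SplitVertex G b)} (he : e ∈ (splitGraph G b).edgeSet) :
    (∃ (d : G.Dart) (h : Fin (b d.fst)), e = s(.inr d, .inl ⟨d.fst, h⟩)) ∨
      ∃ d : G.Dart, e = s(.inr d, .inr d.symm) := by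
  induction e with
  | _ u u' =>
    rw [SimpleGraph.mem_edgeSet] at he
    rcases u with ⟨i, h⟩ | d <;> rcases u' with ⟨i', h'⟩ | d'
    · simp at he
    · simp only [splitGraph_adj_inl_inr] at he
      subst he
      exact .inl ⟨d', h, Sym2.eq_swap⟩
    · simp only [splitGraph_adj_inr_inl] at he
      subst he
      exact .inl ⟨d, h', rfl⟩
    · simp only [splitGraph_adj_inr_inr] at he
      subst he
      exact .inr ⟨d, rfl⟩

@[simp] theorem splitWeight_dart (d : G.Dart) :
    splitWeight G b w s(.inr d, .inr d.symm) = w d.edge := by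
  simp [splitWeight]

theorem dart_eq_or_symm {d d' : G.Dart} (h : d.edge = d'.edge) : d = d' ∨ d = d'.symm :=
  SimpleGraph.dart_edge_eq_iff _ _ |>.1 h

/-- Every edge of the split graph stems from a unique edge of the original graph. -/
theorem splitGraph_edge_origin {e : Sym2 (SplitVertex G b)} (he : e ∈ (splitGraph G b).edgeSet) :
    ∃ d : G.Dart, .inr d ∈ e ∧ splitWeight G b w e = w d.edge ∧
      ∀ d' : G.Dart, .inr d' ∈ e → d'.edge = d.edge := by
  rcases splitGraph_edge_cases he with ⟨d, h, rfl⟩ | ⟨d, rfl⟩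
  · exact ⟨d, by simp, rfl, fun d' hd' => by simp_all⟩
  · refine ⟨d, by simp, by simp, fun d' hd' => ?_⟩
    simp only [Sym2.mem_iff, Sum.inr.injEq] at hd'
    rcases hd' with rfl | rfl <;> simp

theorem positiveWeights_split (hw : PositiveWeights G w) :
    PositiveWeights (splitGraph G b) (splitWeight G b w) := by
  intro e he
  obtain ⟨d, -, h, -⟩ := splitGraph_edge_origin (w := w) he
  exact h ▸ hw _ d.edge_mem

theorem uniformWeights_split (hw : UniformWeights G w) :
    UniformWeights (splitGraph G b) (splitWeight G b w) := by
  intro e he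
  obtain ⟨d, -, h, -⟩ := splitGraph_edge_origin (w := w) he
  exact h ▸ hw _ d.edge_mem

theorem exists_dart_edge {e : Sym2 V} (he : e ∈ G.edgeSet) : ∃ d : G.Dart, d.edge = e := by
  induction e with
  | _ i j => exact ⟨⟨(i, j), he⟩, rfl⟩

theorem exists_dart_of_mem {e : Sym2 V} (he : e ∈ G.edgeSet) {i : V} (hi : i ∈ e) :
    ∃ d : G.Dart, d.edge = e ∧ d.fst = i := by
  obtain ⟨j, rfl⟩ := Sym2.mem_iff_exists.1 hi
  exact ⟨⟨(i, j), he⟩, rfl, rfl⟩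

theorem splitOwner_surjective (hb : ∀ i, 0 < b i) : Function.Surjective (splitOwner G b) := by
  rintro (i | ⟨e, he⟩)
  · exact ⟨.inl ⟨i, ⟨0, hb i⟩⟩, rfl⟩
  · obtain ⟨d, rfl⟩ := exists_dart_edge he
    exact ⟨.inr d, rfl⟩

theorem width_id [Fintype V] (hb : ∀ i, 0 < b i) (h : maxCapacity b ≤ 1) :
    width (id : V → V) = maxCapacity b := by
  have hb1 : ∀ i, b i = 1 := fun i =>
    le_antisymm ((Finset.le_sup (f := b) (Finset.mem_univ i)).trans h) (hb i)
  simp only [width, maxCapacity, id]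
  refine Finset.sup_congr rfl fun i _ => ?_
  rw [hb1]
  simp

/-- The sets of copies have the sizes b(i), and the pairs of darts do not exceed the maximum because
it is at least two. -/
theorem width_splitOwner [Fintype V] [Fintype (V ⊕ G.edgeSet)] (h2 : 2 ≤ maxCapacity b) :
    width (splitOwner G b) = maxCapacity b := by
  classical
  have hV : ∀ i, Nat.card {u // splitOwner G b u = .inl i} = b i := by
    intro i
    let φ : Fin (b i) → {u // splitOwner G b u = .inl i} := fun h => ⟨.inl ⟨i, h⟩, rfl⟩
    have hφ : Function.Bijective φ := by
      constructor
      · intro h h' hh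
        have := Sum.inl.inj (congrArg Subtype.val hh)
        simpa using this
      · rintro ⟨⟨j, h⟩ | d, hu⟩
        · obtain rfl : j = i := by simpa [splitOwner] using hu
          exact ⟨h, rfl⟩
        · simp [splitOwner] at hu
    rw [← Nat.card_eq_of_bijective φ hφ, Nat.card_fin]
  have hE : ∀ e, Nat.card {u // splitOwner G b u = .inr e} ≤ 2 := by
    rintro ⟨e, he⟩
    obtain ⟨d, rfl⟩ := exists_dart_edge he
    let s : Finset (SplitVertex G b) := {.inr d, .inr d.symm}
    have hs : ∀ u, splitOwner G b u = .inr ⟨d.edge, he⟩ → u ∈ s := by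
      rintro (p | d') hu
      · simp [splitOwner] at hu
      · have hu' : d'.edge = d.edge := by simpa [splitOwner] using hu
        rcases dart_eq_or_symm hu' with rfl | rfl <;> simp [s]
    calc Nat.card {u // splitOwner G b u = .inr ⟨d.edge, he⟩} ≤ Nat.card s :=
          Nat.card_le_card_of_injective (fun u => (⟨u.1, hs u.1 u.2⟩ : s))
            fun u u' h => Subtype.ext (by simpa using h)
      _ ≤ 2 := by simpa using Finset.card_le_two
  refine le_antisymm (Finset.sup_le ?_) (Finset.sup_le fun i _ => ?_)
  · rintro (i | e) -
    · exact (hV i).le.trans (Finset.le_sup (f := b) (Finset.mem_univ i))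
    · exact (hE e).trans h2
  · rw [← hV i]
    exact Finset.le_sup (f := fun p => Nat.card {u // splitOwner G b u = p})
      (Finset.mem_univ (Sum.inl i : V ⊕ G.edgeSet))

/-! ### The two inequalities between the value functions -/

variable [Finite V]

-- Charge each edge of the matching to the edge of `G` from which it stems. An edge of `F` is
-- charged at most twice, as each of its darts is covered at most once, and at most once if one of
-- its darts is not matched to a copy. The surplus is thus bounded by the weight of a b-matching.
open Classical in
theorem partitionedValue_split_le (hw : PositiveWeights G w) (T : Finset (V ⊕ G.edgeSet))
    (S : Finset V) (F : Finset (Sym2 V)) (hS : ∀ i, .inl i ∈ T → i ∈ S)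
    (hF : ∀ e : G.edgeSet, .inr e ∈ T → (e : Sym2 V) ∈ F) (hFG : ∀ e ∈ F, e ∈ G.edgeSet) :
    partitionedValue (splitGraph G b) (splitWeight G b w) (splitOwner G b) T ≤
      bMatchingValue G b w S + ∑ e ∈ F, w e := by
  refine partitionedValue_le fun M hM => ?_
  have := fun e : M => splitGraph_edge_origin (w := w) (hM.1 e e.2).1
  choose! π hπ hπw hπd using this
  let fiber (e : Sym2 V) : Finset (Sym2 (SplitVertex G b)) :=
    M.filter fun m => ∃ d : G.Dart, d.edge = e ∧ .inr d ∈ m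
  have hsum : ∑ m ∈ M, splitWeight G b w m ≤ ∑ e ∈ F, (fiber e).card * w e := by
    rw [← Finset.sum_coe_sort, ← Finset.sum_fiberwise_of_maps_to (t := F)
      (g := fun m : M => (π m).edge)]
    · refine Finset.sum_le_sum fun e he => ?_
      rw [Finset.sum_congr rfl (g := fun _ => w e)
        (fun m hm => by rw [hπw, (Finset.mem_filter.1 hm).2]), Finset.sum_const, nsmul_eq_mul]
      refine mul_le_mul_of_nonneg_right (Nat.cast_le.2 ?_) (hw e (hFG e he)).le
      refine Finset.card_le_card_of_injOn (fun m => m.1) (fun m hm => ?_)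
        (fun _ _ _ _ h => Subtype.ext h)
      simp only [Finset.coe_filter, Finset.mem_univ, true_and, Set.mem_ofPred_eq] at hm
      simp only [fiber, Finset.coe_filter, Set.mem_ofPred_eq]
      exact ⟨m.2, π m, hm, hπ m⟩
    · intro m _
      exact hF ⟨_, (π m).edge_mem⟩ ((hM.1 _ m.2).2 _ (hπ m))
  -- The edges both of whose darts are matched to copies: no other edges can be charged twice.
  let M' : Finset (Sym2 V) := F.filter fun e =>
    ∀ d : G.Dart, d.edge = e → ∃ h : Fin (b d.fst), s(.inr d, .inl ⟨d.fst, h⟩) ∈ M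
  have hM' : IsBMatching G b S M' := by
    refine ⟨fun e he => ?_, fun i => ?_⟩
    · obtain ⟨heF, hd⟩ := Finset.mem_filter.1 he
      refine ⟨hFG e heF, fun i hi => ?_⟩
      obtain ⟨d, hde, rfl⟩ := exists_dart_of_mem (hFG e heF) hi
      obtain ⟨h, hh⟩ := hd d hde
      exact hS _ ((hM.1 _ hh).2 (.inl ⟨d.fst, h⟩) (by simp))
    -- The copy of `i` used by an edge determines that edge, since a copy lies in at most one edge
    -- of the matching. This bounds the degree by `b i`.
    · have hex : ∀ e ∈ M'.filter (fun e => i ∈ e), ∃ (h : Fin (b i)) (d : G.Dart),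
          d.edge = e ∧ s(.inr d, .inl ⟨i, h⟩) ∈ M := by
        intro e he
        obtain ⟨heM, hi⟩ := Finset.mem_filter.1 he
        obtain ⟨heF, hd⟩ := Finset.mem_filter.1 heM
        obtain ⟨d, hde, rfl⟩ := exists_dart_of_mem (hFG e heF) hi
        obtain ⟨h, hh⟩ := hd d hde
        exact ⟨h, d, hde, hh⟩
      -- `choose!` needs a default copy of `i`, and `b i = 0` is possible here; an edge at `i`
      -- supplies a copy.
      by_cases hne : (M'.filter fun e => i ∈ e).Nonempty
      · obtain ⟨h₀, -⟩ := hex _ hne.choose_spec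
        have : Inhabited (Fin (b i)) := ⟨h₀⟩
        choose! h hh using hex
        rw [← Finset.card_fin (b i)]
        refine Finset.card_le_card_of_injOn h (by simp) fun e he e' he' heq => ?_
        obtain ⟨d, rfl, hd⟩ := hh e he
        obtain ⟨d', rfl, hd'⟩ := hh e' he'
        rw [← heq] at hd'
        have := hM.2 _ hd _ hd' (.inl ⟨i, h d.edge⟩) (by simp) (by simp)
        rw [Sym2.eq_iff] at this
        have : d = d' := by simpa using this
        rw [this]
      · rw [Finset.not_nonempty_iff_eq_empty.1 hne]
        simp
  have hone : ∀ u, (M.filter fun m => u ∈ m).card ≤ 1 := by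
    intro u
    rw [Finset.card_le_one]
    intro m hm m' hm'
    simp only [Finset.mem_filter] at hm hm'
    exact hM.2 m hm.1 m' hm'.1 u hm.2 hm'.2
  have hcard : ∀ e ∈ F, (fiber e).card ≤ if e ∈ M' then 2 else 1 := by
    intro e he
    split_ifs with heM
    · obtain ⟨d, rfl⟩ := exists_dart_edge (hFG e he)
      refine (Finset.card_le_card (t := (M.filter fun m => .inr d ∈ m) ∪
        (M.filter fun m => .inr d.symm ∈ m)) fun m hm => ?_).trans
        ((Finset.card_union_le _ _).trans (Nat.add_le_add (hone _) (hone _)))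
      obtain ⟨hmM, d', hd', hm'⟩ := Finset.mem_filter.1 hm
      rcases dart_eq_or_symm hd' with rfl | rfl <;> simp [hmM, hm']
    -- Since `d` is not matched to a copy, it can only be matched to `d.symm`. So every edge charged
    -- to `e` contains `d.symm`, and there is at most one.
    · obtain ⟨d, rfl, hd⟩ : ∃ d : G.Dart, d.edge = e ∧
          ∀ h : Fin (b d.fst), s(.inr d, .inl ⟨d.fst, h⟩) ∉ M := by
        by_contra hcon
        push Not at hcon
        exact heM (Finset.mem_filter.2 ⟨he, hcon⟩)
      refine (Finset.card_le_card (t := M.filter fun m => .inr d.symm ∈ m) fun m hm => ?_).trans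
        (hone _)
      obtain ⟨hmM, d', hd', hm'⟩ := Finset.mem_filter.1 hm
      refine Finset.mem_filter.2 ⟨hmM, ?_⟩
      rcases splitGraph_edge_cases (hM.1 m hmM).1 with ⟨d'', h, rfl⟩ | ⟨d'', rfl⟩
      · obtain rfl : d' = d'' := by simpa using hm'
        rcases dart_eq_or_symm hd' with rfl | rfl
        · exact absurd hmM (hd h)
        · simp
      · rcases dart_eq_or_symm hd' with rfl | rfl <;>
        · simp only [Sym2.mem_iff, Sum.inr.injEq] at hm' ⊢
          rcases hm' with rfl | h
          · simp
          · simp [h]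
  have hsub : M' ⊆ F := Finset.filter_subset _ _
  calc ∑ m ∈ M, splitWeight G b w m ≤ ∑ e ∈ F, (fiber e).card * w e := hsum
    _ ≤ ∑ e ∈ F, ((if e ∈ M' then w e else 0) + w e) := by
        refine Finset.sum_le_sum fun e he => ?_
        have h1 := mul_le_mul_of_nonneg_right (Nat.cast_le (α := ℝ).2 (hcard e he))
          (hw e (hFG e he)).le
        refine h1.trans_eq ?_
        split_ifs <;> push_cast <;> ring
    _ = ∑ e ∈ M', w e + ∑ e ∈ F, w e := by
        rw [Finset.sum_add_distrib, ← Finset.sum_filter, Finset.filter_mem_eq_inter,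
          Finset.inter_eq_right.2 hsub]
    _ ≤ _ := add_le_add_left (hM'.weight_le w) _

-- An edge of the b-matching contributes two edges from darts to copies, any other edge of `F` the
-- edge between its darts. By `hFS` the darts of the b-matching belong to the coalition, and are
-- counted once in the sum over `F`.
open Classical in
theorem le_partitionedValue_split (T : Finset (V ⊕ G.edgeSet)) (S : Finset V)
    (F : Finset (Sym2 V)) (hS : ∀ i ∈ S, .inl i ∈ T) (hFG : ∀ e ∈ F, e ∈ G.edgeSet)
    (hF : ∀ e : G.edgeSet, (e : Sym2 V) ∈ F → .inr e ∈ T)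
    (hFS : ∀ e ∈ G.edgeSet, (∀ i ∈ e, i ∈ S) → e ∈ F) :
    bMatchingValue G b w S + ∑ e ∈ F, w e ≤
      partitionedValue (splitGraph G b) (splitWeight G b w) (splitOwner G b) T := by
  have := Fintype.ofFinite V
  rw [← le_sub_iff_add_le]
  refine bMatchingValue_le fun M hM => ?_
  rw [le_sub_iff_add_le]
  have hMF : M ⊆ F := fun e he => hFS e (hM.1 e he).1 (hM.1 e he).2
  -- At most `b i` edges of `M` meet `i`, so they can be assigned distinct copies of `i`.
  have hinj : ∀ i, ∃ h : {e // e ∈ M.filter fun e => i ∈ e} → Fin (b i), Function.Injective h := by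
    intro i
    have : Nonempty ({e // e ∈ M.filter fun e => i ∈ e} ↪ Fin (b i)) :=
      Function.Embedding.nonempty_of_card_le (by
        rw [Fintype.card_coe, Fintype.card_fin]
        exact hM.2 i)
    exact ⟨this.some, this.some.injective⟩
  choose h hh using hinj
  have hmem : ∀ d : {d : G.Dart // d.edge ∈ M}, d.1.edge ∈ M.filter fun e => d.1.fst ∈ e :=
    fun d => Finset.mem_filter.2 ⟨d.2, by simp [SimpleGraph.Dart.edge]⟩
  let copyEdge (d : {d : G.Dart // d.edge ∈ M}) : Sym2 (SplitVertex G b) :=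
    s(.inr d.1, .inl ⟨d.1.fst, h _ ⟨_, hmem d⟩⟩)
  have hdart : ∀ e : {e // e ∈ F \ M}, ∃ d : G.Dart, d.edge = e :=
    fun e => exists_dart_edge (hFG _ (Finset.mem_sdiff.1 e.2).1)
  choose δ hδ using hdart
  let dartEdge (e : {e // e ∈ F \ M}) : Sym2 (SplitVertex G b) := s(.inr (δ e), .inr (δ e).symm)
  have hcopy : Function.Injective copyEdge := by
    intro d d' hdd
    simp only [copyEdge, Sym2.eq_iff, Sum.inr.injEq, reduceCtorEq, and_false, or_false] at hdd
    exact Subtype.ext hdd.1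
  have hdartEdge : ∀ (e : {e // e ∈ F \ M}) (d : G.Dart), .inr d ∈ dartEdge e → d.edge = e.1 := by
    intro e d hd
    rw [← hδ]
    simp only [dartEdge, Sym2.mem_iff, Sum.inr.injEq] at hd
    rcases hd with rfl | rfl <;> simp
  have hdinj : Function.Injective dartEdge := by
    intro e e' hee
    have h1 : Sum.inr (δ e) ∈ dartEdge e := by simp [dartEdge]
    have h2 := hdartEdge e _ h1
    rw [hee] at h1
    exact Subtype.ext (h2.symm.trans (hdartEdge e' _ h1))
  let A := Finset.univ.image copyEdge
  let B := Finset.univ.image dartEdge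
  have hdisj : Disjoint A B := by
    rw [Finset.disjoint_left]
    rintro m hA hB
    obtain ⟨d, -, rfl⟩ := Finset.mem_image.1 hA
    obtain ⟨e, -, he⟩ := Finset.mem_image.1 hB
    simp [copyEdge, dartEdge] at he
  have hmatch : IsMatchingOn (splitGraph G b) (fun u => splitOwner G b u ∈ T) (A ∪ B) := by
    have hMS : ∀ d : {d : G.Dart // d.edge ∈ M}, d.1.fst ∈ S := fun d =>
      (hM.1 _ d.2).2 _ (by simp [SimpleGraph.Dart.edge])
    constructor
    · intro m hm
      rcases Finset.mem_union.1 hm with hm | hm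
      · obtain ⟨d, -, rfl⟩ := Finset.mem_image.1 hm
        refine ⟨by simp [copyEdge], fun p hp => ?_⟩
        simp only [copyEdge, Sym2.mem_iff] at hp
        rcases hp with rfl | rfl
        · exact hF _ (hMF d.2)
        · exact hS _ (hMS d)
      · obtain ⟨e, -, rfl⟩ := Finset.mem_image.1 hm
        refine ⟨by simp [dartEdge], fun p hp => ?_⟩
        have hd : ∀ d : G.Dart, .inr d ∈ dartEdge e → splitOwner G b (.inr d) ∈ T := by
          intro d hd
          refine hF ⟨d.edge, d.edge_mem⟩ ?_
          show d.edge ∈ F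
          rw [hdartEdge e d hd]
          exact (Finset.mem_sdiff.1 e.2).1
        have hp' := hp
        simp only [dartEdge, Sym2.mem_iff] at hp'
        rcases hp' with rfl | rfl <;> exact hd _ hp
    · have hAB : ∀ d e p, p ∈ copyEdge d → p ∈ dartEdge e → False := by
        intro d e p hp hp'
        simp only [copyEdge, Sym2.mem_iff] at hp
        rcases hp with rfl | rfl
        · exact (Finset.mem_sdiff.1 e.2).2 (hdartEdge e _ hp' ▸ d.2)
        · simp [dartEdge] at hp'
      intro m hm m' hm' p hp hp'
      rcases Finset.mem_union.1 hm with hm | hm <;> rcases Finset.mem_union.1 hm' with hm' | hm' <;>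
        obtain ⟨x, -, rfl⟩ := Finset.mem_image.1 hm <;>
        obtain ⟨y, -, rfl⟩ := Finset.mem_image.1 hm'
      · congr 1
        simp only [copyEdge, Sym2.mem_iff] at hp hp'
        rcases hp with rfl | rfl
        · exact Subtype.ext (by simpa using hp')
        · simp only [reduceCtorEq, Sum.inl.injEq, false_or, Sigma.mk.injEq] at hp'
          -- The two copies live in types that depend on their vertices. With a variable `i` for one
          -- vertex, the heterogeneous equality becomes an equality, and injectivity of the
          -- assignment identifies the edges.
          have hkey : ∀ (i : V) (hi : y.1.fst = i)
              (e : {e // e ∈ M.filter fun e => i ∈ e}),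
              h i e ≍ h _ ⟨_, hmem y⟩ → e.1 = y.1.edge := by
            rintro _ rfl e he
            rw [hh _ (eq_of_heq he)]
          have he := hkey _ hp'.1.symm _ hp'.2
          -- The darts have the same edge and the same initial vertex; opposite darts would make the
          -- edge a loop.
          rcases dart_eq_or_symm he with h1 | h1
          · exact Subtype.ext h1
          · have h2 := hp'.1
            rw [h1] at h2
            exact absurd h2 y.1.fst_ne_snd.symm
      · exact (hAB _ _ _ hp hp').elim
      · exact (hAB _ _ _ hp' hp).elim
      · have key : ∀ e, p ∈ dartEdge e → ∃ d : G.Dart, p = .inr d ∧ d.edge = e.1 := by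
          intro e he
          have he' := he
          simp only [dartEdge, Sym2.mem_iff] at he'
          rcases he' with rfl | rfl <;> exact ⟨_, rfl, hdartEdge e _ he⟩
        obtain ⟨d, rfl, h1⟩ := key _ hp
        rw [Subtype.ext (h1.symm.trans (hdartEdge _ _ hp'))]
  refine le_trans (le_of_eq ?_) (hmatch.weight_le (splitWeight G b w))
  have hA : ∑ m ∈ A, splitWeight G b w m = ∑ e ∈ M, 2 * w e := by
    rw [Finset.sum_image fun _ _ _ _ h => hcopy h]
    have h1 : ∑ d : {d : G.Dart // d.edge ∈ M}, splitWeight G b w (copyEdge d) =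
        ∑ d : G.Dart with d.edge ∈ M, w d.edge := by
      rw [Finset.sum_subtype (p := fun d : G.Dart => d.edge ∈ M) _ (by simp)]
      rfl
    rw [h1, ← Finset.sum_fiberwise_of_maps_to (t := M) (g := fun d : G.Dart => d.edge) (by simp)]
    refine Finset.sum_congr rfl fun e he => ?_
    obtain ⟨d, rfl⟩ := exists_dart_edge (hM.1 e he).1
    -- The factor two arises here: each edge of `M` has exactly two darts.
    have h2 : (Finset.univ.filter fun d' : G.Dart => d'.edge ∈ M).filter
        (fun d' => d'.edge = d.edge) = {d, d.symm} := by
      ext d'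
      simp only [Finset.mem_filter, Finset.mem_univ, true_and, Finset.mem_insert,
        Finset.mem_singleton]
      refine ⟨fun h => dart_eq_or_symm h.2, ?_⟩
      rintro (rfl | rfl) <;> simp [he]
    rw [h2, Finset.sum_pair d.symm_ne.symm]
    simp [two_mul]
  have hB : ∑ m ∈ B, splitWeight G b w m = ∑ e ∈ F \ M, w e := by
    rw [Finset.sum_image fun _ _ _ _ h => hdinj h, ← Finset.sum_coe_sort (F \ M)]
    refine Finset.sum_congr rfl fun e _ => ?_
    simp only [dartEdge, splitWeight_dart, hδ]
  rw [Finset.sum_union hdisj, hA, hB, ← Finset.sum_sdiff hMF, ← Finset.mul_sum]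
  ring

end SplitGame

/-! ### The core of the split game -/

section SplitCore

variable {V : Type*} {G : SimpleGraph V} {b : V → ℕ} {w : Sym2 V → ℝ}

/-- A chosen end-vertex of an edge. -/
noncomputable def someEnd (e : Sym2 V) : V := (Sym2.exists_mem e).choose

theorem someEnd_mem (e : Sym2 V) : someEnd e ∈ e := (Sym2.exists_mem e).choose_spec

/-- Any choice of an end as anchor works: an edge with both ends in a coalition is then anchored in
it, so closure under anchoring puts all induced edges into F. The map `e` is the identity, left
opaque. -/
theorem coreReduction_split [Fintype V] [Fintype G.edgeSet] (hw : PositiveWeights G w)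
    {e : V ⊕ G.edgeSet ≃ V ⊕ G.edgeSet} (he : ∀ p, e p = p) :
    CoreReduction e (bMatchingValue G b w)
      (partitionedValue (splitGraph G b) (splitWeight G b w) (splitOwner G b))
      (fun e => w e) (fun e => someEnd e) := by
  classical
  have hF : ∀ (F : Finset G.edgeSet) (q : G.edgeSet),
      (q : Sym2 V) ∈ F.map (.subtype _) ↔ q ∈ F := by
    simp
  have hFG : ∀ (F : Finset G.edgeSet), ∀ q ∈ F.map (.subtype _), q ∈ G.edgeSet := by
    simp +contextual
  have hsum : ∀ F : Finset G.edgeSet, ∑ q ∈ F, w q = ∑ q ∈ F.map (.subtype _), w q := by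
    simp
  refine ⟨fun T S F hS hF' => ?_, fun T S F hS hF' hT => ?_⟩ <;>
    simp only [he] at hS hF' <;> rw [hsum]
  · exact partitionedValue_split_le hw T S _ (fun i => (hS i).2)
      (fun q hq => (hF F q).2 ((hF' q).2 hq)) (hFG F)
  · exact le_partitionedValue_split T S _ (fun i => (hS i).1) (hFG F)
      (fun q hq => (hF' q).1 ((hF F q).1 hq)) fun q hq h => (hF F ⟨q, hq⟩).2
        (hT ⟨q, hq⟩ (h _ (someEnd_mem q)))

end SplitCore

theorem splitting_construction (V : Type*) [Fintype V] [DecidableEq V] (G : SimpleGraph V)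
    [DecidableRel G.Adj] (b : V → ℕ) (w : Sym2 V → ℝ) (hb : ∀ i, 0 < b i)
    (hw : PositiveWeights G w) :
    PositiveWeights (splitGraph G b) (splitWeight G b w) ∧
      Function.Surjective (splitOwner G b) ∧
      (2 ≤ maxCapacity b → width (splitOwner G b) = maxCapacity b) ∧
      (maxCapacity b ≤ 1 → width (id : V → V) = maxCapacity b ∧
        partitionedValue G w (id : V → V) = bMatchingValue G b w) ∧
      (UniformWeights G w → UniformWeights (splitGraph G b) (splitWeight G b w)) ∧
      (∀ x : V → ℝ, IsAllocation (bMatchingValue G b w) x →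
        IsAllocation (partitionedValue (splitGraph G b) (splitWeight G b w) (splitOwner G b))
          (splitVector G w x) ∧
        (x ∈ core (bMatchingValue G b w) ↔ splitVector G w x ∈
          core (partitionedValue (splitGraph G b) (splitWeight G b w) (splitOwner G b))) ∧
        ∀ S : Finset (V ⊕ G.edgeSet),
          Violates (partitionedValue (splitGraph G b) (splitWeight G b w) (splitOwner G b))
            (splitVector G w x) S →
          Violates (bMatchingValue G b w) x S.toLeft) ∧
      ((core (bMatchingValue G b w)).Nonempty ↔
        (core (partitionedValue (splitGraph G b) (splitWeight G b w)
          (splitOwner G b))).Nonempty) := by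
  obtain ⟨e, he⟩ : ∃ e : V ⊕ G.edgeSet ≃ V ⊕ G.edgeSet, ∀ p, e p = p :=
    ⟨Equiv.refl _, fun _ => rfl⟩
  have hred := coreReduction_split (b := b) hw he
  have hV : ∀ (x : V → ℝ) i, splitVector G w x (e (.inl i)) = x i :=
    fun x i => by rw [he]; rfl
  have hQ : ∀ (x : V → ℝ) q, splitVector G w x (e (.inr q)) = w q :=
    fun x q => by rw [he]; rfl
  refine ⟨positiveWeights_split hw, splitOwner_surjective hb, width_splitOwner,
    fun h => ⟨width_id hb h, partitionedValue_id G w fun i => ?_⟩, uniformWeights_split,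
    fun x hx => ⟨(hred.isAllocation_iff (hV x) (hQ x)).2 hx,
      (hred.mem_core_iff (hV x) (hQ x)).symm, fun S hS => ?_⟩, hred.nonempty_iff⟩
  · exact le_antisymm ((Finset.le_sup (f := b) (Finset.mem_univ i)).trans h) (hb i)
  · convert hred.violates (hV x) (hQ x) hS using 1
    ext i
    simp [he]

/-! ### The padded split game -/

/-- The entry of the weight matrix for the vertices number `r` and `r'` in the rows `i` and `i'`.
In each row, the first `B` vertices are copies (of which the first `b i` are not isolated), and the
next `q` vertices are darts. Without darts, the matrix is that of the original graph. -/
def padEntry (W : ℕ → ℕ → ℕ) (b : ℕ → ℕ) (B q i r i' r' : ℕ) : ℕ :=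
  if r < B then
    if r' < B then (if B ≤ 1 then W i i' else 0)
    else if r' < B + q ∧ i = i' ∧ r < b i then W i (r' - B) else 0
  else if r < B + q then
    if r' < B then (if i = i' ∧ r' < b i then W i (r - B) else 0)
    else if r' < B + q ∧ r = B + i' ∧ r' = B + i then W i i' else 0
  else 0

/-- The owner of vertex `r` in row `i`. Row `i` has `1 + q` players: the vertex `i` and the
pairs `(i, j)`. A pair `(i, j)` with `i ≤ j` owns the darts between `i` and `j`, any other pair owns
isolated vertices. -/
def padOwner (B q i r : ℕ) : ℕ :=
  if r < B then i * (1 + q)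
  else if r < B + q then min i (r - B) * (1 + q) + (1 + max i (r - B))
  else max i (r - B - q) * (1 + q) + (1 + min i (r - B - q))

/-! ### Arithmetic of rows and symmetry of the padded matrix -/

section Arithmetic

theorem padEntry_comm {W : ℕ → ℕ → ℕ} (hW : ∀ i j, W i j = W j i) (b : ℕ → ℕ) (B q i r i' r' : ℕ) :
    padEntry W b B q i r i' r' = padEntry W b B q i' r' i r := by
  unfold padEntry
  have := hW i i'
  by_cases hi : i = i'
  · subst hi
    split_ifs <;> first | rfl | omega
  · split_ifs <;> first | rfl | omega

theorem padEntry_self {W : ℕ → ℕ → ℕ} (hW : ∀ i, W i i = 0) (b : ℕ → ℕ) (B q i r : ℕ) :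
    padEntry W b B q i r i r = 0 := by
  unfold padEntry
  have := hW i
  split_ifs <;> first | rfl | omega

theorem padEntry_origin {W : ℕ → ℕ → ℕ} {b : ℕ → ℕ} {B q i r i' r' : ℕ}
    (h : 0 < padEntry W b B q i r i' r') : ∃ j j', padEntry W b B q i r i' r' = W j j' := by
  unfold padEntry at h ⊢
  split_ifs at h ⊢ <;> first | exact ⟨_, _, rfl⟩ | omega

theorem row_mul_add_lt {n m i r : ℕ} (hi : i < n) (hr : r < m) : i * m + r < n * m := by
  have := Nat.mul_le_mul_right m (Nat.succ_le_of_lt hi)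
  rw [Nat.succ_mul] at this
  omega

theorem row_div {m i r : ℕ} (hr : r < m) : (i * m + r) / m = i := by
  rw [Nat.mul_comm, Nat.mul_add_div (by omega), Nat.div_eq_of_lt hr, Nat.add_zero]

theorem row_mod {m i r : ℕ} (hr : r < m) : (i * m + r) % m = r := by
  rw [Nat.mul_comm, Nat.mul_add_mod, Nat.mod_eq_of_lt hr]

theorem row_inj {m i r i' r' : ℕ} (hr : r < m) (hr' : r' < m) (h : i * m + r = i' * m + r') :
    i = i' ∧ r = r' := by
  have h1 := row_div (i := i) hr
  have h2 := row_mod (i := i) hr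
  rw [h, row_div hr'] at h1
  rw [h, row_mod hr'] at h2
  exact ⟨h1.symm, h2.symm⟩

theorem row_div_lt {n m u : ℕ} (hu : u < n * m) : u / m < n :=
  Nat.div_lt_of_lt_mul (by rwa [Nat.mul_comm])

theorem row_mod_lt {n m u : ℕ} (hu : u < n * m) : u % m < m := by
  refine Nat.mod_lt _ (Nat.pos_of_ne_zero ?_)
  rintro rfl
  simp at hu

theorem row_eq {m u : ℕ} : u / m * m + u % m = u := Nat.div_add_mod' u m

/-- If there are slots, there is one for each vertex. So a slot number is also a row number, and
sorting the two by `min` and `max` stays in range. -/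
theorem padOwner_lt {n B q i r : ℕ} (hq : q = 0 ∨ q = n) (hi : i < n) (hr : r < B + 2 * q) :
    padOwner B q i r < n * (1 + q) := by
  unfold padOwner
  split_ifs with h1 h2
  · exact row_mul_add_lt (r := 0) hi (by omega)
  · rcases hq with rfl | rfl
    · omega
    · exact row_mul_add_lt (by omega) (by omega)
  · rcases hq with rfl | rfl
    · omega
    · exact row_mul_add_lt (by omega) (by omega)

end Arithmetic

/-- The players of a game with `n` rows of `1 + q` players. -/
def rowPlayer {n q : ℕ} : Fin n ⊕ (Fin n × Fin q) → Fin (n * (1 + q))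
  | .inl i => ⟨i * (1 + q) + 0, row_mul_add_lt i.2 (by omega)⟩
  | .inr (i, j) => ⟨i * (1 + q) + (1 + j), row_mul_add_lt i.2 (by omega)⟩

theorem rowPlayer_bijective (n q : ℕ) : Function.Bijective (rowPlayer (n := n) (q := q)) := by
  rw [Fintype.bijective_iff_injective_and_card]
  constructor
  · rintro (i | ⟨i, j⟩) (i' | ⟨i', j'⟩) h <;>
      have h := row_inj (by omega) (by omega) (Fin.ext_iff.1 h)
    · rw [Fin.ext h.1]
    · omega
    · omega
    · rw [Fin.ext h.1, Fin.ext (show (j : ℕ) = j' by omega)]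
  · simp
    ring

/-- The players of a game with `n` rows of `1 + q` players, as an equivalence. -/
noncomputable def rowPlayers (n q : ℕ) : Fin n ⊕ (Fin n × Fin q) ≃ Fin (n * (1 + q)) :=
  Equiv.ofBijective rowPlayer (rowPlayer_bijective n q)

@[simp] theorem rowPlayers_inl {n q : ℕ} (i : Fin n) :
    (rowPlayers n q (.inl i) : ℕ) = i * (1 + q) := rfl

@[simp] theorem rowPlayers_inr {n q : ℕ} (i : Fin n) (j : Fin q) :
    (rowPlayers n q (.inr (i, j)) : ℕ) = i * (1 + q) + (1 + j) := rfl

/-! ### The padded game as an instance, and its width -/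

namespace BMatchingGame

variable (I : BMatchingGame)

open Classical in
/-- The numerators of the weights, extended by zero. -/
noncomputable def wt (i j : ℕ) : ℕ :=
  if h : ∃ (hi : i < I.n) (hj : j < I.n), I.graph.Adj ⟨i, hi⟩ ⟨j, hj⟩ then
    I.num s(⟨i, h.1⟩, ⟨j, h.2.1⟩) else 0

/-- The capacities, extended by zero. -/
def capacity (i : ℕ) : ℕ := if h : i < I.n then I.cap ⟨i, h⟩ else 0

variable {I}

theorem wt_of_adj {i j : Fin I.n} (h : I.graph.Adj i j) : I.wt i j = I.num s(i, j) :=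
  dif_pos ⟨i.2, j.2, h⟩

theorem adj_of_wt_pos {i j : ℕ} (h : 0 < I.wt i j) :
    ∃ (hi : i < I.n) (hj : j < I.n), I.graph.Adj ⟨i, hi⟩ ⟨j, hj⟩ := by
  by_contra hcon
  rw [wt, dif_neg hcon] at h
  exact h.false

/-- Since weights are positive, the value zero can stand for non-adjacency. -/
theorem wt_pos_iff {i j : Fin I.n} : 0 < I.wt i j ↔ I.graph.Adj i j :=
  ⟨fun h => (adj_of_wt_pos h).2.2, fun h => wt_of_adj h ▸ I.num_pos _ h⟩

variable (I)

theorem wt_comm (i j : ℕ) : I.wt i j = I.wt j i := by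
  by_cases h : ∃ (hi : i < I.n) (hj : j < I.n), I.graph.Adj ⟨i, hi⟩ ⟨j, hj⟩
  · obtain ⟨hi, hj, h⟩ := h
    rw [wt_of_adj (i := ⟨i, hi⟩) (j := ⟨j, hj⟩) h, wt_of_adj h.symm, Sym2.eq_swap]
  · rw [wt, dif_neg h, wt, dif_neg]
    rintro ⟨hi, hj, h'⟩
    exact h ⟨hj, hi, h'.symm⟩

theorem wt_self (i : ℕ) : I.wt i i = 0 := by
  by_contra h
  obtain ⟨_, _, h⟩ := adj_of_wt_pos (Nat.pos_of_ne_zero h)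
  exact h.ne rfl

@[simp] theorem capacity_coe (i : Fin I.n) : I.capacity i = I.cap i := dif_pos i.2

theorem cap_le_bStar (i : Fin I.n) : I.cap i ≤ I.bStar :=
  Finset.le_sup (f := I.cap) (Finset.mem_univ i)

theorem bStar_pos {i : ℕ} (hi : i < I.n) : 0 < I.bStar :=
  (I.cap_pos ⟨i, hi⟩).trans_le (I.cap_le_bStar _)

theorem positiveWeights : PositiveWeights I.graph I.weight := fun e he =>
  div_pos (Nat.cast_pos.2 (I.num_pos e he)) (Nat.cast_pos.2 I.den_pos)

/-- The number of darts in a row: none if all capacities are one. -/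
def slots : ℕ := if 2 ≤ I.bStar then I.n else 0

theorem slots_eq : I.slots = 0 ∨ I.slots = I.n := by
  unfold slots
  split_ifs <;> simp

/-- The entry of the weight matrix of the padded game. -/
noncomputable def entry (i r j s : ℕ) : ℕ :=
  padEntry I.wt I.capacity I.bStar I.slots i r j s

/-- The number of vertices in a row. -/
def rowLength : ℕ := I.bStar + 2 * I.slots

/-- The weight between two vertices of the padded game. -/
noncomputable def vertexEntry (u u' : ℕ) : ℕ :=
  I.entry (u / I.rowLength) (u % I.rowLength) (u' / I.rowLength) (u' % I.rowLength)

theorem vertexEntry_comm (u u' : ℕ) : I.vertexEntry u u' = I.vertexEntry u' u :=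
  padEntry_comm I.wt_comm ..

theorem vertexEntry_row {i r i' r' : ℕ} (hr : r < I.rowLength) (hr' : r' < I.rowLength) :
    I.vertexEntry (i * I.rowLength + r) (i' * I.rowLength + r') = I.entry i r i' r' := by
  rw [vertexEntry, row_div hr, row_div hr', row_mod hr, row_mod hr']

/-- The split game, with isolated vertices (and players who own isolated vertices only) added so
that all rows have the same length; if all capacities are one, the game itself. -/
noncomputable def padded : PartitionedGame where
  n := I.n * I.rowLength
  graph :=
    { Adj := fun u u' => 0 < I.vertexEntry u u'
      symm := ⟨fun u u' h => by rwa [I.vertexEntry_comm]⟩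
      loopless := ⟨fun u h => by
        rw [vertexEntry, entry, padEntry_self I.wt_self] at h
        exact h.false⟩ }
  num := Sym2.lift ⟨fun u u' => I.vertexEntry u u', fun u u' => I.vertexEntry_comm u u'⟩
  den := I.den
  num_pos := by
    intro e
    induction e with
    | _ u u' => exact id
  den_pos := I.den_pos
  k := I.n * (1 + I.slots)
  owner := fun u => ⟨padOwner I.bStar I.slots (u / I.rowLength) (u % I.rowLength),
    padOwner_lt I.slots_eq (row_div_lt u.2) (row_mod_lt u.2)⟩
  owner_surjective := by
    intro p
    have hrow : ∀ {i r : ℕ} (hi : i < I.n) (hr : r < I.rowLength)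
        (h : padOwner I.bStar I.slots i r = p), ∃ u : Fin (I.n * I.rowLength),
        (⟨padOwner I.bStar I.slots (u / I.rowLength) (u % I.rowLength),
          padOwner_lt I.slots_eq (row_div_lt u.2) (row_mod_lt u.2)⟩ :
            Fin (I.n * (1 + I.slots))) = p :=
      fun {i r} hi hr h => ⟨⟨i * I.rowLength + r, row_mul_add_lt hi hr⟩, Fin.ext (by
        simp only [row_div hr, row_mod hr, h])⟩
    obtain ⟨i | ⟨a, c⟩, rfl⟩ := (rowPlayers I.n I.slots).surjective p
    · have := I.bStar_pos i.2
      refine hrow i.2 (r := 0) (by unfold rowLength; omega) ?_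
      simp [padOwner, this]
    · have hc := c.2
      have hn : I.slots = I.n := by have := I.slots_eq; omega
      have ha := a.2
      -- The slot of the dart from `a` to `c` represents the pair if `a ≤ c`. The last `q` vertices
      -- of each row exist to make the sets of the remaining pairs non-empty.
      rcases le_total (a : ℕ) c with h | h
      · refine hrow a.2 (r := I.bStar + c) (by unfold rowLength; omega) ?_
        simp [padOwner, h]
      · refine hrow (i := c) (by omega) (r := I.bStar + I.slots + a)
          (by unfold rowLength; omega) ?_
        have h1 : I.bStar + I.slots + a - I.bStar - I.slots = a := by omega
        have h2 : ¬ I.bStar + I.slots + a < I.bStar := by omega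
        simp [padOwner, h, h1, h2]

theorem uniform_padded (h : I.Uniform) : I.padded.Uniform := by
  intro e he
  induction e with
  | _ u u' =>
    obtain ⟨j, j', hj⟩ := padEntry_origin (show 0 < padEntry .. from he)
    have hpos : 0 < I.wt j j' := hj ▸ he
    obtain ⟨hj1, hj2, hadj⟩ := adj_of_wt_pos hpos
    have h1 := h s(_, _) hadj
    rw [WeightedGraph.weight, ← wt_of_adj hadj, ← hj] at h1
    exact h1

/-- All first places of a row belong to its vertex player, who thus owns exactly `bStar` vertices. A
pair owns at most two, and pairs exist only if `bStar` is at least two. -/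
theorem width_padded : width I.padded.owner = I.bStar := by
  classical
  refine le_antisymm (Finset.sup_le fun p _ => ?_) ?_
  · have key : ∀ s : Finset ℕ, s.card ≤ I.bStar → (∀ i r, i < I.n → r < I.rowLength →
        padOwner I.bStar I.slots i r = p → i * I.rowLength + r ∈ s) →
        Nat.card {u // I.padded.owner u = p} ≤ I.bStar := by
      intro s hs h
      refine le_trans ?_ hs
      have hmem : ∀ u : {u // I.padded.owner u = p}, (u.1 : ℕ) ∈ s := by
        rintro ⟨u, hu⟩
        have := h _ _ (row_div_lt u.2) (row_mod_lt u.2) (congrArg Fin.val hu)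
        rwa [row_eq] at this
      calc Nat.card {u // I.padded.owner u = p} ≤ Nat.card s :=
            Nat.card_le_card_of_injective (fun u => (⟨u.1, hmem u⟩ : s)) fun u u' h =>
              Subtype.ext (Fin.ext (by simpa using h))
        _ = s.card := by simp
    obtain ⟨i | ⟨a, c⟩, rfl⟩ := (rowPlayers I.n I.slots).surjective p
    · refine key ((Finset.range I.bStar).image fun r => i * I.rowLength + r)
        (Finset.card_image_le.trans (by simp)) fun i' r hi' hr h => ?_
      rw [rowPlayers_inl] at h
      have hq := I.slots_eq
      unfold rowLength at hr
      unfold padOwner at h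
      split_ifs at h with h1 h2
      · obtain rfl : i' = i := Nat.eq_of_mul_eq_mul_right (by omega) h
        exact Finset.mem_image_of_mem _ (by simpa using h1)
      · have := (row_inj (r' := 0) (by omega) (by omega) h).2
        omega
      · have := (row_inj (r' := 0) (by omega) (by omega) h).2
        omega
    · have hc := c.2
      have h2 : 2 ≤ I.bStar := by
        by_contra hcon
        have : I.slots = 0 := if_neg hcon
        omega
      have hq : I.slots = I.n := if_pos h2
      have ha := a.2
      -- A pair with `a < c` owns two opposite dart slots, a pair with `a > c` two filler vertices,
      -- and `(a, a)` one vertex of each kind.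
      rcases lt_trichotomy (a : ℕ) c with hac | hac | hac
      · refine key {a * I.rowLength + (I.bStar + c), c * I.rowLength + (I.bStar + a)}
          (Finset.card_le_two.trans h2) fun i r hi hr h => ?_
        rw [rowPlayers_inr] at h
        unfold rowLength at hr
        unfold padOwner at h
        split_ifs at h with h1 h2
        · have := (row_inj (r := 0) (by omega) (by omega) h).2
          omega
        · obtain ⟨h3, h4⟩ := row_inj (by omega) (by omega) h
          rcases le_total i (r - I.bStar) with h5 | h5
          · obtain rfl : i = a := by omega
            obtain rfl : r = I.bStar + c := by omega
            simp
          · obtain rfl : i = c := by omega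
            obtain rfl : r = I.bStar + a := by omega
            simp
        · obtain ⟨h3, h4⟩ := row_inj (by omega) (by omega) h
          omega
      · refine key {a * I.rowLength + (I.bStar + a), a * I.rowLength + (I.bStar + I.slots + a)}
          (Finset.card_le_two.trans h2) fun i r hi hr h => ?_
        rw [rowPlayers_inr] at h
        unfold rowLength at hr
        unfold padOwner at h
        split_ifs at h with h1 h2
        · have := (row_inj (r := 0) (by omega) (by omega) h).2
          omega
        · obtain ⟨h3, h4⟩ := row_inj (by omega) (by omega) h
          obtain rfl : i = a := by omega
          obtain rfl : r = I.bStar + a := by omega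
          simp
        · obtain ⟨h3, h4⟩ := row_inj (by omega) (by omega) h
          obtain rfl : i = a := by omega
          obtain rfl : r = I.bStar + I.slots + a := by omega
          simp
      · refine key {a * I.rowLength + (I.bStar + I.slots + c),
          c * I.rowLength + (I.bStar + I.slots + a)}
          (Finset.card_le_two.trans h2) fun i r hi hr h => ?_
        rw [rowPlayers_inr] at h
        unfold rowLength at hr
        unfold padOwner at h
        split_ifs at h with h1 h2
        · have := (row_inj (r := 0) (by omega) (by omega) h).2
          omega
        · obtain ⟨h3, h4⟩ := row_inj (by omega) (by omega) h
          omega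
        · obtain ⟨h3, h4⟩ := row_inj (by omega) (by omega) h
          rcases le_total i (r - I.bStar - I.slots) with h5 | h5
          · obtain rfl : i = c := by omega
            obtain rfl : r = I.bStar + I.slots + a := by omega
            simp
          · obtain rfl : i = a := by omega
            obtain rfl : r = I.bStar + I.slots + c := by omega
            simp
  · rcases Nat.eq_zero_or_pos I.n with hn | hn
    · have : IsEmpty (Fin I.n) := by rw [hn]; infer_instance
      simp [bStar, maxCapacity]
    · let p : Fin I.padded.k := rowPlayers I.n I.slots (.inl ⟨0, hn⟩)
      have hR : I.bStar ≤ I.rowLength := Nat.le_add_right _ _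
      let φ : Fin I.bStar → {u // I.padded.owner u = p} := fun r =>
        ⟨⟨0 * I.rowLength + r, row_mul_add_lt hn (r.2.trans_le hR)⟩, Fin.ext (by
          show padOwner _ _ ((0 * I.rowLength + r) / _) ((0 * I.rowLength + r) % _) = 0 * _
          rw [row_div (r.2.trans_le hR), row_mod (r.2.trans_le hR), padOwner, if_pos r.2])⟩
      have hφ : Function.Injective φ := by
        intro r r' h
        have := congrArg (fun u => (u.1 : ℕ)) h
        simpa [φ, Fin.ext_iff] using this
      calc I.bStar = Nat.card (Fin I.bStar) := by simp
        _ ≤ _ := Nat.card_le_card_of_injective φ hφ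
        _ ≤ _ := Finset.le_sup (f := fun p => Nat.card {u // I.padded.owner u = p})
          (Finset.mem_univ p)

end BMatchingGame

/-! ### Values of the padded game -/

namespace BMatchingGame

variable {I : BMatchingGame}

/-- Vertex `r` in row `i` of the padded game. -/
def vertex {i r : ℕ} (hi : i < I.n) (hr : r < I.rowLength) : Fin I.padded.n :=
  ⟨i * I.rowLength + r, row_mul_add_lt hi hr⟩

variable (I) in
/-- The players of the padded game. -/
noncomputable def player : Fin I.n ⊕ (Fin I.n × Fin I.slots) ≃ Fin I.padded.k :=
  rowPlayers I.n I.slots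

theorem player_inl (i : Fin I.n) : (I.player (.inl i) : ℕ) = i * (1 + I.slots) := rfl

theorem player_inr (i : Fin I.n) (j : Fin I.slots) :
    (I.player (.inr (i, j)) : ℕ) = i * (1 + I.slots) + (1 + j) := rfl

theorem exists_vertex (u : Fin I.padded.n) :
    ∃ (i r : ℕ) (hi : i < I.n) (hr : r < I.rowLength), u = vertex hi hr :=
  ⟨_, _, row_div_lt u.2, row_mod_lt u.2, Fin.ext row_eq.symm⟩

theorem vertex_inj {i r i' r' : ℕ} {hi : i < I.n} {hr : r < I.rowLength} {hi' : i' < I.n}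
    {hr' : r' < I.rowLength} (h : vertex hi hr = vertex hi' hr') : i = i' ∧ r = r' :=
  row_inj hr hr' (Fin.ext_iff.1 h)

theorem adj_vertex {i r i' r' : ℕ} (hi : i < I.n) (hr : r < I.rowLength) (hi' : i' < I.n)
    (hr' : r' < I.rowLength) :
    I.padded.graph.Adj (vertex hi hr) (vertex hi' hr') ↔ 0 < I.entry i r i' r' := by
  rw [← I.vertexEntry_row hr hr']
  rfl

theorem num_vertex {i r i' r' : ℕ} (hi : i < I.n) (hr : r < I.rowLength) (hi' : i' < I.n)
    (hr' : r' < I.rowLength) :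
    I.padded.num s(vertex hi hr, vertex hi' hr') = I.entry i r i' r' := by
  rw [← I.vertexEntry_row hr hr']
  rfl

theorem owner_vertex {i r : ℕ} (hi : i < I.n) (hr : r < I.rowLength) :
    (I.padded.owner (vertex hi hr) : ℕ) = padOwner I.bStar I.slots i r := by
  show padOwner _ _ ((i * I.rowLength + r) / I.rowLength) _ = _
  rw [row_div hr]
  exact congrArg _ (row_mod hr)

/-- Each row shrinks to one vertex, the matrix is that of the original graph, and b-matchings with
unit capacities are matchings. -/
theorem padded_value_of_bStar_le_one (h : I.bStar ≤ 1) (T : Finset (Fin I.padded.k))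
    (S : Finset (Fin I.n)) (hS : ∀ i, i ∈ S ↔ I.player (.inl i) ∈ T) :
    I.padded.value T = I.value S := by
  have hq : I.slots = 0 := if_neg (by omega)
  -- Without vertices `bStar` is zero, so this and the next claim need a row.
  have hB : ∀ {i : ℕ}, i < I.n → I.bStar = 1 := fun hi => by
    have := I.bStar_pos hi
    omega
  have hR : ∀ {i : ℕ}, i < I.n → I.rowLength = 1 := fun hi => by
    have := hB hi
    unfold rowLength
    omega
  have hent : ∀ {i : ℕ} (i' : ℕ), i < I.n → I.entry i 0 i' 0 = I.wt i i' := by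
    intro i i' hi
    simp [entry, padEntry, hB hi]
  have hpos : ∀ {i : ℕ}, i < I.n → 0 < I.rowLength := fun hi => by rw [hR hi]; omega
  rw [value, ← partitionedValue_id I.graph I.weight fun i => le_antisymm
    ((I.cap_le_bStar i).trans h) (I.cap_pos i)]
  refine partitionedValue_embed (H := I.graph) (owner := id)
    (ι := fun i : Fin I.n => vertex i.2 (hpos i.2))
    (κ := fun i => I.player (.inl i)) ?_ T _ hS ?_ ?_ ?_
  · intro i j hij
    exact Fin.ext (vertex_inj hij).1
  · intro u v
    obtain ⟨i, r, hi, hr, rfl⟩ := exists_vertex u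
    obtain ⟨i', r', hi', hr', rfl⟩ := exists_vertex v
    rw [adj_vertex]
    obtain rfl : r = 0 := by have := hR hi; omega
    obtain rfl : r' = 0 := by have := hR hi; omega
    rw [hent _ hi]
    refine ⟨fun h => ⟨⟨i, hi⟩, ⟨i', hi'⟩, (adj_of_wt_pos h).2.2, rfl, rfl⟩, ?_⟩
    rintro ⟨x, y, hxy, h1, h2⟩
    obtain rfl := (vertex_inj h1).1
    obtain rfl := (vertex_inj h2).1
    exact wt_pos_iff.2 hxy
  · intro x y hxy
    rw [WeightedGraph.weight, WeightedGraph.weight, num_vertex, hent _ x.2, wt_of_adj hxy]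
    rfl
  · intro x
    refine Fin.ext ?_
    rw [owner_vertex]
    simp [padOwner, hB x.2, player_inl]

/-- The position of a vertex of the split graph in the padded game. -/
def position (h : I.slots = I.n) : SplitVertex I.graph I.cap → Fin I.padded.n
  | .inl p => vertex (r := p.2) p.1.2
      ((p.2.2.trans_le (I.cap_le_bStar _)).trans_le (Nat.le_add_right _ _))
  | .inr d => vertex (r := I.bStar + d.snd) d.fst.2
      (by have := d.snd.2; unfold rowLength; omega)

theorem entry_copy_dart {i i' j k : ℕ} (hk : k < I.bStar) (hj : j < I.slots) :
    I.entry i k i' (I.bStar + j) = if i = i' ∧ k < I.capacity i then I.wt i' j else 0 := by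
  have h1 : ¬ I.bStar + j < I.bStar := by omega
  simp only [entry, padEntry, hk, h1, add_lt_add_iff_left, hj, if_true, if_false, true_and,
    Nat.add_sub_cancel_left]
  split_ifs with h2
  · rw [h2.1]
  · rfl

theorem entry_dart_dart {i i' j j' : ℕ} (hj : j < I.slots) (hj' : j' < I.slots) :
    I.entry i (I.bStar + j) i' (I.bStar + j') = if j = i' ∧ j' = i then I.wt i i' else 0 := by
  have h1 : ∀ j, ¬ I.bStar + j < I.bStar := by omega
  simp [entry, padEntry, h1, hj, hj']

theorem entry_position (hq : I.slots = I.n) {x y : SplitVertex I.graph I.cap}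
    (hxy : (splitGraph I.graph I.cap).Adj x y) :
    (I.padded.num s(position hq x, position hq y) : ℝ) / I.den =
        splitWeight I.graph I.cap I.weight s(x, y) ∧
      I.padded.graph.Adj (position hq x) (position hq y) := by
  have hcopy : ∀ (d : I.graph.Dart) (p : Σ i, Fin (I.cap i)), d.fst = p.1 →
      (I.padded.num s(position hq (.inl p), position hq (.inr d)) : ℝ) / I.den = I.weight d.edge ∧
      I.padded.graph.Adj (position hq (.inl p)) (position hq (.inr d)) := by
    rintro d ⟨i, k⟩ hd
    obtain rfl : d.fst = i := hd
    have h1 := k.2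
    rw [position, position, num_vertex, adj_vertex, entry_copy_dart
      (k.2.trans_le (I.cap_le_bStar _)) (by rw [hq]; exact d.snd.2), if_pos ⟨rfl, by simp⟩,
      wt_of_adj d.adj]
    exact ⟨rfl, I.num_pos _ d.adj⟩
  rcases x with p | d <;> rcases y with p' | d'
  · simp at hxy
  · exact hcopy _ _ (by simpa using hxy)
  · have := hcopy d p' (by simpa using hxy)
    rw [Sym2.eq_swap, SimpleGraph.adj_comm]
    exact this
  · obtain rfl : d' = d.symm := by simpa using hxy
    rw [position, position, num_vertex, adj_vertex, entry_dart_dart (by rw [hq]; exact d.snd.2)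
      (by rw [hq]; exact d.symm.snd.2), if_pos ⟨rfl, rfl⟩, splitWeight_dart]
    have : I.wt d.fst d.symm.fst = I.num d.edge := wt_of_adj d.adj
    rw [this]
    exact ⟨rfl, I.num_pos _ d.adj⟩

/-- Up to isolated vertices and their owners, the padded game is the split game, embedded by
`position`; an edge player becomes the pair of its smaller and larger end. -/
theorem padded_value_eq_split (h : 2 ≤ I.bStar) (hq : I.slots = I.n) (T : Finset (Fin I.padded.k))
    (T' : Finset (Fin I.n ⊕ I.graph.edgeSet))
    (hT : ∀ i, .inl i ∈ T' ↔ I.player (.inl i) ∈ T)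
    (hT' : ∀ e : I.graph.edgeSet, .inr e ∈ T' ↔
      I.player (.inr (e.1.inf, Fin.cast hq.symm e.1.sup)) ∈ T) :
    I.padded.value T = partitionedValue (splitGraph I.graph I.cap)
      (splitWeight I.graph I.cap I.weight) (splitOwner I.graph I.cap) T' := by
  classical
  have hcap : ∀ (i : Fin I.n) (k : Fin (I.cap i)), (k : ℕ) < I.bStar :=
    fun i k => k.2.trans_le (I.cap_le_bStar i)
  have hB : ¬ I.bStar ≤ 1 := by omega
  refine partitionedValue_embed (H := splitGraph I.graph I.cap) (ι := position hq)
    (κ := Sum.elim (fun i => I.player (.inl i)) fun e =>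
      I.player (.inr (e.1.inf, Fin.cast hq.symm e.1.sup))) ?_ T _ ?_ ?_ ?_ ?_
  · rintro (⟨i, k⟩ | d) (⟨i', k'⟩ | d') hh <;> simp only [position] at hh <;>
      obtain ⟨h1, h2⟩ := vertex_inj hh
    · obtain rfl := Fin.ext h1
      obtain rfl := Fin.ext h2
      rfl
    · have := hcap i k
      omega
    · have := hcap i' k'
      omega
    · have : d = d' := SimpleGraph.Dart.ext _ _ (Prod.ext (Fin.ext h1) (Fin.ext (by omega)))
      rw [this]
  · rintro (i | e)
    · exact hT i
    · exact hT' e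
  · intro u v
    constructor
    · intro huv
      obtain ⟨i, r, hi, hr, rfl⟩ := exists_vertex u
      obtain ⟨i', r', hi', hr', rfl⟩ := exists_vertex v
      rw [adj_vertex] at huv
      have hdart : ∀ {i j : ℕ} (hi : i < I.n) (hj : j < I.n) (hadj : I.graph.Adj ⟨i, hi⟩ ⟨j, hj⟩)
          {r : ℕ} (hr : r < I.rowLength), r = I.bStar + j →
          position hq (.inr ⟨(⟨i, hi⟩, ⟨j, hj⟩), hadj⟩) = vertex hi hr := by
        rintro i j hi hj hadj r hr rfl
        rfl
      unfold entry padEntry at huv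
      simp only [hB, if_false] at huv
      -- The positive entries are those between a copy and a dart, in either order, and those
      -- between opposite darts. The other branches have entry zero.
      split_ifs at huv with h1 h2 h3 h4 h5 h6 h7
      · omega
      · obtain ⟨h3, rfl, h4⟩ := h3
        obtain ⟨_, hj, hadj⟩ := adj_of_wt_pos huv
        rw [capacity, dif_pos hi] at h4
        exact ⟨.inl ⟨⟨i, hi⟩, ⟨r, h4⟩⟩, .inr ⟨(⟨i, hi⟩, ⟨r' - I.bStar, hj⟩), hadj⟩, by simp, rfl,
          hdart _ _ _ _ (by omega)⟩
      · omega
      · obtain ⟨rfl, h4⟩ := h6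
        obtain ⟨_, hj, hadj⟩ := adj_of_wt_pos huv
        rw [capacity, dif_pos hi] at h4
        exact ⟨.inr ⟨(⟨i, hi⟩, ⟨r - I.bStar, hj⟩), hadj⟩, .inl ⟨⟨i, hi⟩, ⟨r', h4⟩⟩, by simp,
          hdart _ _ _ _ (by omega), rfl⟩
      · omega
      · obtain ⟨h8, rfl, rfl⟩ := h7
        obtain ⟨_, _, hadj⟩ := adj_of_wt_pos huv
        exact ⟨.inr ⟨(⟨i, hi⟩, ⟨i', hi'⟩), hadj⟩, .inr ⟨(⟨i', hi'⟩, ⟨i, hi⟩), hadj.symm⟩,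
          by simp [SimpleGraph.Dart.symm], rfl, rfl⟩
      · omega
      · omega
    · rintro ⟨x, y, hxy, rfl, rfl⟩
      exact (entry_position hq hxy).2
  · intro x y hxy
    exact (entry_position hq hxy).1
  · rintro (⟨i, k⟩ | d)
    · refine Fin.ext ?_
      rw [position, owner_vertex]
      simp [padOwner, splitOwner, hcap i k, player_inl]
    · refine Fin.ext ?_
      rw [position, owner_vertex]
      have h1 : ¬ I.bStar + (d.snd : ℕ) < I.bStar := by omega
      have h2 : (d.snd : ℕ) < I.slots := by rw [hq]; exact d.snd.2
      simp only [padOwner, h1, h2, add_lt_add_iff_left, if_true, if_false, splitOwner, Sum.elim_inr,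
        player_inr, Nat.add_sub_cancel_left]
      rfl

variable (I) in
/-- The demand of the player `(i, j)` of the padded game. -/
noncomputable def demand (p : Fin I.n × Fin I.slots) : ℝ :=
  ((if (p.1 : ℕ) < p.2 then I.wt p.1 p.2 else 0 : ℕ) : ℝ) / I.den

/-- Increasing adjacent pairs correspond to edges; all other pairs have demand zero. -/
theorem sum_demand (hq : I.slots = I.n) (F : Finset (Fin I.n × Fin I.slots))
    (F' : Finset (Sym2 (Fin I.n))) (hF : ∀ e, e ∈ F' ↔ e ∈ I.graph.edgeSet ∧
      (e.inf, Fin.cast hq.symm e.sup) ∈ F) : ∑ p ∈ F, I.demand p = ∑ e ∈ F', I.weight e := by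
  symm
  have hlt : ∀ e ∈ I.graph.edgeSet, e.inf < e.sup ∧ s(e.inf, e.sup) = e := by
    intro e he
    induction e with
    | _ i j =>
      rcases lt_or_gt_of_ne (SimpleGraph.Adj.ne he) with hij | hij
      · simp [hij, hij.le]
      · simp [hij, hij.le, Sym2.eq_swap]
  refine Finset.sum_of_injOn (fun e => (e.inf, Fin.cast hq.symm e.sup)) ?_ ?_ ?_ ?_
  · intro e he e' he' hee
    rw [Finset.mem_coe, hF] at he he'
    simp only [Prod.mk.injEq, Fin.cast_inj] at hee
    rw [← (hlt e he.1).2, ← (hlt e' he'.1).2, hee.1, hee.2]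
  · intro e he
    exact ((hF e).1 he).2
  · intro p hp hnot
    rw [demand]
    split_ifs with hlt'
    · rcases Nat.eq_zero_or_pos (I.wt p.1 p.2) with h0 | h0
      · simp [h0]
      · obtain ⟨h1, h2, hadj⟩ := adj_of_wt_pos h0
        have hle : (⟨p.1, h1⟩ : Fin I.n) ≤ ⟨p.2, h2⟩ := hlt'.le
        have hp' : ((s(⟨p.1, h1⟩, ⟨p.2, h2⟩) : Sym2 (Fin I.n)).inf, Fin.cast hq.symm
            (s(⟨p.1, h1⟩, ⟨p.2, h2⟩) : Sym2 (Fin I.n)).sup) = p := by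
          simp [hle]
        refine absurd ⟨s(⟨p.1, h1⟩, ⟨p.2, h2⟩), ?_, hp'⟩ hnot
        rw [Finset.mem_coe, hF, hp']
        exact ⟨hadj, hp⟩
    · simp
  · intro e he
    have he := ((hF e).1 he).1
    obtain ⟨h1, h2⟩ := hlt e he
    have hadj : I.graph.Adj e.inf e.sup := by rwa [← SimpleGraph.mem_edgeSet, h2]
    have h3 : ((e.inf : Fin I.n) : ℕ) < e.sup := h1
    simp only [demand, Fin.val_cast, h3, if_true]
    rw [wt_of_adj hadj, h2, WeightedGraph.weight]

/-- Anchored at its first component, a pair that represents an edge is anchored at the smaller end.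
So the edges induced by a coalition are anchored in it. Without slots there are no pairs, and the
two values agree. -/
theorem coreReduction_padded :
    CoreReduction I.player I.value I.padded.value I.demand Prod.fst := by
  classical
  suffices hs : _ ∧ _ from ⟨hs.1, hs.2⟩
  by_cases h : 2 ≤ I.bStar
  · have hq : I.slots = I.n := if_pos h
    have key : ∀ (T : Finset (Fin I.padded.k)) (S : Finset (Fin I.n))
        (F : Finset (Fin I.n × Fin I.slots)), (∀ i, i ∈ S ↔ I.player (.inl i) ∈ T) →
        (∀ q, q ∈ F ↔ I.player (.inr q) ∈ T) → ∃ T' F', I.padded.value T =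
          partitionedValue (splitGraph I.graph I.cap) (splitWeight I.graph I.cap I.weight)
            (splitOwner I.graph I.cap) T' ∧ ∑ p ∈ F, I.demand p = ∑ e ∈ F', I.weight e ∧
          (∀ i, i ∈ S ↔ .inl i ∈ T') ∧ (∀ e : I.graph.edgeSet, (e : Sym2 _) ∈ F' ↔ .inr e ∈ T') ∧
          (∀ e ∈ F', e ∈ I.graph.edgeSet) ∧
          ∀ e ∈ I.graph.edgeSet, (e.inf, Fin.cast hq.symm e.sup) ∈ F → e ∈ F' := by
      intro T S F hS hF
      let T' : Finset (Fin I.n ⊕ I.graph.edgeSet) := Finset.univ.filter fun p =>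
        Sum.elim (fun i => i ∈ S) (fun e => (e.1.inf, Fin.cast hq.symm e.1.sup) ∈ F) p
      let F' := I.graph.edgeFinset.filter fun e => (e.inf, Fin.cast hq.symm e.sup) ∈ F
      refine ⟨T', F', padded_value_eq_split h hq T T' ?_ ?_, sum_demand hq F F' ?_, ?_, ?_, ?_, ?_⟩
      · simp [T', hS]
      · simp [T', hF]
      · simp [F']
      · simp [T']
      · simp [T', F']
      · simp +contextual [F']
      · simp +contextual [F']
    refine ⟨fun T S F hS hF => ?_, fun T S F hS hF hT => ?_⟩ <;>
      obtain ⟨T', F', hT', hsum, hS', hF', hFG, hFF⟩ := key T S F hS hF <;> rw [hT', hsum]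
    · exact partitionedValue_split_le I.positiveWeights _ _ _ (fun i => (hS' i).2)
        (fun e => (hF' e).2) hFG
    · refine le_partitionedValue_split _ _ _ (fun i => (hS' i).1) hFG (fun e => (hF' e).1)
        fun e he hS => hFF e he (hT _ (hS _ ?_))
      induction e with
      | _ i j => rcases le_total i j with hij | hij <;> simp [hij]
  · have hq : I.slots = 0 := if_neg h
    have hsum : ∀ F : Finset (Fin I.n × Fin I.slots), ∑ p ∈ F, I.demand p = 0 := fun F =>
      Finset.sum_eq_zero fun p _ => by have := p.2.2; omega
    refine ⟨fun T S F hS _ => ?_, fun T S F hS _ _ => ?_⟩ <;>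
      rw [hsum, add_zero, padded_value_of_bStar_le_one (by omega) T S hS]

end BMatchingGame

/-! ### Lists arranged in rows -/

section Lists

theorem List.ofFn_eq_map_range {α : Type*} {n : ℕ} (f : Fin n → α) (g : ℕ → α)
    (h : ∀ i : Fin n, f i = g i) : List.ofFn f = (List.range n).map g := by
  apply List.ext_getElem <;> simp [h]

theorem List.map_range_mul {α : Type*} (n m : ℕ) (g : ℕ → α) :
    (List.range (n * m)).map g =
      (List.range n).flatMap fun i => (List.range m).map fun j => g (i * m + j) := by
  induction n with
  | zero => simp
  | succ n ih => simp [Nat.succ_mul, List.range_add, List.range_succ, ih, Function.comp_def]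

/-- Unfolds a single index into a row and a position, the form in which nested loops produce the
list. -/
theorem List.ofFn_rows {α : Type*} {n m : ℕ} (f : Fin (n * m) → α) (g : ℕ → ℕ → α)
    (h : ∀ (i : Fin n) (j : Fin m), f ⟨i * m + j, row_mul_add_lt i.2 j.2⟩ = g i j) :
    List.ofFn f = (List.range n).flatMap fun i => (List.range m).map (g i) := by
  rw [List.ofFn_eq_map_range f (fun u => g (u / m) (u % m)), List.map_range_mul]
  · refine List.flatMap_congr fun i _ => List.map_congr_left fun j hj => ?_
    rw [row_div (List.mem_range.1 hj), row_mod (List.mem_range.1 hj)]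
  · intro u
    rw [← h ⟨_, row_div_lt u.2⟩ ⟨_, row_mod_lt u.2⟩]
    exact congrArg f (Fin.ext row_eq.symm)

theorem List.getD_ofFn {α : Type*} {n : ℕ} (f : Fin n → α) (d : α) (i : Fin n) :
    (List.ofFn f).getD i d = f i := by
  simp [List.getD]

theorem List.getD_map_range {α : Type*} {n i : ℕ} (g : ℕ → α) (d : α) (hi : i < n) :
    ((List.range n).map g).getD i d = g i := by
  simp [List.getD, hi]

theorem List.getD_append_add {α : Type*} (l l' : List α) (d : α) {m : ℕ} (hm : l.length = m)
    (k : ℕ) : (l ++ l').getD (m + k) d = l'.getD k d := by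
  subst hm
  simp [List.getD, List.getElem?_append_right]

end Lists

/-! ### Maps of vectors and coalitions, and descriptions in loop form -/

namespace BMatchingGame

variable (I : BMatchingGame)

/-- The vector `x̄` for the padded game. -/
noncomputable def extend (x : RatVec I.n) : RatVec I.padded.k where
  num p := Sum.elim (fun i => x.num i * (I.den : ℤ))
    (fun s => if (s.1 : ℕ) < s.2 then (I.wt s.1 s.2 : ℤ) * x.den else 0) (I.player.symm p)
  den := x.den * I.den
  den_pos := Nat.mul_pos x.den_pos I.den_pos

/-- The players of the original game in a coalition of the padded game. -/
noncomputable def restrict (S : Finset (Fin I.padded.k)) : Finset (Fin I.n) :=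
  Finset.univ.filter fun i => I.player (.inl i) ∈ S

/-- The allocation of the original game obtained from `y` by giving to the vertex `i` what the
players `(i, j)` have in excess of their demand. -/
noncomputable def pull (y : RatVec I.padded.k) : RatVec I.n where
  num i := y.num (I.player (.inl i)) * (I.den : ℤ) + ∑ j : Fin I.slots,
    (y.num (I.player (.inr (i, j))) * (I.den : ℤ) -
      (if (i : ℕ) < j then (I.wt i j : ℤ) * y.den else 0))
  den := y.den * I.den
  den_pos := Nat.mul_pos y.den_pos I.den_pos

variable {I}

theorem extend_num_inl (x : RatVec I.n) (i : Fin I.n) :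
    (I.extend x).num (I.player (.inl i)) = x.num i * (I.den : ℤ) := by
  simp [extend]

theorem extend_num_inr (x : RatVec I.n) (s : Fin I.n × Fin I.slots) :
    (I.extend x).num (I.player (.inr s)) =
      if (s.1 : ℕ) < s.2 then (I.wt s.1 s.2 : ℤ) * x.den else 0 := by
  simp [extend]

theorem extend_inl (x : RatVec I.n) (i : Fin I.n) :
    (I.extend x).vec (I.player (.inl i)) = x.vec i := by
  have := I.den_pos.ne'
  have := x.den_pos.ne'
  simp only [extend, RatVec.vec, Equiv.symm_apply_apply, Sum.elim_inl]
  push_cast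
  field_simp

theorem extend_inr (x : RatVec I.n) (p : Fin I.n × Fin I.slots) :
    (I.extend x).vec (I.player (.inr p)) = I.demand p := by
  have := I.den_pos.ne'
  have := x.den_pos.ne'
  simp only [extend, RatVec.vec, Equiv.symm_apply_apply, Sum.elim_inr, demand]
  split_ifs
  · push_cast
    field_simp
  · simp

-- The integer formula, over the product of both denominators, represents the vector of
-- `CoreReduction.pull_mem_core`.
open Classical in
theorem vec_pull (y : RatVec I.padded.k) : (I.pull y).vec = fun i => y.vec (I.player (.inl i)) +
    ∑ q : Fin I.n × Fin I.slots with q.1 = i, (y.vec (I.player (.inr q)) - I.demand q) := by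
  funext i
  have h1 : (I.den : ℝ) ≠ 0 := by exact_mod_cast I.den_pos.ne'
  have h2 : (y.den : ℝ) ≠ 0 := by exact_mod_cast y.den_pos.ne'
  have h3 : ∑ q : Fin I.n × Fin I.slots with q.1 = i, (y.vec (I.player (.inr q)) - I.demand q) =
      ∑ j, (y.vec (I.player (.inr (i, j))) - I.demand (i, j)) := by
    rw [Finset.sum_filter, Fintype.sum_prod_type, Finset.sum_eq_single i] <;> simp +contextual
  rw [h3]
  simp only [pull, RatVec.vec, demand]
  push_cast
  rw [add_div, Finset.sum_div, mul_div_mul_right _ _ h1]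
  congr 1
  refine Finset.sum_congr rfl fun j _ => ?_
  split_ifs
  · field_simp
  · simp only [sub_zero, zero_div]
    field_simp

theorem wt_code : (List.ofFn fun i => List.ofFn fun j =>
      open Classical in if I.graph.Adj i j then (I.num s(i, j) : ℤ) else 0).flatten =
    (List.range (I.n * I.n)).map fun u => (I.wt (u / I.n) (u % I.n) : ℤ) := by
  classical
  rw [List.map_range_mul, List.flatMap_def]
  congr 1
  refine List.ofFn_eq_map_range _ _ fun i => List.ofFn_eq_map_range _ _ fun j => ?_
  rw [row_div j.2, row_mod j.2]
  split_ifs with h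
  · rw [wt_of_adj h]
  · have : ¬ 0 < I.wt i j := fun h' => h (wt_pos_iff.1 h')
    omega

variable (I) in
theorem code_eq : I.code = ([(I.n : ℤ), (I.den : ℤ)] ++
    (List.range (I.n * I.n)).map fun u => (I.wt (u / I.n) (u % I.n) : ℤ)) ++
    (List.range I.n).map fun i => (I.capacity i : ℤ) := by
  rw [code, WeightedGraph.code, wt_code]
  congr 1
  exact List.ofFn_eq_map_range _ _ fun i => by rw [capacity_coe]

theorem code_length : I.code.length = 2 + I.n * I.n + I.n := by
  simp [code_eq]
  ring

variable (X : List ℤ)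

theorem getD_code_zero : (I.code ++ X).getD 0 0 = I.n := by
  simp [code_eq]

theorem getD_code_one : (I.code ++ X).getD 1 0 = I.den := by
  simp [code_eq]

theorem getD_code_wt {i j : ℕ} (hi : i < I.n) (hj : j < I.n) :
    (I.code ++ X).getD (2 + (i * I.n + j)) 0 = I.wt i j := by
  rw [code_eq, List.append_assoc, List.append_assoc, List.getD_append_add _ _ _ (by simp),
    List.getD_append _ _ _ _ (by simpa using row_mul_add_lt hi hj),
    List.getD_map_range _ _ (row_mul_add_lt hi hj), row_div hj, row_mod hj]

theorem getD_code_capacity {i : ℕ} (hi : i < I.n) :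
    (I.code ++ X).getD (2 + I.n * I.n + i) 0 = I.capacity i := by
  rw [code_eq, List.append_assoc, List.getD_append_add _ _ _ (by simp; ring),
    List.getD_append _ _ _ _ (by simpa using hi), List.getD_map_range _ _ hi]

theorem getD_code_rest (k : ℕ) :
    (I.code ++ X).getD (2 + I.n * I.n + I.n + k) 0 = X.getD k 0 :=
  List.getD_append_add _ _ _ code_length k

-- The nesting of `flatMap` and `map` is that of the loops of `gameProg`; the descriptions below
-- likewise follow their programs.
variable (I) in
theorem padded_code : I.padded.code = [((I.n * I.rowLength : ℕ) : ℤ), (I.den : ℤ)] ++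
    ((List.range I.n).flatMap fun i => (List.range I.rowLength).flatMap fun r =>
      (List.range I.n).flatMap fun i' => (List.range I.rowLength).map fun r' =>
        (I.entry i r i' r' : ℤ)) ++ [((I.n * (1 + I.slots) : ℕ) : ℤ)] ++
    (List.range I.n).flatMap fun i => (List.range I.rowLength).map fun r =>
      (padOwner I.bStar I.slots i r : ℤ) := by
  have h1 : List.ofFn (fun u => ((I.padded.owner u : ℕ) : ℤ)) =
      (List.range I.n).flatMap fun i => (List.range I.rowLength).map fun r =>
        (padOwner I.bStar I.slots i r : ℤ) :=
    List.ofFn_rows (n := I.n) (m := I.rowLength) _ _ fun i r => by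
      exact congrArg _ (owner_vertex i.2 r.2)
  have h2 : (List.ofFn fun u => List.ofFn fun u' =>
      open Classical in if I.padded.graph.Adj u u' then (I.padded.num s(u, u') : ℤ) else 0) =
      (List.range I.n).flatMap fun i => (List.range I.rowLength).map fun r =>
      (List.range I.n).flatMap fun i' => (List.range I.rowLength).map fun r' =>
        (I.entry i r i' r' : ℤ) := by
    classical
    have h3 : ∀ u u', (if I.padded.graph.Adj u u' then (I.padded.num s(u, u') : ℤ) else 0) =
        (I.vertexEntry u u' : ℕ) := by
      intro u u'
      split_ifs with h
      · rfl
      · have : ¬ 0 < I.vertexEntry u u' := h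
        omega
    simp only [h3]
    refine List.ofFn_rows (n := I.n) (m := I.rowLength) _ _ fun i r =>
      List.ofFn_rows (n := I.n) (m := I.rowLength) _ _ fun i' r' => ?_
    exact congrArg _ (I.vertexEntry_row r.2 r'.2)
  rw [PartitionedGame.code, WeightedGraph.code, h1, h2]
  simp [padded, List.flatMap_def, List.flatten_flatten, Function.comp_def]

theorem extend_code (x : RatVec I.n) : (I.extend x).code = [x.code.getD 0 0 * (I.den : ℤ)] ++
    (List.range I.n).flatMap fun i => [x.code.getD (1 + i) 0 * (I.den : ℤ)] ++
      (List.range I.slots).map fun j => if i < j then (I.wt i j : ℤ) * x.code.getD 0 0 else 0 := by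
  have hx : ∀ i : Fin I.n, x.code.getD (1 + i) 0 = x.num i := fun i => by
    rw [RatVec.code, Nat.add_comm, List.getD_cons_succ, List.getD_ofFn]
  have h0 : x.code.getD 0 0 = x.den := rfl
  -- Place zero in a row of players is the vertex, which shifts its pairs by one.
  have key : List.ofFn (I.extend x).num = (List.range I.n).flatMap fun i =>
      (List.range (1 + I.slots)).map fun s => if s = 0 then x.code.getD (1 + i) 0 * (I.den : ℤ)
        else if i < s - 1 then (I.wt i (s - 1) : ℤ) * x.code.getD 0 0 else 0 := by
    refine List.ofFn_rows (n := I.n) (m := 1 + I.slots) _ _ ?_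
    rintro i ⟨s, hs⟩
    rcases s with _ | s
    · exact (extend_num_inl x i).trans (by rw [if_pos rfl, hx])
    · have : (⟨i * (1 + I.slots) + (s + 1), row_mul_add_lt i.2 hs⟩ : Fin (I.n * (1 + I.slots))) =
        I.player (.inr (i, ⟨s, by omega⟩)) := Fin.ext (by rw [player_inr]; simp; ring)
      rw [this, extend_num_inr, h0]
      simp
  rw [RatVec.code, key]
  have h1 : ((I.extend x).den : ℤ) = x.code.getD 0 0 * (I.den : ℤ) := by
    rw [h0]
    simp [extend]
  rw [h1]
  simp [List.range_add, Function.comp_def]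

theorem restrict_code (S : Finset (Fin I.padded.k)) : coalitionCode (I.restrict S) =
    (List.range I.n).map fun i => (coalitionCode S).getD (i * (1 + I.slots)) 0 := by
  refine List.ofFn_eq_map_range _ _ fun i => ?_
  have := List.getD_ofFn (fun p => if p ∈ S then (1 : ℤ) else 0) 0 (I.player (.inl i))
  rw [player_inl] at this
  rw [coalitionCode, this]
  simp [restrict]

theorem pull_code (y : RatVec I.padded.k) : (I.pull y).code = [y.code.getD 0 0 * (I.den : ℤ)] ++
    (List.range I.n).map fun i => y.code.getD (1 + i * (1 + I.slots)) 0 * (I.den : ℤ) +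
      ∑ j ∈ Finset.range I.slots, (y.code.getD (1 + i * (1 + I.slots) + (1 + j)) 0 * (I.den : ℤ) -
        if i < j then (I.wt i j : ℤ) * y.code.getD 0 0 else 0) := by
  have hy : ∀ p : Fin I.padded.k, y.code.getD (1 + p) 0 = y.num p := fun p => by
    rw [RatVec.code, Nat.add_comm, List.getD_cons_succ, List.getD_ofFn]
  have h0 : y.code.getD 0 0 = y.den := rfl
  have h1 : ((I.pull y).den : ℤ) = y.code.getD 0 0 * (I.den : ℤ) := by
    rw [h0]
    simp [pull]
  rw [RatVec.code, h1, List.singleton_append]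
  refine congrArg _ (List.ofFn_eq_map_range _ _ fun i => ?_)
  simp only [pull]
  rw [← hy, player_inl, Finset.sum_range]
  congr 1
  refine Finset.sum_congr rfl fun j _ => ?_
  rw [← hy, player_inr, ← Nat.add_assoc, h0]

end BMatchingGame

namespace RAM

/-! ### Cost bounds -/

/-- A bound on the bit length of the value of an expression, if all cells are less than `2 ^ N`. -/
def Expr.bitBound (N : ℕ) : Expr → ℕ
  | .const z => bits z
  | .read _ _ => N + 1
  | .add e₁ e₂ => e₁.bitBound N + e₂.bitBound N
  | .sub e₁ e₂ => e₁.bitBound N + e₂.bitBound N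
  | .mul e₁ e₂ => e₁.bitBound N + e₂.bitBound N

/-- A bound on the cost of evaluating an expression. -/
def Expr.costBound (N : ℕ) : Expr → ℕ
  | .const z => bits z
  | .read _ e => e.costBound N + (N + 1)
  | .add e₁ e₂ => e₁.costBound N + e₂.costBound N + (e₁.bitBound N + e₂.bitBound N)
  | .sub e₁ e₂ => e₁.costBound N + e₂.costBound N + (e₁.bitBound N + e₂.bitBound N)
  | .mul e₁ e₂ => e₁.costBound N + e₂.costBound N + (e₁.bitBound N + e₂.bitBound N)

/-- A bound on the cost of a program whose loops are executed at most `N` times. -/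
def Prog.costBound (N : ℕ) : Prog → ℕ
  | .skip => 1
  | .write _ i e => i.costBound N + e.costBound N
  | .seq c₁ c₂ => c₁.costBound N + c₂.costBound N
  | .ite e c₁ c₂ => e.costBound N + (c₁.costBound N + c₂.costBound N)
  | .loop e c => N * (e.costBound N + c.costBound N) + e.costBound N

/-- `f` is given by a polynomial. -/
def IsPolynomial (f : ℕ → ℕ) : Prop := ∃ P : Polynomial ℕ, ∀ N, f N = P.eval N

theorem IsPolynomial.const (k : ℕ) : IsPolynomial fun _ => k := ⟨.C k, by simp⟩

theorem IsPolynomial.id : IsPolynomial fun N => N := ⟨.X, by simp⟩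

theorem IsPolynomial.add {f g : ℕ → ℕ} (hf : IsPolynomial f) (hg : IsPolynomial g) :
    IsPolynomial fun N => f N + g N := by
  obtain ⟨P, hP⟩ := hf
  obtain ⟨Q, hQ⟩ := hg
  exact ⟨P + Q, by simp [hP, hQ]⟩

theorem IsPolynomial.mul {f g : ℕ → ℕ} (hf : IsPolynomial f) (hg : IsPolynomial g) :
    IsPolynomial fun N => f N * g N := by
  obtain ⟨P, hP⟩ := hf
  obtain ⟨Q, hQ⟩ := hg
  exact ⟨P * Q, by simp [hP, hQ]⟩

theorem Expr.isPolynomial_bitBound (e : Expr) : IsPolynomial e.bitBound := by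
  induction e with
  | const z => exact .const _
  | read a e ih => exact .add .id (.const 1)
  | add _ _ h₁ h₂ => exact h₁.add h₂
  | sub _ _ h₁ h₂ => exact h₁.add h₂
  | mul _ _ h₁ h₂ => exact h₁.add h₂

theorem Expr.isPolynomial_costBound (e : Expr) : IsPolynomial e.costBound := by
  induction e with
  | const z => exact .const _
  | read a e ih => exact ih.add (.add .id (.const 1))
  | add e₁ e₂ h₁ h₂ => exact (h₁.add h₂).add (e₁.isPolynomial_bitBound.add e₂.isPolynomial_bitBound)
  | sub e₁ e₂ h₁ h₂ => exact (h₁.add h₂).add (e₁.isPolynomial_bitBound.add e₂.isPolynomial_bitBound)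
  | mul e₁ e₂ h₁ h₂ => exact (h₁.add h₂).add (e₁.isPolynomial_bitBound.add e₂.isPolynomial_bitBound)

/-- Each loop contributes a factor `N`, and the depth of nesting is fixed by the program. -/
theorem Prog.isPolynomial_costBound (c : Prog) : IsPolynomial c.costBound := by
  induction c with
  | skip => exact .const 1
  | write a i e => exact i.isPolynomial_costBound.add e.isPolynomial_costBound
  | seq _ _ h₁ h₂ => exact h₁.add h₂
  | ite e _ _ h₁ h₂ => exact e.isPolynomial_costBound.add (h₁.add h₂)
  | loop e c ih =>
    exact (IsPolynomial.id.mul (e.isPolynomial_costBound.add ih)).add e.isPolynomial_costBound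

/-- All cells are less than `2 ^ N` in absolute value. -/
def Bounded (N : ℕ) (s : Memory) : Prop := ∀ a i, (s a i).natAbs < 2 ^ N

theorem bits_le {N : ℕ} {z : ℤ} (h : z.natAbs < 2 ^ N) : bits z ≤ N + 1 :=
  Nat.succ_le_succ (Nat.size_le.2 h)

theorem natAbs_lt_two_pow_bits (z : ℤ) : z.natAbs < 2 ^ bits z :=
  (Nat.lt_size_self _).trans (Nat.pow_lt_pow_right (by omega) (Nat.lt_succ_self _))

/-- The hypothesis on absolute values covers sums and differences alike. The two sign bits on the
right pay for the carry and for the sign of `z`. -/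
theorem bits_add_aux {x y z : ℤ} (h : z.natAbs ≤ x.natAbs + y.natAbs) :
    bits z ≤ bits x + bits y := by
  have hx := Nat.lt_size_self x.natAbs
  have hy := Nat.lt_size_self y.natAbs
  have : z.natAbs < 2 ^ (x.natAbs.size + y.natAbs.size + 1) := by
    have h1 := Nat.pow_le_pow_right (n := 2) (by omega)
      (Nat.le_add_right x.natAbs.size y.natAbs.size)
    have h2 := Nat.pow_le_pow_right (n := 2) (by omega)
      (Nat.le_add_left y.natAbs.size x.natAbs.size)
    rw [pow_succ]
    omega
  have := Nat.size_le.2 this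
  unfold bits
  omega

theorem bits_mul_le (x y : ℤ) : bits (x * y) ≤ bits x + bits y := by
  have : (x * y).natAbs < 2 ^ (x.natAbs.size + y.natAbs.size) := by
    rw [Int.natAbs_mul, pow_add]
    exact Nat.mul_lt_mul'' (Nat.lt_size_self _) (Nat.lt_size_self _)
  have := Nat.size_le.2 this
  unfold bits
  omega

theorem Expr.bits_eval_le {N : ℕ} {s : Memory} (hs : Bounded N s) (e : Expr) :
    bits (e.eval s) ≤ e.bitBound N := by
  induction e with
  | const z => exact le_rfl
  | read a e ih => exact bits_le (hs _ _)
  | add _ _ h₁ h₂ => exact (bits_add_aux (Int.natAbs_add_le _ _)).trans (Nat.add_le_add h₁ h₂)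
  | sub _ _ h₁ h₂ => exact (bits_add_aux (Int.natAbs_sub_le _ _)).trans (Nat.add_le_add h₁ h₂)
  | mul _ _ h₁ h₂ => exact (bits_mul_le _ _).trans (Nat.add_le_add h₁ h₂)

theorem Expr.cost_le {N : ℕ} {s : Memory} (hs : Bounded N s) (e : Expr) :
    e.cost s ≤ e.costBound N := by
  induction e with
  | const z => exact le_rfl
  | read a e ih => exact Nat.add_le_add ih (bits_le (hs _ _))
  | add e₁ e₂ h₁ h₂ =>
    exact Nat.add_le_add (Nat.add_le_add h₁ h₂) (bits_eval_le hs (.add e₁ e₂))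
  | sub e₁ e₂ h₁ h₂ =>
    exact Nat.add_le_add (Nat.add_le_add h₁ h₂) (bits_eval_le hs (.sub e₁ e₂))
  | mul e₁ e₂ h₁ h₂ =>
    exact Nat.add_le_add (Nat.add_le_add h₁ h₂) (bits_eval_le hs (.mul e₁ e₂))

theorem Bounded.set {N : ℕ} {s : Memory} (hs : Bounded N s) (a : ℕ) (i : ℤ) {z : ℤ}
    (hz : z.natAbs < 2 ^ N) : Bounded N (s.set a i z) := by
  intro a' i'
  by_cases ha : a' = a
  · subst ha
    by_cases hi : i' = i
    · subst hi
      simpa [Memory.set] using hz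
    · simpa [Memory.set, hi] using hs a' i'
  · simpa [Memory.set, ha] using hs a' i'

theorem Memory.set_same (s : Memory) (a : ℕ) (i z : ℤ) : s.set a i z a i = z := by
  simp [Memory.set]

theorem Memory.set_array (s : Memory) {a a' : ℕ} (i z : ℤ) (h : a' ≠ a) :
    s.set a i z a' = s a' := by
  simp [Memory.set, h]

theorem Memory.set_cell (s : Memory) (a : ℕ) {i i' : ℤ} (z : ℤ) (h : i' ≠ i) :
    s.set a i z a i' = s a i' := by
  simp [Memory.set, h]

/-! ### A logic for programs that write their output sequentially

The data are in array `2`, the variables `0, 1, 2, …` in the arrays `3, 4, 5, …`. -/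

/-- The cell `e` of the data. -/
def dat (e : Expr) : Expr := .read 2 e

/-- The variable number `v`. -/
def var (v : ℕ) : Expr := .read (v + 3) (.const 0)

/-- Assignment to a variable. -/
def assign (v : ℕ) (e : Expr) : Prog := .write (v + 3) (.const 0) e

/-- Append the value of `e` to the output. -/
def emit (e : Expr) : Prog :=
  .seq (.write 0 (.read 1 (.const 0)) e)
    (.write 1 (.const 0) (.add (.read 1 (.const 0)) (.const 1)))

/-- Run `c` for the values `0, …, e - 1` of the variable `v`. -/
def forLoop (v : ℕ) (e : Expr) (c : Prog) : Prog :=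
  .seq (assign v (.const 0))
    (.loop (.sub e (var v)) (.seq c (assign v (.add (var v) (.const 1)))))

/-- The memory `s` holds the data `D` and the variables `σ`. -/
structure Holds (D : ℤ → ℤ) (σ : List ℤ) (s : Memory) : Prop where
  data : s 2 = D
  vars : ∀ v < σ.length, s (v + 3) 0 = σ.getD v 0

/-- The program `c` transforms the variables `σ` to `σ'` and appends `g` to the output. -/
def Runs (N : ℕ) (D : ℤ → ℤ) (c : Prog) (σ σ' g : List ℤ) : Prop :=
  ∀ (L : List ℤ) (s : Memory), Bounded N s → Holds D σ s → Outputs s L →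
    L.length + g.length < 2 ^ N → ∃ s' t, Exec c s s' t ∧ t ≤ c.costBound N ∧ Bounded N s' ∧
      Holds D σ' s' ∧ Outputs s' (L ++ g)

/-- The expression `e` has the value `z` whenever the memory holds the data `D` and the
variables `σ`. -/
def Evaluates (D : ℤ → ℤ) (σ : List ℤ) (e : Expr) (z : ℤ) : Prop :=
  ∀ s, Holds D σ s → e.eval s = z

section Evaluation

variable {D : ℤ → ℤ} {σ : List ℤ} {e e₁ e₂ : Expr} {z z₁ z₂ : ℤ}

theorem Evaluates.const (z : ℤ) : Evaluates D σ (.const z) z := fun _ _ => rfl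

theorem Evaluates.var {v : ℕ} (hv : v < σ.length) : Evaluates D σ (var v) (σ.getD v 0) :=
  fun _ hs => hs.vars v hv

theorem Evaluates.dat (h : Evaluates D σ e z) : Evaluates D σ (dat e) (D z) := by
  intro s hs
  simp only [RAM.dat, Expr.eval, h s hs, hs.data]

theorem Evaluates.add (h₁ : Evaluates D σ e₁ z₁) (h₂ : Evaluates D σ e₂ z₂) :
    Evaluates D σ (.add e₁ e₂) (z₁ + z₂) := fun s hs => by
  rw [Expr.eval, h₁ s hs, h₂ s hs]

theorem Evaluates.sub (h₁ : Evaluates D σ e₁ z₁) (h₂ : Evaluates D σ e₂ z₂) :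
    Evaluates D σ (.sub e₁ e₂) (z₁ - z₂) := fun s hs => by
  rw [Expr.eval, h₁ s hs, h₂ s hs]

theorem Evaluates.mul (h₁ : Evaluates D σ e₁ z₁) (h₂ : Evaluates D σ e₂ z₂) :
    Evaluates D σ (.mul e₁ e₂) (z₁ * z₂) := fun s hs => by
  rw [Expr.eval, h₁ s hs, h₂ s hs]

theorem Holds.of_append {τ : List ℤ} {s : Memory} (h : Holds D (σ ++ τ) s) : Holds D σ s where
  data := h.data
  vars v hv := by
    rw [h.vars v (by simp; omega), List.getD_append _ _ _ _ hv]

theorem Evaluates.append (h : Evaluates D σ e z) (τ : List ℤ) : Evaluates D (σ ++ τ) e z :=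
  fun s hs => h s hs.of_append

end Evaluation

section Rules

variable {N : ℕ} {D : ℤ → ℤ} {σ σ' σ'' g g' : List ℤ} {c c' : Prog} {e : Expr} {z : ℤ}

theorem Runs.skip : Runs N D .skip σ σ [] := fun L s hb hs ho _ =>
  ⟨s, 1, .skip s, le_rfl, hb, hs, by simpa using ho⟩

theorem Runs.seq (h : Runs N D c σ σ' g) (h' : Runs N D c' σ' σ'' g') :
    Runs N D (.seq c c') σ σ'' (g ++ g') := by
  intro L s hb hs ho hL
  rw [List.length_append] at hL
  obtain ⟨s₁, t₁, hx₁, ht₁, hb₁, hs₁, ho₁⟩ := h L s hb hs ho (by omega)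
  obtain ⟨s₂, t₂, hx₂, ht₂, hb₂, hs₂, ho₂⟩ := h' _ s₁ hb₁ hs₁ ho₁
    (by rw [List.length_append]; omega)
  exact ⟨s₂, _, .seq hx₁ hx₂, Nat.add_le_add ht₁ ht₂, hb₂, hs₂, by rwa [← List.append_assoc]⟩

theorem Runs.ite (he : Evaluates D σ e z) (h : 0 < z → Runs N D c σ σ' g)
    (h' : ¬ 0 < z → Runs N D c' σ σ' g) : Runs N D (.ite e c c') σ σ' g := by
  intro L s hb hs ho hL
  have hez := he s hs
  have hcost := e.cost_le hb
  by_cases hz : 0 < z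
  · obtain ⟨s₁, t₁, hx₁, ht₁, h₁⟩ := h hz L s hb hs ho hL
    exact ⟨s₁, _, .ite_pos (by rwa [hez]) hx₁, by rw [Prog.costBound]; omega, h₁⟩
  · obtain ⟨s₁, t₁, hx₁, ht₁, h₁⟩ := h' hz L s hb hs ho hL
    exact ⟨s₁, _, .ite_neg (by rwa [hez]) hx₁, by rw [Prog.costBound]; omega, h₁⟩

theorem Runs.weaken {τ : List ℤ} (h : Runs N D c σ (σ' ++ τ) g) : Runs N D c σ σ' g := by
  intro L s hb hs ho hL
  obtain ⟨s₁, t₁, hx₁, ht₁, hb₁, hs₁, ho₁⟩ := h L s hb hs ho hL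
  exact ⟨s₁, t₁, hx₁, ht₁, hb₁, hs₁.of_append, ho₁⟩

theorem Holds.set {s : Memory} (hs : Holds D σ s) {v : ℕ}
    (h : ∀ v' < σ'.length, σ'.getD v' 0 = if v' = v then z else σ.getD v' 0)
    (hlen : ∀ v' < σ'.length, v' ≠ v → v' < σ.length) :
    Holds D σ' (s.set (v + 3) 0 z) where
  data := by rw [Memory.set_array _ _ _ (by omega), hs.data]
  vars v' hv' := by
    rw [h v' hv']
    split_ifs with hvv
    · rw [hvv, Memory.set_same]
    · rw [Memory.set_array _ _ _ (by omega), hs.vars v' (hlen v' hv' hvv)]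

theorem Outputs.set {s : Memory} {L : List ℤ} (hs : Outputs s L) {a : ℕ} (ha : 2 ≤ a) (i z : ℤ) :
    Outputs (s.set a i z) L := by
  rw [Outputs, Memory.set_array _ _ _ (by omega), Memory.set_array _ _ _ (by omega)]
  exact hs

/-- Common to overwriting a variable and to declaring a new one; in the latter case `v` is not an
index of `σ`. -/
theorem Runs.assign_aux {v : ℕ} (he : Evaluates D σ e z) (hz : z.natAbs < 2 ^ N)
    (h : ∀ v' < σ'.length, σ'.getD v' 0 = if v' = v then z else σ.getD v' 0)
    (hlen : ∀ v' < σ'.length, v' ≠ v → v' < σ.length) :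
    Runs N D (assign v e) σ σ' [] := by
  intro L s hb hs ho _
  refine ⟨s.set (v + 3) 0 z, _, ?_, Nat.add_le_add (Expr.cost_le hb _) (e.cost_le hb),
    hb.set _ _ hz, hs.set h hlen, by simpa using ho.set (by omega) _ _⟩
  have := Exec.write s (v + 3) (.const 0) e
  rwa [he s hs] at this

/-- Introduction of a new variable. -/
theorem Runs.declare {v : ℕ} (hv : σ.length = v) (he : Evaluates D σ e z)
    (hz : z.natAbs < 2 ^ N) : Runs N D (assign v e) σ (σ ++ [z]) [] := by
  subst hv
  refine .assign_aux he hz (fun v' hv' => ?_) fun v' hv' hne => ?_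
  · simp only [List.length_append, List.length_singleton] at hv'
    split_ifs with h
    · simp [h]
    · rw [List.getD_append _ _ _ _ (by omega)]
  · simp only [List.length_append, List.length_singleton] at hv'
    omega

theorem Runs.assign {v : ℕ} (he : Evaluates D σ e z) (hz : z.natAbs < 2 ^ N) :
    Runs N D (assign v e) σ (σ.set v z) [] := by
  refine .assign_aux he hz (fun v' hv' => ?_) fun v' hv' _ => by simpa using hv'
  rw [List.length_set] at hv'
  split_ifs with h
  · subst h
    simp [hv']
  · rw [List.getD_eq_getElem?_getD, List.getD_eq_getElem?_getD, List.getElem?_set_ne (Ne.symm h)]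

/-- The length condition in `Runs` keeps the output counter, itself a cell, below `2 ^ N`. -/
theorem Runs.emit (he : Evaluates D σ e z) (hz : z.natAbs < 2 ^ N) :
    Runs N D (emit e) σ σ [z] := by
  intro L s hb hs ho hL
  simp only [List.length_singleton] at hL
  have hb₁ : Bounded N (s.set 0 (s 1 0) z) := hb.set _ _ hz
  have hlen : (s.set 0 (s 1 0) z) 1 0 = L.length := by
    rw [Memory.set_array _ _ _ (by omega), ho.1]
  have hx₁ := Exec.write s 0 (.read 1 (.const 0)) e
  rw [he s hs] at hx₁
  have hx₂ := Exec.write (s.set 0 (s 1 0) z) 1 (.const 0) (.add (.read 1 (.const 0)) (.const 1))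
  refine ⟨_, _, .seq hx₁ hx₂, Nat.add_le_add
    (Nat.add_le_add (Expr.cost_le hb _) (Expr.cost_le hb _))
    (Nat.add_le_add (Expr.cost_le hb₁ _) (Expr.cost_le hb₁ _)), ?_, ⟨?_, ?_⟩, ?_, ?_⟩
  · refine hb₁.set _ _ ?_
    simp only [Expr.eval, hlen]
    omega
  · rw [Memory.set_array _ _ _ (by omega), Memory.set_array _ _ _ (by omega), hs.data]
  · intro v hv
    rw [Memory.set_array _ _ _ (by omega), Memory.set_array _ _ _ (by omega), hs.vars v hv]
  · simp only [Expr.eval, Memory.set_same, hlen]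
    simp
  · intro k hk
    rw [Memory.set_array _ _ _ (by omega)]
    simp only [ho.1]
    simp only [List.length_append, List.length_singleton] at hk
    by_cases hkL : k = L.length
    · subst hkL
      rw [Memory.set_same]
      simp
    · rw [Memory.set_cell _ _ _ (by exact_mod_cast hkL), ho.2 k (by omega),
        List.getD_append _ _ _ _ (by omega)]

theorem length_flatMap_range_le (g : ℕ → List ℤ) {k M : ℕ} (h : k ≤ M) :
    ((List.range k).flatMap g).length ≤ ((List.range M).flatMap g).length := by
  obtain ⟨d, rfl⟩ := Nat.exists_eq_add_of_le h
  simp [List.range_add]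

/-- The invariant `τ k` lists the variables before round `k`. Its constant length `v` makes the
counter the last variable, which goes out of scope at the end. -/
theorem Runs.forLoop {v M : ℕ} {τ : ℕ → List ℤ} {g : ℕ → List ℤ} (hM : M ≤ N)
    (hv : ∀ k, (τ k).length = v) (he : ∀ k, Evaluates D (τ k) e M)
    (h : ∀ k < M, Runs N D c (τ k ++ [(k : ℤ)]) (τ (k + 1) ++ [(k : ℤ)]) (g k)) :
    Runs N D (forLoop v e c) (τ 0) (τ M) ((List.range M).flatMap g) := by
  have hM2 : M < 2 ^ N := hM.trans_lt Nat.lt_two_pow_self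
  intro L s hb hs ho hL
  let body := Prog.seq c (RAM.assign v (.add (var v) (.const 1)))
  let test := Expr.sub e (var v)
  have hvar : ∀ k, Evaluates D (τ k ++ [(k : ℤ)]) (var v) k := fun k => by
    have := Evaluates.var (D := D) (σ := τ k ++ [(k : ℤ)]) (v := v) (by simp [hv])
    rwa [← hv k, List.getD_append_right _ _ _ _ le_rfl, Nat.sub_self, List.getD_cons_zero,
      hv k] at this
  have hbody : ∀ k < M, Runs N D body (τ k ++ [(k : ℤ)]) (τ (k + 1) ++ [((k + 1 : ℕ) : ℤ)])
      (g k) := by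
    intro k hk
    have hvar' : Evaluates D (τ (k + 1) ++ [(k : ℤ)]) (var v) k := by
      have := Evaluates.var (D := D) (σ := τ (k + 1) ++ [(k : ℤ)]) (v := v) (by simp [hv])
      rwa [← hv (k + 1), List.getD_append_right _ _ _ _ le_rfl, Nat.sub_self, List.getD_cons_zero,
        hv (k + 1)] at this
    have h1 := Runs.assign (N := N) (v := v) (hvar'.add (.const 1)) (by omega)
    have h2 : (τ (k + 1) ++ [(k : ℤ)]).set v ((k : ℤ) + 1) =
        τ (k + 1) ++ [((k + 1 : ℕ) : ℤ)] := by
      rw [← hv (k + 1), List.set_append_right _ _ le_rfl]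
      simp
    rw [h2] at h1
    simpa using (h k hk).seq h1
  have htest : ∀ k, Evaluates D (τ k ++ [(k : ℤ)]) test (M - k) :=
    fun k => ((he k).append _).sub (hvar k)
  -- Induction on the number `m` of remaining rounds.
  have hloop : ∀ m k s', k + m = M → Bounded N s' → Holds D (τ k ++ [(k : ℤ)]) s' →
      Outputs s' (L ++ (List.range k).flatMap g) →
      ∃ s'' t, Exec (.loop test body) s' s'' t ∧
        t ≤ m * (test.costBound N + body.costBound N) + test.costBound N ∧ Bounded N s'' ∧
        Holds D (τ M ++ [(M : ℤ)]) s'' ∧ Outputs s'' (L ++ (List.range M).flatMap g) := by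
    intro m
    induction m with
    | zero =>
      intro k s' hk hb' hs' ho'
      obtain rfl : k = M := by omega
      have hneg : ¬ 0 < test.eval s' := by
        rw [htest _ s' hs']
        omega
      exact ⟨s', _, .loop_neg hneg, by simpa using test.cost_le hb', hb', hs', ho'⟩
    | succ m ih =>
      intro k s' hk hb' hs' ho'
      have hpos : 0 < test.eval s' := by
        rw [htest _ s' hs']
        omega
      -- The output after this round is no longer than the final one, so it obeys the length bound.
      have hlen := length_flatMap_range_le g (show k + 1 ≤ M by omega)
      rw [List.range_succ, List.flatMap_append, List.length_append] at hlen
      simp only [List.flatMap_singleton] at hlen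
      obtain ⟨s₁, t₁, hx₁, ht₁, hb₁, hs₁, ho₁⟩ := hbody k (by omega) _ s' hb' hs' ho'
        (by rw [List.length_append]; omega)
      obtain ⟨s₂, t₂, hx₂, ht₂, h₂⟩ := ih (k + 1) s₁ (by omega) hb₁ hs₁
        (by rw [List.range_succ, List.flatMap_append, ← List.append_assoc]
            simpa only [List.flatMap_singleton] using ho₁)
      refine ⟨s₂, _, .loop_pos hpos hx₁ hx₂, ?_, h₂⟩
      have := test.cost_le hb'
      rw [Nat.succ_mul]
      omega
  obtain ⟨s₀, t₀, hx₀, ht₀, hb₀, hs₀, ho₀⟩ := Runs.declare (N := N) (hv 0)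
    (Evaluates.const (D := D) 0) (by simp) L s hb hs ho (by simp; omega)
  obtain ⟨s₁, t₁, hx₁, ht₁, hb₁, hs₁, ho₁⟩ := hloop M 0 s₀ (by omega) hb₀
    (by simpa using hs₀) (by simpa using ho₀)
  refine ⟨s₁, _, .seq hx₀ hx₁, Nat.add_le_add ht₀ (ht₁.trans ?_), hb₁, hs₁.of_append, ho₁⟩
  exact Nat.add_le_add_right (Nat.mul_le_mul_right _ hM) _

/-- A loop that does not change the variables. -/
theorem Runs.for_emit {v M : ℕ} {g : ℕ → List ℤ} (hM : M ≤ N) (hv : σ.length = v)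
    (he : Evaluates D σ e M)
    (h : ∀ k < M, Runs N D c (σ ++ [(k : ℤ)]) (σ ++ [(k : ℤ)]) (g k)) :
    Runs N D (RAM.forLoop v e c) σ σ ((List.range M).flatMap g) :=
  Runs.forLoop (τ := fun _ => σ) hM (fun _ => hv) (fun _ => he) h

end Rules

/-! ### Saving the input, and the passage to polynomial time -/

/-- Copy the input to array `2`, and empty the output. -/
def copyInput : Prog :=
  .seq
    (.seq (assign 0 (.const 0))
      (.loop (.sub (.read 1 (.const 0)) (var 0))
        (.seq (.write 2 (var 0) (.read 0 (var 0))) (assign 0 (.add (var 0) (.const 1))))))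
    (.write 1 (.const 0) (.const 0))

/-- The state of `copyInput` after `k` entries of `L` have been copied. -/
structure Copied (L : List ℤ) (k : ℕ) (s : Memory) : Prop where
  source : s 0 = input L 0
  length : s 1 0 = L.length
  copy : s 2 = fun i => if i < (k : ℤ) then input L 0 i else 0
  counter : s 3 0 = k

theorem length_le_bitLength (L : List ℤ) : L.length ≤ bitLength L := by
  induction L with
  | nil => simp
  | cons z L ih =>
    simp only [bitLength, List.map_cons, List.sum_cons, List.length_cons] at ih ⊢
    have : 1 ≤ bits z := Nat.le_add_left _ _
    omega

theorem bits_le_bitLength {L : List ℤ} {z : ℤ} (hz : z ∈ L) : bits z ≤ bitLength L :=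
  List.single_le_sum (by simp) _ (List.mem_map_of_mem hz)

theorem natAbs_getD_lt (L : List ℤ) (k : ℕ) : (L.getD k 0).natAbs < 2 ^ bitLength L := by
  by_cases hk : k < L.length
  · rw [List.getD_eq_getElem _ _ hk]
    exact (natAbs_lt_two_pow_bits _).trans_le
      (Nat.pow_le_pow_right (by omega) (bits_le_bitLength (List.getElem_mem hk)))
  · rw [List.getD_eq_default _ _ (by omega)]
    simp

theorem input_coe (L : List ℤ) (k : ℕ) : input L 0 k = L.getD k 0 := by
  simp [input]

theorem natAbs_input_lt (L : List ℤ) (i : ℤ) : (input L 0 i).natAbs < 2 ^ bitLength L := by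
  rcases lt_or_ge i 0 with hi | hi
  · simp [input, not_le.2 hi]
  · obtain ⟨k, rfl⟩ := Int.eq_ofNat_of_zero_le hi
    rw [input_coe]
    exact natAbs_getD_lt L k

theorem bounded_input {L : List ℤ} {N : ℕ} (hN : bitLength L ≤ N) : Bounded N (input L) := by
  intro a i
  have h2 : 2 ^ bitLength L ≤ 2 ^ N := Nat.pow_le_pow_right (by omega) hN
  by_cases ha : a = 0
  · subst ha
    exact (natAbs_input_lt L i).trans_le h2
  · simp only [input, ha, if_false]
    split_ifs
    · simpa using ((length_le_bitLength L).trans hN).trans_lt Nat.lt_two_pow_self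
    · simp

/-- Input and output share the arrays 0 and 1, so the input has to be saved before anything is
emitted. -/
theorem exec_copyInput {L : List ℤ} {N : ℕ} (hN : bitLength L ≤ N) :
    ∃ s t, Exec copyInput (input L) s t ∧ t ≤ copyInput.costBound N ∧ Bounded N s ∧
      Holds (input L 0) [] s ∧ Outputs s [] := by
  have hLN : L.length ≤ N := (length_le_bitLength L).trans hN
  have hlt : L.length < 2 ^ N := hLN.trans_lt Nat.lt_two_pow_self
  have hb := bounded_input hN
  let test : Expr := .sub (.read 1 (.const 0)) (var 0)
  let body : Prog := .seq (.write 2 (var 0) (.read 0 (var 0))) (assign 0 (.add (var 0) (.const 1)))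
  have hvar : ∀ {k s}, Copied L k s → (var 0).eval s = k := fun h => h.counter
  have htest : ∀ {k s}, Copied L k s → test.eval s = L.length - k := fun h => by
    show (Expr.read 1 (.const 0)).eval _ - (var 0).eval _ = _
    rw [hvar h]
    simp [Expr.eval, h.length]
  have hbody : ∀ k s, k < L.length → Bounded N s → Copied L k s → ∃ s' t, Exec body s s' t ∧
      t ≤ body.costBound N ∧ Bounded N s' ∧ Copied L (k + 1) s' := by
    intro k s hk hb h
    have hx₁ := Exec.write s 2 (var 0) (.read 0 (var 0))
    have hv : (Expr.read 0 (var 0)).eval s = input L 0 k := by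
      rw [Expr.eval, hvar h, h.source]
    rw [hvar h, hv] at hx₁
    have hb₁ : Bounded N (s.set 2 k (input L 0 k)) := hb.set _ _ (by
      have := hb 0 k
      rwa [h.source] at this)
    have hx₂ := Exec.write (s.set 2 k (input L 0 k)) 3 (.const 0) (.add (var 0) (.const 1))
    have hc : (s.set 2 k (input L 0 k)) 3 0 = k := by
      rw [Memory.set_array _ _ _ (by omega), h.counter]
    have hv₂ : (Expr.add (var 0) (.const 1)).eval (s.set 2 k (input L 0 k)) = k + 1 := by
      show (s.set 2 k (input L 0 k)) 3 0 + 1 = _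
      rw [hc]
    rw [hv₂] at hx₂
    refine ⟨_, _, .seq hx₁ hx₂, Nat.add_le_add (Nat.add_le_add (Expr.cost_le hb _)
      (Expr.cost_le hb _)) (Nat.add_le_add (Expr.cost_le hb₁ _) (Expr.cost_le hb₁ _)),
      hb₁.set _ _ (by omega), ?_, ?_, ?_, ?_⟩
    · rw [Memory.set_array _ _ _ (by omega), Memory.set_array _ _ _ (by omega), h.source]
    · rw [Memory.set_array _ _ _ (by omega), Memory.set_array _ _ _ (by omega), h.length]
    · rw [Memory.set_array _ _ _ (by omega)]
      funext i
      by_cases hi : i = k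
      · subst hi
        rw [Memory.set_same, if_pos (by omega)]
      · rw [Memory.set_cell _ _ _ hi, h.copy]
        exact if_congr (by omega) rfl rfl
    · simp only [Expr.eval, Memory.set_same]
      simp
  have hloop : ∀ m k s, k + m = L.length → Bounded N s → Copied L k s → ∃ s' t,
      Exec (.loop test body) s s' t ∧
        t ≤ m * (test.costBound N + body.costBound N) + test.costBound N ∧ Bounded N s' ∧
        Copied L L.length s' := by
    intro m
    induction m with
    | zero =>
      intro k s hk hb h
      obtain rfl : k = L.length := by omega
      exact ⟨s, _, .loop_neg (by rw [htest h]; omega), by simpa using test.cost_le hb, hb, h⟩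
    | succ m ih =>
      intro k s hk hb h
      obtain ⟨s₁, t₁, hx₁, ht₁, hb₁, h₁⟩ := hbody k s (by omega) hb h
      obtain ⟨s₂, t₂, hx₂, ht₂, h₂⟩ := ih (k + 1) s₁ (by omega) hb₁ h₁
      refine ⟨s₂, _, .loop_pos (by rw [htest h]; omega) hx₁ hx₂, ?_, h₂⟩
      have := test.cost_le hb
      rw [Nat.succ_mul]
      omega
  have hb₀ : Bounded N ((input L).set 3 0 0) := hb.set _ _ (by simp)
  have hx₀ : Exec (assign 0 (.const 0)) (input L) ((input L).set 3 0 0) _ :=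
    Exec.write (input L) 3 (.const 0) (.const 0)
  have hc₀ : Copied L 0 ((input L).set 3 0 0) := by
    refine ⟨?_, ?_, ?_, ?_⟩
    · rw [Memory.set_array _ _ _ (by omega)]
    · rw [Memory.set_array _ _ _ (by omega)]
      simp [input]
    · rw [Memory.set_array _ _ _ (by omega)]
      funext i
      split_ifs with hi
      · simp [input, not_le.2 (show i < 0 by omega)]
      · simp [input]
    · simp [Memory.set_same]
  obtain ⟨s₁, t₁, hx₁, ht₁, hb₁, hc₁⟩ := hloop L.length 0 _ (by omega) hb₀ hc₀
  refine ⟨s₁.set 1 0 0, _, .seq (.seq hx₀ hx₁) (.write s₁ 1 (.const 0) (.const 0)), ?_,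
    hb₁.set _ _ (by simp), ⟨?_, by simp⟩, ?_⟩
  · refine Nat.add_le_add (Nat.add_le_add ?_ (ht₁.trans ?_)) ?_
    · exact Nat.add_le_add (Expr.cost_le hb _) (Expr.cost_le hb _)
    · exact Nat.add_le_add_right (Nat.mul_le_mul_right _ hLN) _
    · exact Nat.add_le_add (Expr.cost_le hb₁ _) (Expr.cost_le hb₁ _)
  · rw [Memory.set_array _ _ _ (by omega), hc₁.copy]
    funext i
    split_ifs with hi
    · rfl
    -- Past the end of `L`, the input is zero, like the cells that were never written.
    · obtain ⟨k, rfl⟩ := Int.eq_ofNat_of_zero_le (show 0 ≤ i by omega)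
      rw [input_coe, List.getD_eq_default _ _ (by omega)]
  · simp [Outputs, Memory.set_same]

/-- Programs that write their output sequentially yield polynomial time algorithms. -/
theorem PolyTime.of_runs {α : Type} {inp : α → List ℤ} {par : α → ℕ} {out : α → List ℤ}
    (c : Prog) (K : ℕ) (hK : 0 < K) (σ : α → List ℤ)
    (hlen : ∀ a, (out a).length < 2 ^ (K * (bitLength (inp a) + par a + 1)))
    (h : ∀ a, Runs (K * (bitLength (inp a) + par a + 1)) (input (inp a) 0) c [] (σ a) (out a)) :
    PolyTime inp par out := by
  obtain ⟨P, hP⟩ := (Prog.seq copyInput c).isPolynomial_costBound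
  -- The bound `N` is linear in the size, so composing it with the cost polynomial gives a
  -- polynomial again.
  refine ⟨.seq copyInput c, P.comp (.C K * (.X + 1)), fun a => ?_⟩
  obtain ⟨s₁, t₁, hx₁, ht₁, hb₁, hs₁, ho₁⟩ := exec_copyInput (L := inp a)
    (N := K * (bitLength (inp a) + par a + 1)) (by nlinarith)
  obtain ⟨s₂, t₂, hx₂, ht₂, -, -, ho₂⟩ := h a [] s₁ hb₁ hs₁ ho₁ (by simpa using hlen a)
  refine ⟨s₂, _, .seq hx₁ hx₂, ?_, ho₂⟩
  have h1 : (P.comp (.C K * (.X + 1))).eval (bitLength (inp a) + par a) =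
      (Prog.seq copyInput c).costBound (K * (bitLength (inp a) + par a + 1)) := by
    refine (Eq.trans (hP _) ?_).symm
    simp
  rw [h1]
  exact Nat.add_le_add ht₁ ht₂

/-! ### Symbolic evaluation of expressions and comparisons -/

/-- The value of an expression in terms of the data and the variables. -/
def Expr.value (D : ℤ → ℤ) (σ : List ℤ) : Expr → ℤ
  | .const z => z
  | .read a e => if a = 2 then D (e.value D σ) else σ.getD (a - 3) 0
  | .add e₁ e₂ => e₁.value D σ + e₂.value D σ
  | .sub e₁ e₂ => e₁.value D σ - e₂.value D σ
  | .mul e₁ e₂ => e₁.value D σ * e₂.value D σ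

/-- The expression is the constant zero. -/
def Expr.isZero : Expr → Bool
  | .const z => z == 0
  | _ => false

/-- The expression reads only the data and the first `m` variables. -/
def Expr.closed (m : ℕ) : Expr → Bool
  | .const _ => true
  | .read a e => (a == 2 && e.closed m) || (Nat.ble 3 a && Nat.blt a (m + 3) && e.isZero)
  | .add e₁ e₂ => e₁.closed m && e₂.closed m
  | .sub e₁ e₂ => e₁.closed m && e₂.closed m
  | .mul e₁ e₂ => e₁.closed m && e₂.closed m

theorem Expr.eval_eq_zero {e : Expr} (h : e.isZero = true) (s : Memory) : e.eval s = 0 := by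
  cases e <;> simp_all [isZero, eval]

/-- `Expr.value` ignores the index of a read outside array 2; closedness ensures that this index is
the constant zero and that the array is a known variable. -/
theorem Evaluates.of_closed {D : ℤ → ℤ} {σ : List ℤ} {e : Expr} (h : e.closed σ.length = true) :
    Evaluates D σ e (e.value D σ) := by
  intro s hs
  induction e with
  | const z => rfl
  | read a e ih =>
    simp only [Expr.closed, Bool.or_eq_true, Bool.and_eq_true, beq_iff_eq, Nat.ble_eq,
      Nat.blt_eq] at h
    rcases h with ⟨rfl, h⟩ | ⟨⟨h3, ha⟩, hz⟩
    · simp only [Expr.eval, Expr.value, hs.data, ih h, if_true]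
    · have := hs.vars (a - 3) (by omega)
      rw [Nat.sub_add_cancel h3] at this
      rw [Expr.eval, Expr.eval_eq_zero hz, Expr.value, if_neg (by omega), this]
  | add _ _ h₁ h₂ =>
    simp only [Expr.closed, Bool.and_eq_true] at h
    simp only [Expr.eval, Expr.value, h₁ h.1, h₂ h.2]
  | sub _ _ h₁ h₂ =>
    simp only [Expr.closed, Bool.and_eq_true] at h
    simp only [Expr.eval, Expr.value, h₁ h.1, h₂ h.2]
  | mul _ _ h₁ h₂ =>
    simp only [Expr.closed, Bool.and_eq_true] at h
    simp only [Expr.eval, Expr.value, h₁ h.1, h₂ h.2]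

theorem Evaluates.of_value {D : ℤ → ℤ} {σ : List ℤ} {e : Expr} {z : ℤ}
    (h : e.closed σ.length = true) (hz : e.value D σ = z) : Evaluates D σ e z :=
  hz ▸ .of_closed h

/-- Execute `c` if `a < b`, and `d` otherwise. -/
def ifLt (a b : Expr) (c d : Prog) : Prog := .ite (.sub b a) c d

/-- Execute `c` if `a = b`, and `d` otherwise. -/
def ifEq (a b : Expr) (c d : Prog) : Prog := ifLt a b d (ifLt b a d c)

section Rules

variable {N : ℕ} {D : ℤ → ℤ} {σ σ' g : List ℤ} {c c' : Prog} {a b : Expr} {x y : ℕ}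

theorem Runs.emit_zero {z : ℤ} (hz : z = 0) : Runs N D (RAM.emit (.const 0)) σ σ [z] := by
  subst hz
  exact .emit (.const 0) (by simp)

theorem Runs.ifLt (ha : Evaluates D σ a x) (hb : Evaluates D σ b y)
    (h : x < y → Runs N D c σ σ' g) (h' : ¬ x < y → Runs N D c' σ σ' g) :
    Runs N D (ifLt a b c c') σ σ' g :=
  .ite (hb.sub ha) (fun hz => h (by omega)) fun hz => h' (by omega)

theorem Runs.ifEq (ha : Evaluates D σ a x) (hb : Evaluates D σ b y)
    (h : x = y → Runs N D c σ σ' g) (h' : ¬ x = y → Runs N D c' σ σ' g) :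
    Runs N D (ifEq a b c c') σ σ' g :=
  .ifLt ha hb (fun hz => h' (by omega)) fun hz =>
    .ifLt hb ha (fun hz' => h' (by omega)) fun hz' => h (by omega)

end Rules

/-! ### The programs

The variables are the number of vertices, the maximum capacity and the number of slots, followed by
loop counters. -/

/-- The capacity of vertex `i`. -/
def capE (i : Expr) : Expr := dat (.add (.add (.const 2) (.mul (var 0) (var 0))) i)

/-- The numerator of the weight of the pair `i`, `j`. -/
def wtE (i j : Expr) : Expr := dat (.add (.const 2) (.add (.mul i (var 0)) j))

/-- The entry `k` of the input that follows the description of the game. -/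
def restE (k : Expr) : Expr :=
  dat (.add (.add (.add (.const 2) (.mul (var 0) (var 0))) (var 0)) k)

/-- The length of a row of vertices. -/
def rowE : Expr := .add (var 1) (.mul (.const 2) (var 2))

/-- The length of a row of players. -/
def playersE : Expr := .add (.const 1) (var 2)

/-- The denominator of the weights. -/
def denE : Expr := dat (.const 1)

/-- Compute the three parameters. -/
def setup : Prog :=
  .seq (assign 0 (dat (.const 0))) (.seq (assign 1 (.const 0)) (.seq
    (forLoop 2 (var 0) (ifLt (var 1) (capE (var 2)) (assign 1 (capE (var 2))) .skip)) (.seq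
    (assign 2 (.const 0)) (ifLt (.const 1) (var 1) (assign 2 (var 0)) .skip))))

/-- Emit an entry of the weight matrix. -/
def entryProg : Prog :=
  ifLt (var 4) (var 1)
    (ifLt (var 6) (var 1)
      (ifLt (.const 1) (var 1) (emit (.const 0)) (emit (wtE (var 3) (var 5))))
      (ifLt (var 6) (.add (var 1) (var 2))
        (ifEq (var 3) (var 5)
          (ifLt (var 4) (capE (var 3)) (emit (wtE (var 5) (.sub (var 6) (var 1))))
            (emit (.const 0)))
          (emit (.const 0)))
        (emit (.const 0))))
    (ifLt (var 4) (.add (var 1) (var 2))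
      (ifLt (var 6) (var 1)
        (ifEq (var 3) (var 5)
          (ifLt (var 6) (capE (var 3)) (emit (wtE (var 3) (.sub (var 4) (var 1))))
            (emit (.const 0)))
          (emit (.const 0)))
        (ifLt (var 6) (.add (var 1) (var 2))
          (ifEq (var 4) (.add (var 1) (var 5))
            (ifEq (var 6) (.add (var 1) (var 3)) (emit (wtE (var 3) (var 5))) (emit (.const 0)))
            (emit (.const 0)))
          (emit (.const 0))))
      (emit (.const 0)))

/-- The number of the pair `a`, `b` of players. -/
def pairE (a b : Expr) : Expr := .add (.mul a playersE) (.add (.const 1) b)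

/-- Emit the owner of a vertex. -/
def ownerProg : Prog :=
  ifLt (var 4) (var 1) (emit (.mul (var 3) playersE))
    (ifLt (var 4) (.add (var 1) (var 2))
      (ifLt (.sub (var 4) (var 1)) (var 3)
        (emit (pairE (.sub (var 4) (var 1)) (var 3)))
        (emit (pairE (var 3) (.sub (var 4) (var 1)))))
      (ifLt (.sub (.sub (var 4) (var 1)) (var 2)) (var 3)
        (emit (pairE (var 3) (.sub (.sub (var 4) (var 1)) (var 2))))
        (emit (pairE (.sub (.sub (var 4) (var 1)) (var 2)) (var 3)))))

/-- Emit the padded game. -/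
def gameProg : Prog :=
  .seq (.seq (.seq (.seq (emit (.mul (var 0) rowE)) (emit denE))
    (forLoop 3 (var 0) (forLoop 4 rowE (forLoop 5 (var 0) (forLoop 6 rowE entryProg)))))
    (emit (.mul (var 0) playersE))) (forLoop 3 (var 0) (forLoop 4 rowE ownerProg))

/-- Emit the extension of a vector to the padded game. -/
def extendProg : Prog :=
  .seq (emit (.mul (restE (.const 0)) denE)) (forLoop 3 (var 0)
    (.seq (emit (.mul (restE (.add (.const 1) (var 3))) denE))
      (forLoop 4 (var 2) (ifLt (var 3) (var 4)
        (emit (.mul (wtE (var 3) (var 4)) (restE (.const 0)))) (emit (.const 0))))))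

/-- Emit the restriction of a coalition. -/
def restrictProg : Prog := forLoop 3 (var 0) (emit (restE (.mul (var 3) playersE)))

/-- Emit the allocation of the original game. -/
def pullProg : Prog :=
  .seq (emit (.mul (restE (.const 0)) denE)) (forLoop 3 (var 0)
    (.seq (assign 4 (.mul (restE (.add (.const 1) (.mul (var 3) playersE))) denE)) (.seq
      (forLoop 5 (var 2) (.seq
        (assign 4 (.add (var 4) (.mul (restE (.add (.add (.const 1) (.mul (var 3) playersE))
          (.add (.const 1) (var 5)))) denE)))
        (ifLt (var 3) (var 5)
          (assign 4 (.sub (var 4) (.mul (wtE (var 3) (var 5)) (restE (.const 0))))) .skip)))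
      (emit (var 4)))))

/-! ### Correctness and size bounds of the programs -/

/-- `D` holds the description of `I`, followed by `X`; sizes are measured by `A`. -/
structure Describes (D : ℤ → ℤ) (I : BMatchingGame) (X : List ℤ) (A : ℕ) : Prop where
  pos : 1 ≤ A
  n_le : I.n ≤ A
  bStar_le : I.bStar ≤ A
  bound : ∀ i, (D i).natAbs < 2 ^ A
  n_eq : D 0 = I.n
  den_eq : D 1 = I.den
  wt_eq : ∀ i j : ℕ, i < I.n → j < I.n → D (2 + (i * I.n + j)) = I.wt i j
  capacity_eq : ∀ i : ℕ, i < I.n → D (2 + I.n * I.n + i) = I.capacity i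
  rest_eq : ∀ k : ℕ, D (2 + I.n * I.n + I.n + k) = X.getD k 0

/-- The summand `bStar` is needed because capacities are written in binary, while the programs loop
over copies. -/
theorem describes_input (I : BMatchingGame) (X : List ℤ) :
    Describes (input (I.code ++ X) 0) I X (bitLength (I.code ++ X) + I.bStar + 1) where
  pos := by omega
  n_le := by
    have h1 := length_le_bitLength (I.code ++ X)
    rw [List.length_append, BMatchingGame.code_length] at h1
    omega
  bStar_le := by omega
  bound i := (natAbs_input_lt _ i).trans_le (Nat.pow_le_pow_right (by omega) (by omega))
  n_eq := (input_coe _ 0).trans (BMatchingGame.getD_code_zero X)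
  den_eq := (input_coe _ 1).trans (BMatchingGame.getD_code_one X)
  wt_eq i j hi hj := by
    rw [← BMatchingGame.getD_code_wt X hi hj, ← input_coe]
    push_cast
    rfl
  capacity_eq i hi := by
    rw [← BMatchingGame.getD_code_capacity X hi, ← input_coe]
    push_cast
    rfl
  rest_eq k := by
    rw [← BMatchingGame.getD_code_rest X k, ← input_coe]
    push_cast
    rfl

/-- Five multiples of `A` absorb the constant and twelve the power. The bounds are generous so that
one `N = 20 * A` serves all programs. -/
theorem lt_two_pow_of_le {A m : ℕ} (hA : 1 ≤ A) (h : m ≤ 32 * A ^ 12) : m < 2 ^ (20 * A) := by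
  have h1 : A ^ 12 ≤ (2 ^ A) ^ 12 := Nat.pow_le_pow_left Nat.lt_two_pow_self.le 12
  have h2 : 2 ^ 5 ≤ 2 ^ (5 * A) := Nat.pow_le_pow_right (by omega) (by omega)
  calc m ≤ 2 ^ 5 * A ^ 12 := h
    _ ≤ 2 ^ (5 * A) * (2 ^ A) ^ 12 := Nat.mul_le_mul h2 h1
    _ = 2 ^ (17 * A) := by rw [← pow_mul, ← pow_add]; congr 1; ring
    _ < 2 ^ (20 * A) := Nat.pow_lt_pow_right (by omega) (by omega)

namespace Describes

variable {D : ℤ → ℤ} {I : BMatchingGame} {X : List ℤ} {A : ℕ}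

theorem slots_le (h : Describes D I X A) : I.slots ≤ A := by
  have := I.slots_eq
  have := h.n_le
  omega

theorem rowLength_le (h : Describes D I X A) : I.rowLength ≤ 3 * A := by
  have := h.slots_le
  have := h.bStar_le
  unfold BMatchingGame.rowLength
  omega

theorem lt_of_le (h : Describes D I X A) {m : ℕ} (hm : m ≤ 32 * A ^ 12) :
    (m : ℤ).natAbs < 2 ^ (20 * A) := by
  rw [Int.natAbs_natCast]
  exact lt_two_pow_of_le h.pos hm

theorem lt_of_le_mul (h : Describes D I X A) {m : ℕ} (hm : m ≤ 32 * A) :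
    (m : ℤ).natAbs < 2 ^ (20 * A) :=
  h.lt_of_le (hm.trans (Nat.mul_le_mul_left _ (Nat.le_self_pow (by omega) A)))

theorem bound' (h : Describes D I X A) (i : ℤ) : (D i).natAbs < 2 ^ (20 * A) :=
  (h.bound i).trans_le (Nat.pow_le_pow_right (by omega) (by omega))

theorem runs_setup (h : Describes D I X A) :
    Runs (20 * A) D setup [] [(I.n : ℤ), (I.bStar : ℤ), (I.slots : ℤ)] [] := by
  have hn := h.n_le
  have hB := h.bStar_le
  have hpos := h.pos
  -- Loop invariant: variable 1 holds the maximum of the first `k` capacities.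
  let τ : ℕ → List ℤ := fun k => [(I.n : ℤ), (((Finset.range k).sup I.capacity : ℕ) : ℤ)]
  have hsup : (Finset.range I.n).sup I.capacity = I.bStar := by
    apply le_antisymm
    · refine Finset.sup_le fun i hi => ?_
      have := I.cap_le_bStar ⟨i, Finset.mem_range.1 hi⟩
      rwa [← I.capacity_coe] at this
    · show Finset.univ.sup I.cap ≤ _
      refine Finset.sup_le fun i _ => ?_
      rw [← I.capacity_coe]
      exact Finset.le_sup (f := I.capacity) (Finset.mem_range.2 i.2)
  have h1 : Runs (20 * A) D (assign 0 (dat (.const 0))) [] [(I.n : ℤ)] [] :=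
    .declare (σ := []) rfl (.of_value rfl h.n_eq) (h.lt_of_le_mul (by omega))
  have h2 : Runs (20 * A) D (assign 1 (.const 0)) [(I.n : ℤ)] (τ 0) [] :=
    .declare (σ := [(I.n : ℤ)]) rfl (.const 0) (by simp)
  have h3 : Runs (20 * A) D
      (RAM.forLoop 2 (var 0) (ifLt (var 1) (capE (var 2)) (RAM.assign 1 (capE (var 2))) .skip))
      (τ 0) (τ I.n) ((List.range I.n).flatMap fun _ => []) := by
    refine Runs.forLoop (by omega) (fun _ => rfl) (fun _ => .of_value rfl rfl) fun k hk => ?_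
    have hcap : Evaluates D (τ k ++ [(k : ℤ)]) (capE (var 2)) (I.capacity k) :=
      .of_value rfl (h.capacity_eq k hk)
    have hs : (Finset.range (k + 1)).sup I.capacity =
        max ((Finset.range k).sup I.capacity) (I.capacity k) := by
      rw [Finset.range_add_one, Finset.sup_insert, max_comm]
    refine Runs.ifLt (x := (Finset.range k).sup I.capacity) (.of_value rfl rfl) hcap
      (fun hlt => ?_) fun hlt => ?_
    · have := Runs.assign (N := 20 * A) (v := 1) hcap
        (by rw [← h.capacity_eq k hk]; exact h.bound' _)
      simp only [τ, hs, max_eq_right hlt.le]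
      exact this
    · simp only [τ, hs, max_eq_left (not_lt.1 hlt)]
      exact .skip
  have h4 : Runs (20 * A) D (assign 2 (.const 0)) (τ I.n) (τ I.n ++ [0]) [] :=
    .declare rfl (.const 0) (by simp)
  have h5 : Runs (20 * A) D (ifLt (.const 1) (var 1) (assign 2 (var 0)) .skip) (τ I.n ++ [0])
      [(I.n : ℤ), (I.bStar : ℤ), (I.slots : ℤ)] [] := by
    simp only [τ, hsup, BMatchingGame.slots]
    refine Runs.ifLt (x := 1) (y := I.bStar) (.const 1) (.of_value rfl rfl) (fun hlt => ?_)
      fun hlt => ?_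
    · rw [if_pos (show 2 ≤ I.bStar from hlt)]
      exact Runs.assign (v := 2) (z := I.n) (.of_value rfl rfl) (h.lt_of_le_mul (by omega))
    · rw [if_neg (show ¬ 2 ≤ I.bStar from hlt)]
      exact .skip
  have hnil : ((List.range I.n).flatMap fun _ => ([] : List ℤ)) = [] := by simp
  rw [hnil] at h3
  exact h1.seq (h2.seq (h3.seq (h4.seq h5)))

theorem evaluates_rowE (τ : List ℤ) : Evaluates D
    ([(I.n : ℤ), (I.bStar : ℤ), (I.slots : ℤ)] ++ τ) rowE I.rowLength := by
  refine Evaluates.append (.of_value rfl ?_) τ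
  show (I.bStar : ℤ) + 2 * (I.slots : ℤ) = _
  simp [BMatchingGame.rowLength]

theorem evaluates_wtE (h : Describes D I X A) {σ : List ℤ} {e₁ e₂ : Expr} {i j : ℕ}
    (hσ : Evaluates D σ (var 0) I.n) (h₁ : Evaluates D σ e₁ i) (h₂ : Evaluates D σ e₂ j)
    (hi : i < I.n) (hj : j < I.n) : Evaluates D σ (wtE e₁ e₂) (I.wt i j) := by
  rw [← h.wt_eq i j hi hj]
  exact ((Evaluates.const 2).add ((h₁.mul hσ).add h₂)).dat

theorem runs_wtE (h : Describes D I X A) {σ : List ℤ} {e₁ e₂ : Expr} {i j : ℕ} {z : ℤ}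
    (hσ : Evaluates D σ (var 0) I.n) (h₁ : Evaluates D σ e₁ i) (h₂ : Evaluates D σ e₂ j)
    (hi : i < I.n) (hj : j < I.n) (hz : z = I.wt i j) :
    Runs (20 * A) D (emit (wtE e₁ e₂)) σ σ [z] := by
  rw [hz]
  exact .emit (h.evaluates_wtE hσ h₁ h₂ hi hj) (h.wt_eq i j hi hj ▸ h.bound' _)

/-- The program follows the case distinction of `padEntry`, with conjunctions resolved into nested
tests. A weight is read only in branches where both indices are vertices. -/
theorem runs_entryProg (h : Describes D I X A) {i r i' r' : ℕ} (hi : i < I.n) (hi' : i' < I.n) :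
    Runs (20 * A) D entryProg
      [(I.n : ℤ), (I.bStar : ℤ), (I.slots : ℤ), (i : ℤ), (r : ℤ), (i' : ℤ), (r' : ℤ)]
      [(I.n : ℤ), (I.bStar : ℤ), (I.slots : ℤ), (i : ℤ), (r : ℤ), (i' : ℤ), (r' : ℤ)]
      [(I.entry i r i' r' : ℤ)] := by
  have hq := I.slots_eq
  let σ : List ℤ :=
    [(I.n : ℤ), (I.bStar : ℤ), (I.slots : ℤ), (i : ℤ), (r : ℤ), (i' : ℤ), (r' : ℤ)]
  have hn : Evaluates D σ (var 0) I.n := .of_value rfl rfl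
  have hB : Evaluates D σ (var 1) I.bStar := .of_value rfl rfl
  have hiv : Evaluates D σ (var 3) i := .of_value rfl rfl
  have hrv : Evaluates D σ (var 4) r := .of_value rfl rfl
  have hiv' : Evaluates D σ (var 5) i' := .of_value rfl rfl
  have hrv' : Evaluates D σ (var 6) r' := .of_value rfl rfl
  have hBq : Evaluates D σ (.add (var 1) (var 2)) (I.bStar + I.slots : ℕ) :=
    .of_value rfl (Nat.cast_add _ _).symm
  have hBi : Evaluates D σ (.add (var 1) (var 3)) (I.bStar + i : ℕ) :=
    .of_value rfl (Nat.cast_add _ _).symm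
  have hBi' : Evaluates D σ (.add (var 1) (var 5)) (I.bStar + i' : ℕ) :=
    .of_value rfl (Nat.cast_add _ _).symm
  have hcap : Evaluates D σ (capE (var 3)) (I.capacity i) := .of_value rfl (h.capacity_eq i hi)
  unfold BMatchingGame.entry padEntry
  refine Runs.ifLt hrv hB (fun h1 => ?_) fun h1 => ?_ <;> simp only [h1, if_true, if_false]
  · refine Runs.ifLt hrv' hB (fun h2 => ?_) fun h2 => ?_ <;> simp only [h2, if_true, if_false]
    · refine Runs.ifLt (x := 1) (y := I.bStar) (.const 1) hB (fun h3 => ?_) fun h3 => ?_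
      · exact .emit_zero (by rw [if_neg (by omega)]; rfl)
      · exact h.runs_wtE hn hiv hiv' hi hi' (by rw [if_pos (by omega)])
    · refine Runs.ifLt hrv' hBq (fun h3 => ?_) fun h3 => ?_
      · refine Runs.ifEq hiv hiv' (fun h4 => ?_) fun h4 => ?_
        · refine Runs.ifLt hrv hcap (fun h5 => ?_) fun h5 => ?_
          · rw [if_pos ⟨h3, h4, h5⟩]
            have : Evaluates D σ (.sub (var 6) (var 1)) (r' - I.bStar : ℕ) :=
              .of_value rfl (Nat.cast_sub (by omega)).symm
            exact h.runs_wtE hn hiv' this hi' (by omega) (by rw [h4])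
          · exact .emit_zero (by rw [if_neg (by simp [h5])]; rfl)
        · exact .emit_zero (by rw [if_neg (by simp [h4])]; rfl)
      · exact .emit_zero (by rw [if_neg (by simp [h3])]; rfl)
  · refine Runs.ifLt hrv hBq (fun h2 => ?_) fun h2 => ?_ <;> simp only [h2, if_true, if_false]
    · refine Runs.ifLt hrv' hB (fun h3 => ?_) fun h3 => ?_ <;> simp only [h3, if_true, if_false]
      · refine Runs.ifEq hiv hiv' (fun h4 => ?_) fun h4 => ?_
        · refine Runs.ifLt hrv' hcap (fun h5 => ?_) fun h5 => ?_
          · rw [if_pos ⟨h4, h5⟩]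
            have : Evaluates D σ (.sub (var 4) (var 1)) (r - I.bStar : ℕ) :=
              .of_value rfl (Nat.cast_sub (by omega)).symm
            exact h.runs_wtE hn hiv this hi (by omega) rfl
          · exact .emit_zero (by rw [if_neg (by simp [h5])]; rfl)
        · exact .emit_zero (by rw [if_neg (by simp [h4])]; rfl)
      · refine Runs.ifLt hrv' hBq (fun h4 => ?_) fun h4 => ?_
        · refine Runs.ifEq hrv hBi' (fun h5 => ?_) fun h5 => ?_
          · refine Runs.ifEq hrv' hBi (fun h6 => ?_) fun h6 => ?_
            · exact h.runs_wtE hn hiv hiv' hi hi' (by rw [if_pos ⟨h4, h5, h6⟩])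
            · exact .emit_zero (by rw [if_neg (by simp [h6])]; rfl)
          · exact .emit_zero (by rw [if_neg (by simp [h5])]; rfl)
        · exact .emit_zero (by rw [if_neg (by simp [h4])]; rfl)
    · exact .emit_zero rfl

theorem runs_ownerProg (h : Describes D I X A) {i r : ℕ} (hi : i < I.n) (hr : r < I.rowLength) :
    Runs (20 * A) D ownerProg
      [(I.n : ℤ), (I.bStar : ℤ), (I.slots : ℤ), (i : ℤ), (r : ℤ)]
      [(I.n : ℤ), (I.bStar : ℤ), (I.slots : ℤ), (i : ℤ), (r : ℤ)]
      [(padOwner I.bStar I.slots i r : ℤ)] := by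
  let σ : List ℤ := [(I.n : ℤ), (I.bStar : ℤ), (I.slots : ℤ), (i : ℤ), (r : ℤ)]
  have hbound : (padOwner I.bStar I.slots i r : ℤ).natAbs < 2 ^ (20 * A) := by
    have h1 := padOwner_lt I.slots_eq hi hr
    have h2 : I.n * (1 + I.slots) ≤ A * (A + A) :=
      Nat.mul_le_mul h.n_le (Nat.add_le_add h.pos h.slots_le)
    refine h.lt_of_le (h1.le.trans (h2.trans ?_))
    have h3 : A ^ 2 ≤ A ^ 12 := Nat.pow_le_pow_right h.pos (by omega)
    nlinarith
  have hB : Evaluates D σ (var 1) I.bStar := .of_value rfl rfl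
  have hiv : Evaluates D σ (var 3) i := .of_value rfl rfl
  have hrv : Evaluates D σ (var 4) r := .of_value rfl rfl
  have hBq : Evaluates D σ (.add (var 1) (var 2)) (I.bStar + I.slots : ℕ) :=
    .of_value rfl (Nat.cast_add _ _).symm
  have hp : Evaluates D σ playersE (1 + I.slots : ℕ) := .of_value rfl (by simp; rfl)
  have hpair : ∀ {a b : Expr} {x y : ℕ}, Evaluates D σ a x → Evaluates D σ b y →
      padOwner I.bStar I.slots i r = x * (1 + I.slots) + (1 + y) →
      Runs (20 * A) D (emit (pairE a b)) σ σ [(padOwner I.bStar I.slots i r : ℤ)] := by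
    intro a b x y ha hb hxy
    refine .emit ?_ hbound
    rw [hxy]
    push_cast
    have := (ha.mul hp).add ((Evaluates.const 1).add hb)
    push_cast at this
    exact this
  refine Runs.ifLt hrv hB (fun h1 => ?_) fun h1 => ?_
  · refine .emit ?_ hbound
    rw [padOwner, if_pos h1, Nat.cast_mul]
    exact hiv.mul hp
  · have hd : Evaluates D σ (.sub (var 4) (var 1)) (r - I.bStar : ℕ) :=
      .of_value rfl (Nat.cast_sub (by omega)).symm
    refine Runs.ifLt hrv hBq (fun h2 => ?_) fun h2 => ?_
    · refine Runs.ifLt hd hiv (fun h3 => ?_) fun h3 => ?_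
      · exact hpair hd hiv (by rw [padOwner, if_neg h1, if_pos h2, min_eq_right h3.le,
          max_eq_left h3.le])
      · have h3 := not_lt.1 h3
        exact hpair hiv hd (by rw [padOwner, if_neg h1, if_pos h2, min_eq_left h3,
          max_eq_right h3])
    · have hd' : Evaluates D σ (.sub (.sub (var 4) (var 1)) (var 2))
          (r - I.bStar - I.slots : ℕ) := by
        rw [Nat.cast_sub (by omega)]
        exact hd.sub (.of_value rfl rfl)
      refine Runs.ifLt hd' hiv (fun h3 => ?_) fun h3 => ?_
      · exact hpair hiv hd' (by rw [padOwner, if_neg h1, if_neg h2, min_eq_right h3.le,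
          max_eq_left h3.le])
      · have h3 := not_lt.1 h3
        exact hpair hd' hiv (by rw [padOwner, if_neg h1, if_neg h2, min_eq_left h3,
          max_eq_right h3])

end Describes

/-- A loop that emits one number in each round. -/
theorem Runs.for_map {N v M : ℕ} {D : ℤ → ℤ} {σ : List ℤ} {c : Prog} {e : Expr} {g : ℕ → ℤ}
    (hM : M ≤ N) (hv : σ.length = v) (he : Evaluates D σ e M)
    (h : ∀ k < M, Runs N D c (σ ++ [(k : ℤ)]) (σ ++ [(k : ℤ)]) [g k]) :
    Runs N D (RAM.forLoop v e c) σ σ ((List.range M).map g) := by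
  rw [← List.flatMap_singleton' ((List.range M).map g), List.flatMap_map]
  exact .for_emit hM hv he h

namespace Describes

variable {D : ℤ → ℤ} {I : BMatchingGame} {X : List ℤ} {A : ℕ}

theorem mul_rowLength_le (h : Describes D I X A) : I.n * I.rowLength ≤ 3 * A ^ 2 :=
  (Nat.mul_le_mul h.n_le h.rowLength_le).trans_eq (by ring)

theorem mul_slots_le (h : Describes D I X A) : I.n * (1 + I.slots) ≤ 2 * A ^ 2 :=
  (Nat.mul_le_mul h.n_le (Nat.add_le_add h.pos h.slots_le)).trans_eq (by ring)

theorem runs_gameProg (h : Describes D I X A) :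
    Runs (20 * A) D gameProg [(I.n : ℤ), (I.bStar : ℤ), (I.slots : ℤ)]
      [(I.n : ℤ), (I.bStar : ℤ), (I.slots : ℤ)] I.padded.code := by
  have hpow : A ^ 2 ≤ A ^ 12 := Nat.pow_le_pow_right h.pos (by omega)
  have hnA : I.n ≤ 20 * A := h.n_le.trans (by omega)
  have hRA : I.rowLength ≤ 20 * A := h.rowLength_le.trans (by omega)
  have hn : ∀ τ, Evaluates D ([(I.n : ℤ), (I.bStar : ℤ), (I.slots : ℤ)] ++ τ) (var 0) I.n :=
    fun τ => .append (.of_value rfl rfl) τ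
  let σ : List ℤ := [(I.n : ℤ), (I.bStar : ℤ), (I.slots : ℤ)]
  have h1 : Runs (20 * A) D (emit (.mul (var 0) rowE)) σ σ [((I.n * I.rowLength : ℕ) : ℤ)] := by
    refine .emit ?_ (h.lt_of_le (h.mul_rowLength_le.trans (by omega)))
    rw [Nat.cast_mul]
    exact (hn []).mul (evaluates_rowE [])
  have h2 : Runs (20 * A) D (emit denE) σ σ [(I.den : ℤ)] :=
    .emit (.of_value rfl h.den_eq) (h.den_eq ▸ h.bound' 1)
  have h3 : Runs (20 * A) D (emit (.mul (var 0) playersE)) σ σ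
      [((I.n * (1 + I.slots) : ℕ) : ℤ)] :=
    .emit (.of_value rfl (by push_cast; rfl)) (h.lt_of_le (h.mul_slots_le.trans (by omega)))
  rw [I.padded_code]
  refine (((h1.seq h2).seq ?_).seq h3).seq ?_
  · exact .for_emit hnA rfl (hn []) fun i hi => .for_emit hRA rfl (evaluates_rowE _) fun r hr =>
      .for_emit hnA rfl (hn _) fun i' hi' => .for_map hRA rfl (evaluates_rowE [(i : ℤ), r, i'])
        fun r' hr' => h.runs_entryProg hi hi'
  · exact .for_emit hnA rfl (hn []) fun i hi => .for_map hRA rfl (evaluates_rowE [(i : ℤ)])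
      fun r hr => h.runs_ownerProg hi hr

theorem evaluates_restE (h : Describes D I X A) {σ : List ℤ} {e : Expr} {k : ℕ}
    (hσ : Evaluates D σ (var 0) I.n)
    (he : Evaluates D σ e k) : Evaluates D σ (restE e) (X.getD k 0) := by
  rw [← h.rest_eq k]
  exact ((((Evaluates.const 2).add (hσ.mul hσ)).add hσ).add he).dat

theorem rest_mul_den_bound (h : Describes D I X A) (k : ℕ) :
    (X.getD k 0 * (I.den : ℤ)).natAbs < 2 ^ (2 * A) := by
  rw [← h.rest_eq k, ← h.den_eq, Int.natAbs_mul, two_mul, pow_add]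
  exact Nat.mul_lt_mul'' (h.bound _) (h.bound _)

theorem wt_mul_rest_bound (h : Describes D I X A) {i j : ℕ} (hi : i < I.n) (hj : j < I.n) (k : ℕ) :
    ((I.wt i j : ℤ) * X.getD k 0).natAbs < 2 ^ (2 * A) := by
  rw [← h.rest_eq k, ← h.wt_eq i j hi hj, Int.natAbs_mul, two_mul, pow_add]
  exact Nat.mul_lt_mul'' (h.bound _) (h.bound _)

theorem runs_rest_mul_den (h : Describes D I X A) {σ : List ℤ} {e : Expr} {k : ℕ}
    (hσ : Evaluates D σ (var 0) I.n)
    (he : Evaluates D σ e k) :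
    Runs (20 * A) D (emit (.mul (restE e) denE)) σ σ [X.getD k 0 * (I.den : ℤ)] := by
  refine .emit ((h.evaluates_restE hσ he).mul ?_) ((h.rest_mul_den_bound k).trans_le
    (Nat.pow_le_pow_right (by omega) (by omega)))
  rw [← h.den_eq]
  exact (Evaluates.const 1).dat

theorem runs_extendProg (h : Describes D I X A) :
    Runs (20 * A) D extendProg [(I.n : ℤ), (I.bStar : ℤ), (I.slots : ℤ)]
      [(I.n : ℤ), (I.bStar : ℤ), (I.slots : ℤ)] ([X.getD 0 0 * (I.den : ℤ)] ++
        (List.range I.n).flatMap fun i => [X.getD (1 + i) 0 * (I.den : ℤ)] ++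
          (List.range I.slots).map fun j =>
            if i < j then (I.wt i j : ℤ) * X.getD 0 0 else 0) := by
  have hn : ∀ τ, Evaluates D ([(I.n : ℤ), (I.bStar : ℤ), (I.slots : ℤ)] ++ τ) (var 0) I.n :=
    fun τ => .append (.of_value rfl rfl) τ
  refine .seq (h.runs_rest_mul_den (hn []) (.const 0)) (.for_emit (h.n_le.trans (by omega)) rfl
    (hn []) fun i hi => .seq (h.runs_rest_mul_den (hn _) ?_) (.for_map (h.slots_le.trans (by omega))
      rfl (.of_value rfl rfl) fun j hj => ?_))
  · exact .of_value rfl (by push_cast; rfl)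
  · have hj' : j < I.n := by have := I.slots_eq; omega
    refine Runs.ifLt (x := i) (y := j) (.of_value rfl rfl) (.of_value rfl rfl) (fun h1 => ?_)
      fun h1 => ?_
    · rw [if_pos h1]
      exact .emit ((h.evaluates_wtE (hn [(i : ℤ), (j : ℤ)]) (.of_value rfl rfl) (.of_value rfl rfl)
        hi hj').mul (h.evaluates_restE (hn [(i : ℤ), (j : ℤ)]) (.const 0)))
        ((h.wt_mul_rest_bound hi hj' 0).trans_le (Nat.pow_le_pow_right (by omega) (by omega)))
    · exact .emit_zero (if_neg h1)

theorem runs_restrictProg (h : Describes D I X A) :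
    Runs (20 * A) D restrictProg [(I.n : ℤ), (I.bStar : ℤ), (I.slots : ℤ)]
      [(I.n : ℤ), (I.bStar : ℤ), (I.slots : ℤ)]
      ((List.range I.n).map fun i => X.getD (i * (1 + I.slots)) 0) := by
  have hn : ∀ τ, Evaluates D ([(I.n : ℤ), (I.bStar : ℤ), (I.slots : ℤ)] ++ τ) (var 0) I.n :=
    fun τ => .append (.of_value rfl rfl) τ
  refine .for_map (h.n_le.trans (by omega)) rfl (hn []) fun i hi =>
    .emit (h.evaluates_restE (hn _) ?_) ?_
  · exact .of_value rfl (by push_cast; rfl)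
  · rw [← h.rest_eq]
    exact h.bound' _

/-- The sum for each vertex is accumulated in variable 4. Each round adds one product of two input
entries and subtracts at most one, so after `k` rounds the sum is less than `(1 + 2 * k) * 2 ^ (2 *
A)` in absolute value. -/
theorem runs_pullProg (h : Describes D I X A) :
    Runs (20 * A) D pullProg [(I.n : ℤ), (I.bStar : ℤ), (I.slots : ℤ)]
      [(I.n : ℤ), (I.bStar : ℤ), (I.slots : ℤ)] ([X.getD 0 0 * (I.den : ℤ)] ++
        (List.range I.n).map fun i => X.getD (1 + i * (1 + I.slots)) 0 * (I.den : ℤ) +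
          ∑ j ∈ Finset.range I.slots, (X.getD (1 + i * (1 + I.slots) + (1 + j)) 0 * (I.den : ℤ) -
            if i < j then (I.wt i j : ℤ) * X.getD 0 0 else 0)) := by
  have hn : ∀ τ, Evaluates D ([(I.n : ℤ), (I.bStar : ℤ), (I.slots : ℤ)] ++ τ) (var 0) I.n :=
    fun τ => .append (.of_value rfl rfl) τ
  have hden : ∀ σ, Evaluates D σ denE I.den := fun σ => by
    rw [← h.den_eq]
    exact (Evaluates.const 1).dat
  -- The factor is `2 + 2 * k` to cover also the value between the addition and the subtraction of a
  -- round.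
  have hpow : ∀ k ≤ I.slots, (2 + 2 * k) * 2 ^ (2 * A) ≤ 2 ^ (20 * A) := fun k hk => by
    have h1 : A + 1 ≤ 2 ^ A := Nat.lt_two_pow_self
    have h2 := h.slots_le
    have h3 : 2 ≤ 2 ^ A := by have := h.pos; omega
    calc (2 + 2 * k) * 2 ^ (2 * A) ≤ (2 ^ A * 2 ^ A) * 2 ^ (2 * A) := by
          refine Nat.mul_le_mul_right _ (le_trans ?_ (Nat.mul_le_mul h3 h1))
          omega
      _ = 2 ^ (4 * A) := by rw [← pow_add, ← pow_add]; congr 1; ring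
      _ ≤ _ := Nat.pow_le_pow_right (by omega) (by omega)
  refine .seq (h.runs_rest_mul_den (hn []) (.const 0)) (.for_map (h.n_le.trans (by omega)) rfl
    (hn []) fun i hi => ?_)
  let a : ℤ := X.getD (1 + i * (1 + I.slots)) 0 * (I.den : ℤ)
  let p : ℕ → ℤ := fun j => X.getD (1 + i * (1 + I.slots) + (1 + j)) 0 * (I.den : ℤ)
  let m : ℕ → ℤ := fun j => if i < j then (I.wt i j : ℤ) * X.getD 0 0 else 0
  let acc : ℕ → ℤ := fun k => a + ∑ j ∈ Finset.range k, (p j - m j)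
  have hacc : ∀ k, acc (k + 1) = acc k + p k - m k := fun k => by
    simp only [acc, Finset.sum_range_succ]
    ring
  have ha : a.natAbs < 2 ^ (2 * A) := h.rest_mul_den_bound _
  have hp : ∀ j, (p j).natAbs < 2 ^ (2 * A) := fun j => h.rest_mul_den_bound _
  have hm : ∀ j < I.slots, (m j).natAbs < 2 ^ (2 * A) := fun j hj => by
    simp only [m]
    split_ifs
    · exact h.wt_mul_rest_bound hi (by have := I.slots_eq; omega) 0
    · simp
  have hbound : ∀ k ≤ I.slots, (acc k).natAbs < (1 + 2 * k) * 2 ^ (2 * A) := by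
    intro k
    induction k with
    | zero => intro _; simpa [acc] using ha
    | succ k ih =>
      intro hk
      have h1 := ih (by omega)
      have h2 := hp k
      have h3 := hm k (by omega)
      rw [hacc, show (1 + 2 * (k + 1)) * 2 ^ (2 * A) =
        (1 + 2 * k) * 2 ^ (2 * A) + 2 ^ (2 * A) + 2 ^ (2 * A) by ring]
      omega
  have hfin : ∀ k ≤ I.slots, (acc k).natAbs < 2 ^ (20 * A) := fun k hk =>
    (hbound k hk).trans_le ((Nat.mul_le_mul_right _ (by omega)).trans (hpow k hk))
  let τ : ℕ → List ℤ := fun k => [(I.n : ℤ), (I.bStar : ℤ), (I.slots : ℤ), (i : ℤ), acc k]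
  have hrow : ∀ τ, Evaluates D ([(I.n : ℤ), (I.bStar : ℤ), (I.slots : ℤ), (i : ℤ)] ++ τ)
      (.add (.const 1) (.mul (var 3) playersE)) (1 + i * (1 + I.slots) : ℕ) :=
    fun τ => .append (.of_value rfl (by push_cast; rfl)) τ
  have h1 : Runs (20 * A) D
      (assign 4 (.mul (restE (.add (.const 1) (.mul (var 3) playersE))) denE))
      [(I.n : ℤ), (I.bStar : ℤ), (I.slots : ℤ), (i : ℤ)] (τ 0) [] := by
    have h0 : acc 0 = a := by simp [acc]
    simp only [τ, h0]
    refine .declare (σ := [_, _, _, _]) rfl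
      ((h.evaluates_restE (hn [(i : ℤ)]) (hrow [])).mul (hden _)) ?_
    have := hfin 0 (by omega)
    rwa [h0] at this
  have h2 : Runs (20 * A) D (forLoop 5 (var 2) (.seq
        (assign 4 (.add (var 4) (.mul (restE (.add (.add (.const 1) (.mul (var 3) playersE))
          (.add (.const 1) (var 5)))) denE)))
        (RAM.ifLt (var 3) (var 5)
          (assign 4 (.sub (var 4) (.mul (wtE (var 3) (var 5)) (restE (.const 0))))) .skip)))
      (τ 0) (τ I.slots) ((List.range I.slots).flatMap fun _ => [] ++ []) := by
    refine .forLoop (h.slots_le.trans (by omega)) (fun _ => rfl) (fun _ => .of_value rfl rfl)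
      fun k hk => ?_
    have hk' : k < I.n := by have := I.slots_eq; omega
    refine .seq (σ' := [(I.n : ℤ), (I.bStar : ℤ), (I.slots : ℤ), (i : ℤ), acc k + p k, (k : ℤ)])
      ?_ (Runs.ifLt (x := i) (y := k) (.of_value rfl rfl) (.of_value rfl rfl) (fun hik => ?_)
        fun hik => ?_)
    · refine Runs.assign (v := 4) (z := acc k + p k) (Evaluates.add (.of_value rfl rfl)
        ((h.evaluates_restE (k := 1 + i * (1 + I.slots) + (1 + k)) (hn [(i : ℤ), acc k, (k : ℤ)])
          ?_).mul (hden _))) ?_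
      · rw [Nat.cast_add]
        exact (hrow [acc k, (k : ℤ)]).add (.of_value rfl (by push_cast; rfl))
      · refine lt_of_lt_of_le ?_ (hpow k hk.le)
        have h3 := hbound k hk.le
        have h4 := hp k
        rw [show (2 + 2 * k) * 2 ^ (2 * A) = (1 + 2 * k) * 2 ^ (2 * A) + 2 ^ (2 * A) by ring]
        omega
    · have hmk : m k = (I.wt i k : ℤ) * X.getD 0 0 := if_pos hik
      have h3 := hfin (k + 1) hk
      simp only [τ, hacc, hmk] at h3 ⊢
      have hσ := hn [(i : ℤ), acc k + p k, (k : ℤ)]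
      exact Runs.assign (v := 4) (Evaluates.sub (.of_value rfl rfl)
        ((h.evaluates_wtE hσ (.of_value rfl rfl) (.of_value rfl rfl) hi hk').mul
          (h.evaluates_restE hσ (.const 0)))) h3
    · have hmk : m k = 0 := if_neg hik
      simp only [τ, hacc, hmk, sub_zero]
      exact .skip
  have h3 : Runs (20 * A) D (emit (var 4)) (τ I.slots) (τ I.slots) [acc I.slots] :=
    .emit (.of_value rfl rfl) (hfin _ le_rfl)
  have hnil : ((List.range I.slots).flatMap fun _ => ([] ++ [] : List ℤ)) = [] := by simp
  rw [hnil] at h2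
  -- The accumulator goes out of scope, so that the next vertex declares it afresh.
  exact Runs.weaken (τ := [acc I.slots]) (h1.seq (h2.seq h3))

theorem length_lt (h : Describes D I X A) {m : ℕ} (hm : m ≤ 18 * A ^ 4) : m < 2 ^ (20 * A) :=
  lt_two_pow_of_le h.pos (hm.trans (Nat.mul_le_mul (by omega)
    (Nat.pow_le_pow_right h.pos (by omega))))

theorem length_padded_code_le (h : Describes D I X A) : I.padded.code.length ≤ 15 * A ^ 4 := by
  have h1 : A ^ 2 ≤ A ^ 4 := Nat.pow_le_pow_right h.pos (by omega)
  have h2 : 1 ≤ A ^ 2 := Nat.one_le_pow _ _ h.pos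
  have h3 := h.mul_rowLength_le
  have h4 : I.n * I.rowLength * (I.n * I.rowLength) ≤ 9 * A ^ 4 :=
    (Nat.mul_le_mul h3 h3).trans_eq (by ring)
  have h5 : I.padded.code.length =
      2 + I.n * I.rowLength * (I.n * I.rowLength) + 1 + I.n * I.rowLength := by
    rw [I.padded_code]
    simp [List.length_flatMap]
    ring
  omega

theorem length_extend_code_le (h : Describes D I X A) {m : ℕ} (hm : m ≤ 2 * A ^ 2) (x : RatVec m) :
    x.code.length ≤ 3 * A ^ 4 := by
  have h1 : A ^ 2 ≤ A ^ 4 := Nat.pow_le_pow_right h.pos (by omega)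
  have h2 : 1 ≤ A ^ 2 := Nat.one_le_pow _ _ h.pos
  simp only [RatVec.code, List.length_cons, List.length_ofFn]
  omega

end Describes

end RAM

/-! ### Polynomial-time computability of the four maps -/

namespace BMatchingGame

theorem polyTime_padded : RAM.PolyTime code bStar fun I => I.padded.code := by
  have hdesc : ∀ I : BMatchingGame, RAM.Describes (RAM.input I.code 0) I []
      (RAM.bitLength I.code + I.bStar + 1) := fun I => by
    simpa using RAM.describes_input I []
  exact .of_runs (.seq RAM.setup RAM.gameProg) 20 (by omega) _
    (fun I => (hdesc I).length_lt ((hdesc I).length_padded_code_le.trans (by omega)))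
    fun I => (hdesc I).runs_setup.seq (hdesc I).runs_gameProg

theorem polyTime_extend : RAM.PolyTime
    (fun a : Σ I : BMatchingGame, RatVec I.n => a.1.code ++ a.2.code) (fun a => a.1.bStar)
    fun a => a.1.padded.code ++ (a.1.extend a.2).code := by
  refine .of_runs (.seq RAM.setup (.seq RAM.gameProg RAM.extendProg)) 20 (by omega)
    (fun a => [(a.1.n : ℤ), (a.1.bStar : ℤ), (a.1.slots : ℤ)]) ?_ ?_ <;> rintro ⟨I, x⟩
  · have h := RAM.describes_input I x.code
    have h1 := h.length_padded_code_le
    have h2 := h.length_extend_code_le h.mul_slots_le (I.extend x)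
    refine h.length_lt ?_
    rw [List.length_append]
    exact (Nat.add_le_add h1 h2).trans (by omega)
  · have h := RAM.describes_input I x.code
    have := h.runs_setup.seq (h.runs_gameProg.seq h.runs_extendProg)
    rw [← extend_code] at this
    exact this

theorem polyTime_restrict : RAM.PolyTime
    (fun a : Σ I : BMatchingGame, Finset (Fin I.padded.k) => a.1.code ++ coalitionCode a.2)
    (fun a => a.1.bStar) fun a => coalitionCode (a.1.restrict a.2) := by
  refine .of_runs (.seq RAM.setup RAM.restrictProg) 20 (by omega)
    (fun a => [(a.1.n : ℤ), (a.1.bStar : ℤ), (a.1.slots : ℤ)]) ?_ ?_ <;> rintro ⟨I, S⟩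
  · have h := RAM.describes_input I (coalitionCode S)
    refine h.length_lt ?_
    rw [coalitionCode, List.length_ofFn]
    exact h.n_le.trans ((Nat.le_self_pow (by omega) _).trans
      (Nat.le_mul_of_pos_left _ (by omega)))
  · have h := RAM.describes_input I (coalitionCode S)
    have := h.runs_setup.seq h.runs_restrictProg
    rw [← restrict_code] at this
    exact this

theorem polyTime_pull : RAM.PolyTime
    (fun a : Σ I : BMatchingGame, RatVec I.padded.k => a.1.code ++ a.2.code) (fun a => a.1.bStar)
    fun a => (a.1.pull a.2).code := by
  refine .of_runs (.seq RAM.setup RAM.pullProg) 20 (by omega)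
    (fun a => [(a.1.n : ℤ), (a.1.bStar : ℤ), (a.1.slots : ℤ)]) ?_ ?_ <;> rintro ⟨I, y⟩
  · have h := RAM.describes_input I y.code
    have h1 : I.n ≤ 2 * (RAM.bitLength (I.code ++ y.code) + I.bStar + 1) ^ 2 :=
      h.n_le.trans ((Nat.le_self_pow (by omega) _).trans
      (Nat.le_mul_of_pos_left _ (by omega)))
    exact h.length_lt ((h.length_extend_code_le h1 (I.pull y)).trans (by omega))
  · have h := RAM.describes_input I y.code
    have := h.runs_setup.seq h.runs_pullProg
    rw [← pull_code] at this
    exact this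

end BMatchingGame

theorem theorem2 :
    -- the splitting construction, for arbitrary positive real weights
    (∀ (V : Type*) [Fintype V] [DecidableEq V] (G : SimpleGraph V) [DecidableRel G.Adj]
        (b : V → ℕ) (w : Sym2 V → ℝ), (∀ i, 0 < b i) → PositiveWeights G w →
      PositiveWeights (splitGraph G b) (splitWeight G b w) ∧
      Function.Surjective (splitOwner G b) ∧
      (2 ≤ maxCapacity b → width (splitOwner G b) = maxCapacity b) ∧
      (maxCapacity b ≤ 1 → width (id : V → V) = maxCapacity b ∧
        partitionedValue G w (id : V → V) = bMatchingValue G b w) ∧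
      (UniformWeights G w → UniformWeights (splitGraph G b) (splitWeight G b w)) ∧
      (∀ x : V → ℝ, IsAllocation (bMatchingValue G b w) x →
        IsAllocation (partitionedValue (splitGraph G b) (splitWeight G b w) (splitOwner G b))
          (splitVector G w x) ∧
        (x ∈ core (bMatchingValue G b w) ↔ splitVector G w x ∈
          core (partitionedValue (splitGraph G b) (splitWeight G b w) (splitOwner G b))) ∧
        ∀ S : Finset (V ⊕ G.edgeSet),
          Violates (partitionedValue (splitGraph G b) (splitWeight G b w) (splitOwner G b))
            (splitVector G w x) S →
          Violates (bMatchingValue G b w) x S.toLeft) ∧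
      ((core (bMatchingValue G b w)).Nonempty ↔
        (core (partitionedValue (splitGraph G b) (splitWeight G b w)
          (splitOwner G b))).Nonempty)) ∧
    -- the polynomial-time reductions, for positive rational weights
    ∃ (f : BMatchingGame → PartitionedGame)
      (φ : ∀ I : BMatchingGame, RatVec I.n → RatVec (f I).k)
      (γ : ∀ I : BMatchingGame, Finset (Fin (f I).k) → Finset (Fin I.n))
      (ρ : ∀ I : BMatchingGame, RatVec (f I).k → RatVec I.n),
      -- all maps are computable in polynomial time
      RAM.PolyTime BMatchingGame.code BMatchingGame.bStar (fun I => (f I).code) ∧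
      RAM.PolyTime (fun a : Σ I : BMatchingGame, RatVec I.n => a.1.code ++ a.2.code)
        (fun a => a.1.bStar) (fun a => (f a.1).code ++ (φ a.1 a.2).code) ∧
      RAM.PolyTime
        (fun a : Σ I : BMatchingGame, Finset (Fin (f I).k) => a.1.code ++ coalitionCode a.2)
        (fun a => a.1.bStar) (fun a => coalitionCode (γ a.1 a.2)) ∧
      RAM.PolyTime (fun a : Σ I : BMatchingGame, RatVec (f I).k => a.1.code ++ a.2.code)
        (fun a => a.1.bStar) (fun a => (ρ a.1 a.2).code) ∧
      ∀ I : BMatchingGame,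
        -- the width is `b*`, and uniformity is preserved
        width (f I).owner = I.bStar ∧
        (I.Uniform → (f I).Uniform) ∧
        -- P1
        (∀ x : RatVec I.n, IsAllocation I.value x.vec →
          IsAllocation (f I).value (φ I x).vec ∧
          (x.vec ∈ core I.value ↔ (φ I x).vec ∈ core (f I).value) ∧
          ∀ S, Violates (f I).value (φ I x).vec S → Violates I.value x.vec (γ I S)) ∧
        -- P2
        ((core I.value).Nonempty ↔ (core (f I).value).Nonempty) ∧
        -- P3
        (∀ y : RatVec (f I).k, y.vec ∈ core (f I).value → (ρ I y).vec ∈ core I.value) := by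
  refine ⟨fun V _ _ G _ b w hb hw => splitting_construction V G b w hb hw,
    BMatchingGame.padded, BMatchingGame.extend, BMatchingGame.restrict, BMatchingGame.pull,
    BMatchingGame.polyTime_padded, BMatchingGame.polyTime_extend, BMatchingGame.polyTime_restrict,
    BMatchingGame.polyTime_pull, fun I => ?_⟩
  have h := I.coreReduction_padded
  refine ⟨I.width_padded, I.uniform_padded, fun x hx => ?_, h.nonempty_iff, fun y hy => ?_⟩
  · have hV := BMatchingGame.extend_inl x
    have hQ := BMatchingGame.extend_inr x
    refine ⟨(h.isAllocation_iff hV hQ).2 hx, (h.mem_core_iff hV hQ).symm, fun S hS => ?_⟩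
    convert h.violates hV hQ hS
    ext i
    simp [BMatchingGame.restrict]
  · rw [BMatchingGame.vec_pull]
    convert h.pull_mem_core hy
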